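/- Let $M$ be a matroid of rank $r$ on a finite ground set $S$, $|S|=n$. Let $P(M)\subseteq\mathbb R^S$ be the convex hull of the characteristic vectors of its bases, and let $D(M)=\Delta\cap\operatorname{aff}P(M)$, where $\Delta=\{x\in[0,1]^S:\sum_{s\in S}x_s=r\}$. A split flacet of $M$ is a flat $F$ such that $P(M)\cap\{x:\sum_{s\in F}x_s=r_M(F)\}$ is a facet of $P(M)$ and the hyperplane $\{x:\sum_{s\in F}x_s=r_M(F)\}$ meets the relative interior of $D(M)$. The matroid $M$ is a split matroid if, for any two split flacets that define different facets of $P(M)$, the two hyperplanes do not meet in the relative interior of $D(M)$. Two ordered pairs of bases $(A_1,A_2)$ and $(B_1,B_2)$ of $M$ are compatible if $A_1\cap A_2=B_1\cap B_2$ and $A_1\cup A_2=B_1\cup B_2$. A symmetric exchange replaces a pair $(A_1,A_2)$ of bases by $(A_1-e+f,\,A_2+e-f)$, where $e\in A_1-A_2$, $f\in A_2-A_1$ and both new sets are bases. A sequence of symmetric exchanges starting from $(A_1,A_2)$ is strictly monotone for $(A_1,A_2)$ and $(B_1,B_2)$ if each step decreases $|X_1-B_1|$, where $X_1$ is the first member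 of the current pair; it need not reach $(B_1,B_2)$. **Theorem.** There are a single deterministic algorithm, which accesses the matroid only through an independence oracle, and a polynomial $p$ such that the following holds. For every $n$, every split matroid $M$ on a ground set of $n$ elements, and all compatible pairs $(A_1,A_2)$ and $(B_1,B_2)$ of bases of $M$, the algorithm, given $n$ and the four bases, outputs a strictly monotone sequence of symmetric exchanges for $(A_1,A_2)$ and $(B_1,B_2)$ that is longest among all such sequences, using at most $p(n)$ oracle calls and at most $p(n)$ elementary steps (on a random access machine with addition and truncated subtraction of natural numbers as its only arithmetic, each at unit cost). -/

import Mathlib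

noncomputable section

namespace SplitExchange

/-! ### Split matroids, through the matroid base polytope -/

section Polytope

variable {α : Type*} [Fintype α]

/-- The base polytope of `M`: the convex hull of the characteristic vectors of its bases. -/
def basePolytope (M : Matroid α) : Set (α → ℝ) :=
  convexHull ℝ {x | ∃ B : Set α, M.IsBase B ∧ x = B.indicator 1}

/-- The hypersimplex of all vectors of `[0,1]^α` with coordinate sum `r`; it is the base polytope
of the uniform matroid of rank `r`. -/
def hypersimplex (α : Type*) [Fintype α] (r : ℕ) : Set (α → ℝ) :=
  {x | (∀ i, 0 ≤ x i ∧ x i ≤ 1) ∧ ∑ i, x i = r}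

/-- The hypersimplex containing the base polytope, intersected with the affine hull of the base
polytope. For a connected matroid this is the whole hypersimplex; in general it is the product of
the hypersimplices of the connected components. -/
def ambientPolytope (M : Matroid α) : Set (α → ℝ) :=
  hypersimplex α M.eRank.toNat ∩ (affineSpan ℝ (basePolytope M) : Set (α → ℝ))

open Classical in
/-- The hyperplane `x(F) = r_M(F)` of a set `F`. -/
def rankHyperplane (M : Matroid α) (F : Set α) : Set (α → ℝ) :=
  {x | ∑ i, (if i ∈ F then x i else 0) = ((M.eRk F).toNat : ℝ)}

/-- The face of the base polytope on which the valid inequality `x(F) ≤ r_M(F)` is tight. -/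
def rankFace (M : Matroid α) (F : Set α) : Set (α → ℝ) :=
  basePolytope M ∩ rankHyperplane M F

/-- A flacet of `M`: a flat whose face of the base polytope is a facet, that is, a nonempty face of
codimension one. -/
def IsFlacet (M : Matroid α) (F : Set α) : Prop :=
  M.IsFlat F ∧ (rankFace M F).Nonempty ∧
    Module.finrank ℝ (vectorSpan ℝ (rankFace M F)) + 1 =
      Module.finrank ℝ (vectorSpan ℝ (basePolytope M))

/-- A split flacet of `M`: a flacet whose hyperplane splits the ambient polytope, that is, meets its
relative interior. (The other requirement on the hyperplane of a split, that it cuts no edge of the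
polytope in its relative interior, holds automatically: `x(F)` is integral at the vertices, and it
changes by at most one along an edge.) -/
def IsSplitFlacet (M : Matroid α) (F : Set α) : Prop :=
  IsFlacet M F ∧ (rankHyperplane M F ∩ intrinsicInterior ℝ (ambientPolytope M)).Nonempty

/-- A matroid on the finite ground set `α` is split if its split flacets form a compatible system of
splits of the ambient polytope: the hyperplanes of two different splits do not meet in its
relative interior. (Two split flacets that cut out the same facet give the same split.) -/
def IsSplit (M : Matroid α) : Prop :=
  ∀ F G : Set α, IsSplitFlacet M F → IsSplitFlacet M G → rankFace M F ≠ rankFace M G →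
    rankHyperplane M F ∩ rankHyperplane M G ∩ intrinsicInterior ℝ (ambientPolytope M) = ∅

end Polytope

/-! ### Basis pairs and symmetric exchanges -/

section Exchange

variable {α : Type*}

/-- An ordered pair of bases. -/
def IsBasisPair (M : Matroid α) (P : Set α × Set α) : Prop :=
  M.IsBase P.1 ∧ M.IsBase P.2

/-- Compatibility of two pairs of sets. -/
def Compatible (P Q : Set α × Set α) : Prop :=
  P.1 ∩ P.2 = Q.1 ∩ Q.2 ∧ P.1 ∪ P.2 = Q.1 ∪ Q.2

/-- The pair `(P₁ - e + f, P₂ + e - f)`, where `s = (e, f)`. -/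
def swap (P : Set α × Set α) (s : α × α) : Set α × Set α :=
  (insert s.2 (P.1 \ {s.1}), insert s.1 (P.2 \ {s.2}))

/-- The elements `s = (e, f)` define a symmetric exchange for the pair `P`. -/
def IsSymmetricExchange (M : Matroid α) (P : Set α × Set α) (s : α × α) : Prop :=
  s.1 ∈ P.1 \ P.2 ∧ s.2 ∈ P.2 \ P.1 ∧ IsBasisPair M (swap P s)

/-- Performed one after the other from `A` on, the exchanges in the list form a sequence of symmetric
exchanges that is strictly monotone for `A` and `B`: each step decreases the difference between
the first members of the current pair and of `B`. -/
def IsStrictlyMonotone (M : Matroid α) (B : Set α × Set α) :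
    Set α × Set α → List (α × α) → Prop
  | _, [] => True
  | A, s :: l => IsSymmetricExchange M A s ∧
      ((swap A s).1 \ B.1).ncard < (A.1 \ B.1).ncard ∧ IsStrictlyMonotone M B (swap A s) l

/-- The list is a strictly monotone sequence of symmetric exchanges for `A` and `B` of largest
possible length. -/
def IsLongestStrictlyMonotone (M : Matroid α) (A B : Set α × Set α) (l : List (α × α)) : Prop :=
  IsStrictlyMonotone M B A l ∧ ∀ l', IsStrictlyMonotone M B A l' → l'.length ≤ l.length

end Exchange

/-! ### Oracle programs with step counts

A random access machine with registers and arrays holding natural numbers, with addition and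
truncated subtraction as its only arithmetic, and with an independence oracle. -/

/-- Contents of the memory, number of oracle calls and number of steps so far. -/
structure Config where
  reg : ℕ → ℕ
  arr : ℕ → ℕ → ℕ
  calls : ℕ
  steps : ℕ

/-- Arithmetic expressions over registers and array cells. -/
inductive Expr where
  | const (k : ℕ)
  | var (v : ℕ)
  | get (a : ℕ) (i : Expr)
  | add (e f : Expr)
  | sub (e f : Expr)

/-- The value of an expression. -/
def Expr.value (s : Config) : Expr → ℕ
  | .const k => k
  | .var v => s.reg v
  | .get a i => s.arr a (i.value s)
  | .add e f => e.value s + f.value s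
  | .sub e f => e.value s - f.value s

/-- The number of elementary operations in the evaluation of an expression. -/
def Expr.cost : Expr → ℕ
  | .const _ => 1
  | .var _ => 1
  | .get _ i => i.cost + 1
  | .add e f => e.cost + f.cost + 1
  | .sub e f => e.cost + f.cost + 1

/-- Programs. -/
inductive Program where
  /-- do nothing -/
  | skip
  /-- write the value of `e` into the register `v` -/
  | assign (v : ℕ) (e : Expr)
  /-- write the value of `e` into cell `i` of the array `a` -/
  | store (a : ℕ) (i e : Expr)
  /-- ask the oracle whether the set whose characteristic vector is in array `a` is independent;
  write `1` (yes) or `0` (no) into the register `v` -/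
  | query (v a : ℕ)
  /-- first `c`, then `d` -/
  | seq (c d : Program)
  /-- `c` if the value of `e` is not `0`, else `d` -/
  | ite (e : Expr) (c d : Program)
  /-- for `k = 0, …, m - 1`, where `m` is the value of `e` at the beginning: write `k` into the
  register `v` and run `c` -/
  | loop (v : ℕ) (e : Expr) (c : Program)

/-- Let `k` steps pass. -/
def Config.tick (s : Config) (k : ℕ) : Config := { s with steps := s.steps + k }

/-- Write `x` into register `v`. -/
def Config.setReg (s : Config) (v x : ℕ) : Config :=
  { s with reg := Function.update s.reg v x }

/-- Write `x` into cell `i` of array `a`. -/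
def Config.setArr (s : Config) (a i x : ℕ) : Config :=
  { s with arr := Function.update s.arr a (Function.update (s.arr a) i x) }

/-- The subset of the ground set `{0, …, n - 1}` whose characteristic vector is in array `a`. -/
def Config.readSet (s : Config) (n a : ℕ) : Set (Fin n) := {i | s.arr a i ≠ 0}

open Classical in
/-- The run of a program on a ground set of size `n`. The matroid is accessible to the program only
through the oracle `indep`. Every command costs one step, plus the cost of the expressions that it
evaluates, and every round of a loop costs one step besides those of its body. -/
def Program.exec {n : ℕ} (indep : Set (Fin n) → Prop) : Program → Config → Config
  | .skip, s => s.tick 1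
  | .assign v e, s => (s.setReg v (e.value s)).tick (e.cost + 1)
  | .store a i e, s => (s.setArr a (i.value s) (e.value s)).tick (i.cost + e.cost + 1)
  | .query v a, s =>
      { (s.setReg v (if indep (s.readSet n a) then 1 else 0)).tick 1 with calls := s.calls + 1 }
  | .seq c d, s => d.exec indep ((c.exec indep s).tick 1)
  | .ite e c d, s =>
      if e.value s ≠ 0 then c.exec indep (s.tick (e.cost + 1))
      else d.exec indep (s.tick (e.cost + 1))
  | .loop v e c, s =>
      (List.range (e.value s)).foldl (fun t k => c.exec indep ((t.setReg v k).tick 1))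
        (s.tick (e.cost + 1))

open Classical in
/-- The characteristic vector of a set of natural numbers below `n`. -/
def charVec {n : ℕ} (X : Set (Fin n)) (i : ℕ) : ℕ :=
  if ∃ h : i < n, (⟨i, h⟩ : Fin n) ∈ X then 1 else 0

/-- The initial configuration: register `0` holds the size of the ground set, arrays `0`, `1`, `2`,
`3` hold the characteristic vectors of `A₁`, `A₂`, `B₁`, `B₂`, and everything else is `0`. -/
def startConfig {n : ℕ} (A B : Set (Fin n) × Set (Fin n)) : Config where
  reg := fun v => if v = 0 then n else 0
  arr := fun a =>
    if a = 0 then charVec A.1 else if a = 1 then charVec A.2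
    else if a = 2 then charVec B.1 else if a = 3 then charVec B.2 else fun _ => 0
  calls := 0
  steps := 0

/-- The output convention: the list `(x₁, y₁), …, (xₗ, yₗ)` is given by its length `l` in register
`1`, the `xᵢ` in array `4` and the `yᵢ` in array `5`. -/
def Config.Outputs {n : ℕ} (s : Config) (l : List (Fin n × Fin n)) : Prop :=
  s.reg 1 = l.length ∧
    ∀ (i : ℕ) (h : i < l.length), s.arr 4 i = (l[i].1 : ℕ) ∧ s.arr 5 i = (l[i].2 : ℕ)

end SplitExchange

end

/-! Let X be the current pair, P = X₁ \ B₁ and Q = B₁ \ X₁. A strictly monotone step takes p ∈ P and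
q ∈ Q such that X₁ - p + q and X₂ - q + p are bases. Inside a connected component, a missing
exchange is always caused by a cut (`exists_isCut`, `exch_iff_slack`): the complement W of a split
flacet that contains the outgoing but not the incoming element and that the base meets in as few
elements as any base does. Splitness enters only through the polytope: the hyperplanes of two
different cuts would meet in the relative interior unless both cuts lie in the same component K
(`IsCut.eq_component`) and satisfy |K \ (W ∪ W')| + low W + low W' ≤ rk K
(`IsCut.ncard_sdiff_union_le`). Outside K, exchanges are never blocked.

The slack of a cut is the number of elements that a base has in it beyond the minimum. The
inequality bounds the sum of two slacks from below, so X₁ and X₂ give two abstract split systems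
(`SplitSystem`) on the parts of P and Q in K, and the matroid can be forgotten. An obstruction
consists of two tight sets in each system that partition P and Q; together they form four cells, in
each of which the numbers of elements of P and Q differ by d > 0. Allowed exchanges stay inside a
cell, so d never changes (`Obstruction.next`), and a sequence that gets stuck leaves exactly 2d
elements unexchanged (`Obstruction.card_eq_of_stuck`). Thus all maximal sequences from an obstructed
pair are equally long. The combinatorial core is `exists_allowed_not_obstructed`: without an
obstruction and with P nonempty, some exchange leads to a pair that is again without an obstruction,
so everything can be exchanged.

Hence a greedy choice is optimal: take an exchange to an unobstructed pair if there is one, and any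
exchange otherwise (`Run.isLongest`). Obstructions show in the exchange relations of four elements
and in two counts (`Pattern`, `pattern_allowed_iff`), so an independence oracle detects them within
a fixed number of nested loops of length n. The test is written as a term with sums as quantifiers
and compiled into a program (`Term.exec_compile`); since every loop has n rounds, calls and steps
are polynomially bounded (`Program.Tame.exec_le`). -/

namespace SplitExchange

/-! ### Terms, their compilation, and running times -/

section Machine

/-- The value of an expression depends only on the memory. -/
def Expr.eval (e : Expr) (reg : ℕ → ℕ) (arr : ℕ → ℕ → ℕ) : ℕ := e.value ⟨reg, arr, 0, 0⟩

lemma Expr.value_eq_eval (e : Expr) (s : Config) : e.value s = e.eval s.reg s.arr := by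
  induction e with
  | const k => rfl
  | var v => rfl
  | get a i ih => simp only [Expr.value, Expr.eval, ih]
  | add e f ihe ihf => simp only [Expr.value, Expr.eval, ihe, ihf]
  | sub e f ihe ihf => simp only [Expr.value, Expr.eval, ihe, ihf]

@[simp] lemma Expr.eval_const (k : ℕ) (reg arr) : (Expr.const k).eval reg arr = k := rfl
@[simp] lemma Expr.eval_var (v : ℕ) (reg arr) : (Expr.var v).eval reg arr = reg v := rfl
@[simp] lemma Expr.eval_get (a : ℕ) (i : Expr) (reg arr) :
    (Expr.get a i).eval reg arr = arr a (i.eval reg arr) := rfl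
@[simp] lemma Expr.eval_add (e f : Expr) (reg arr) :
    (Expr.add e f).eval reg arr = e.eval reg arr + f.eval reg arr := rfl
@[simp] lemma Expr.eval_sub (e f : Expr) (reg arr) :
    (Expr.sub e f).eval reg arr = e.eval reg arr - f.eval reg arr := rfl

/-- A bound on the registers in an expression. -/
def Expr.bound : Expr → ℕ
  | .const _ => 0
  | .var v => v + 1
  | .get _ i => i.bound
  | .add e f => max e.bound f.bound
  | .sub e f => max e.bound f.bound

lemma Expr.eval_congr (e : Expr) {reg reg' : ℕ → ℕ} (arr : ℕ → ℕ → ℕ)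
    (h : ∀ v < e.bound, reg v = reg' v) : e.eval reg arr = e.eval reg' arr := by
  induction e with
  | const k => rfl
  | var v => exact h v (Nat.lt_succ_self v)
  | get a i ih => simp only [Expr.eval_get, ih h]
  | add e f ihe ihf =>
    simp only [Expr.eval_add, ihe fun v hv => h v (lt_of_lt_of_le hv (le_max_left _ _)),
      ihf fun v hv => h v (lt_of_lt_of_le hv (le_max_right _ _))]
  | sub e f ihe ihf =>
    simp only [Expr.eval_sub, ihe fun v hv => h v (lt_of_lt_of_le hv (le_max_left _ _)),
      ihf fun v hv => h v (lt_of_lt_of_le hv (le_max_right _ _))]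

/-- Terms: expressions, oracle answers, and sums over the ground set. -/
inductive Term where
  | ex (e : Expr)
  /-- the oracle answer for the set in an array -/
  | query (a : ℕ)
  | add (t u : Term)
  | sub (t u : Term)
  | ite (c t u : Term)
  /-- the sum over all values below `n` of a register -/
  | sum (v : ℕ) (t : Term)
  /-- the value after an array cell has been overwritten -/
  | update (a : ℕ) (i e : Expr) (t : Term)

open Classical in
/-- The value of a term. -/
noncomputable def Term.den {n : ℕ} (indep : Set (Fin n) → Prop) : Term → (ℕ → ℕ) → (ℕ → ℕ → ℕ) → ℕ
  | .ex e, reg, arr => e.eval reg arr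
  | .query a, _, arr => if indep {i | arr a i ≠ 0} then 1 else 0
  | .add t u, reg, arr => t.den indep reg arr + u.den indep reg arr
  | .sub t u, reg, arr => t.den indep reg arr - u.den indep reg arr
  | .ite c t u, reg, arr => if c.den indep reg arr ≠ 0 then t.den indep reg arr
      else u.den indep reg arr
  | .sum v t, reg, arr => ∑ k ∈ Finset.range (reg 0), t.den indep (Function.update reg v k) arr
  | .update a i e t, reg, arr => t.den indep reg
      (Function.update arr a (Function.update (arr a) (i.eval reg arr) (e.eval reg arr)))

/-- A bound on the registers in a term. -/
def Term.bound : Term → ℕ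
  | .ex e => e.bound
  | .query _ => 0
  | .add t u => max t.bound u.bound
  | .sub t u => max t.bound u.bound
  | .ite c t u => max c.bound (max t.bound u.bound)
  | .sum v t => max (max 1 (v + 1)) t.bound
  | .update _ i e t => max (max i.bound e.bound) t.bound

/-- Compiled code uses the registers from some `d` on as scratch memory; terms with bound at most
`d` do not notice. -/
lemma Term.den_congr {n : ℕ} (indep : Set (Fin n) → Prop) (t : Term) {reg reg' : ℕ → ℕ}
    (arr : ℕ → ℕ → ℕ) (h : ∀ v < t.bound, reg v = reg' v) :
    t.den indep reg arr = t.den indep reg' arr := by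
  induction t generalizing reg reg' arr with
  | ex e => exact e.eval_congr arr h
  | query a => rfl
  | add t u iht ihu =>
    simp only [Term.den, iht arr fun v hv => h v (lt_of_lt_of_le hv (le_max_left _ _)),
      ihu arr fun v hv => h v (lt_of_lt_of_le hv (le_max_right _ _))]
  | sub t u iht ihu =>
    simp only [Term.den, iht arr fun v hv => h v (lt_of_lt_of_le hv (le_max_left _ _)),
      ihu arr fun v hv => h v (lt_of_lt_of_le hv (le_max_right _ _))]
  | ite c t u ihc iht ihu =>
    simp only [Term.den, ihc arr fun v hv => h v (lt_of_lt_of_le hv (le_max_left _ _)),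
      iht arr fun v hv => h v (lt_of_lt_of_le hv ((le_max_left _ _).trans (le_max_right _ _))),
      ihu arr fun v hv => h v (lt_of_lt_of_le hv ((le_max_right _ _).trans (le_max_right _ _)))]
  | sum w t ih =>
    simp only [Term.den]
    rw [h 0 (by simp [Term.bound])]
    refine Finset.sum_congr rfl fun k _ => ih arr fun v hv => ?_
    rcases eq_or_ne v w with rfl | hvw
    · simp
    · simp [hvw, h v (lt_of_lt_of_le hv (le_max_right _ _))]
  | update a i e t ih =>
    simp only [Term.den]
    rw [i.eval_congr arr fun v hv => h v
        (lt_of_lt_of_le hv ((le_max_left _ _).trans (le_max_left _ _))),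
      e.eval_congr arr fun v hv => h v
        (lt_of_lt_of_le hv ((le_max_right _ _).trans (le_max_left _ _)))]
    exact ih _ fun v hv => h v (lt_of_lt_of_le hv (le_max_right _ _))

/-- A program that writes the value of a term into register `d`, using only registers from `d` on,
except for temporary changes of bound registers and arrays. -/
def Term.compile : Term → ℕ → Program
  | .ex e, d => .assign d e
  | .query a, d => .query d a
  | .add t u, d => .seq (t.compile d) (.seq (u.compile (d + 1))
      (.assign d (.add (.var d) (.var (d + 1)))))
  | .sub t u, d => .seq (t.compile d) (.seq (u.compile (d + 1))
      (.assign d (.sub (.var d) (.var (d + 1)))))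
  | .ite c t u, d => .seq (c.compile d) (.ite (.var d) (t.compile d) (u.compile d))
  -- The loop overwrites `v`, so its old value is kept in `d + 1` and restored at the end; the sum
  -- accumulates in `d`.
  | .sum v t, d => .seq (.assign (d + 1) (.var v)) (.seq (.assign d (.const 0))
      (.seq (.loop v (.var 0) (.seq (t.compile (d + 2))
        (.assign d (.add (.var d) (.var (d + 2)))))) (.assign v (.var (d + 1)))))
  -- Besides the old content of the cell, its index is saved: `i` may itself read the array `a`, so
  -- evaluating it again later could give another cell.
  | .update a i e t, d => .seq (.assign (d + 1) (.get a i)) (.seq (.assign (d + 2) i)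
      (.seq (.store a i e) (.seq (t.compile (d + 3))
        (.seq (.assign d (.var (d + 3))) (.store a (.var (d + 2)) (.var (d + 1)))))))

variable {n : ℕ} (indep : Set (Fin n) → Prop)

@[simp] lemma exec_seq_reg (c d : Program) (s : Config) :
    ((Program.seq c d).exec indep s) = d.exec indep ((c.exec indep s).tick 1) := rfl
@[simp] lemma tick_reg (s : Config) (k : ℕ) : (s.tick k).reg = s.reg := rfl
@[simp] lemma tick_arr (s : Config) (k : ℕ) : (s.tick k).arr = s.arr := rfl
@[simp] lemma exec_assign_reg (v : ℕ) (e : Expr) (s : Config) :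
    ((Program.assign v e).exec indep s).reg = Function.update s.reg v (e.eval s.reg s.arr) := by
  rw [← Expr.value_eq_eval]; rfl
@[simp] lemma exec_assign_arr (v : ℕ) (e : Expr) (s : Config) :
    ((Program.assign v e).exec indep s).arr = s.arr := rfl
@[simp] lemma exec_store_reg (a : ℕ) (i e : Expr) (s : Config) :
    ((Program.store a i e).exec indep s).reg = s.reg := rfl
@[simp] lemma exec_store_arr (a : ℕ) (i e : Expr) (s : Config) :
    ((Program.store a i e).exec indep s).arr = Function.update s.arr a
      (Function.update (s.arr a) (i.eval s.reg s.arr) (e.eval s.reg s.arr)) := by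
  simp only [← Expr.value_eq_eval]; rfl
open Classical in
@[simp] lemma exec_query_reg (v a : ℕ) (s : Config) :
    ((Program.query v a).exec indep s).reg =
      Function.update s.reg v (if indep {i | s.arr a i ≠ 0} then 1 else 0) := rfl
lemma exec_ite (e : Expr) (c d : Program) (s : Config) :
    ((Program.ite e c d).exec indep s) = if e.eval s.reg s.arr ≠ 0
      then c.exec indep (s.tick (e.cost + 1)) else d.exec indep (s.tick (e.cost + 1)) := by
  rw [← Expr.value_eq_eval]; rfl
lemma exec_loop (v : ℕ) (e : Expr) (c : Program) (s : Config) :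
    ((Program.loop v e c).exec indep s) = (List.range (e.eval s.reg s.arr)).foldl
      (fun t k => c.exec indep ((t.setReg v k).tick 1)) (s.tick (e.cost + 1)) := by
  rw [← Expr.value_eq_eval]; rfl
@[simp] lemma setReg_reg (s : Config) (v x : ℕ) :
    (s.setReg v x).reg = Function.update s.reg v x := rfl
@[simp] lemma setReg_arr (s : Config) (v x : ℕ) : (s.setReg v x).arr = s.arr := rfl

/-- A loop keeps an invariant. -/
lemma exec_loop_induction {v : ℕ} {e : Expr} {c : Program} {s : Config}
    (I : ℕ → Config → Prop) (h0 : I 0 (s.tick (e.cost + 1)))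
    (hs : ∀ k t, k < e.eval s.reg s.arr → I k t →
      I (k + 1) (c.exec indep ((t.setReg v k).tick 1))) :
    I (e.eval s.reg s.arr) ((Program.loop v e c).exec indep s) := by
  rw [exec_loop]
  have key : ∀ m ≤ e.eval s.reg s.arr, I m ((List.range m).foldl
      (fun t k => c.exec indep ((t.setReg v k).tick 1)) (s.tick (e.cost + 1))) := by
    intro m hm
    induction m with
    | zero => exact h0
    | succ m ih =>
      rw [List.range_succ, List.foldl_append]
      exact hs m _ hm (ih (by omega))
  exact key _ le_rfl

/-- The compiled term computes the value of the term. -/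
theorem Term.exec_compile (t : Term) (d : ℕ) (hd : t.bound ≤ d) (s : Config) :
    ((t.compile d).exec indep s).reg d = t.den indep s.reg s.arr ∧
    (∀ v < d, ((t.compile d).exec indep s).reg v = s.reg v) ∧
    ((t.compile d).exec indep s).arr = s.arr := by
  induction t generalizing d s with
  | ex e =>
    refine ⟨by simp [Term.compile, Term.den], fun v hv => ?_, rfl⟩
    simp [Term.compile, hv.ne]
  | query a =>
    refine ⟨by simp [Term.compile, Term.den], fun v hv => ?_, rfl⟩
    simp [Term.compile, hv.ne]
  | add t u iht ihu =>
    obtain ⟨h1, h2⟩ := max_le_iff.1 hd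
    obtain ⟨a1, a2, a3⟩ := iht d h1 s
    obtain ⟨b1, b2, b3⟩ := ihu (d + 1) (by omega) (((t.compile d).exec indep s).tick 1)
    have hu : u.den indep ((t.compile d).exec indep s).reg s.arr = u.den indep s.reg s.arr :=
      u.den_congr indep _ fun v hv => a2 v (by omega)
    refine ⟨?_, fun v hv => ?_, ?_⟩
    · simp only [Term.compile, exec_seq_reg, exec_assign_reg, tick_reg, Function.update_self,
        Expr.eval_add, Expr.eval_var, b1, b2 d (by omega), tick_arr, a1, a3, hu, Term.den]
    · simp only [Term.compile, exec_seq_reg, exec_assign_reg, tick_reg,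
        Function.update_of_ne hv.ne, b2 v (by omega), a2 v hv]
    · simp only [Term.compile, exec_seq_reg, exec_assign_arr, tick_arr, b3, a3]
  | sub t u iht ihu =>
    obtain ⟨h1, h2⟩ := max_le_iff.1 hd
    obtain ⟨a1, a2, a3⟩ := iht d h1 s
    obtain ⟨b1, b2, b3⟩ := ihu (d + 1) (by omega) (((t.compile d).exec indep s).tick 1)
    have hu : u.den indep ((t.compile d).exec indep s).reg s.arr = u.den indep s.reg s.arr :=
      u.den_congr indep _ fun v hv => a2 v (by omega)
    refine ⟨?_, fun v hv => ?_, ?_⟩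
    · simp only [Term.compile, exec_seq_reg, exec_assign_reg, tick_reg, Function.update_self,
        Expr.eval_sub, Expr.eval_var, b1, b2 d (by omega), tick_arr, a1, a3, hu, Term.den]
    · simp only [Term.compile, exec_seq_reg, exec_assign_reg, tick_reg,
        Function.update_of_ne hv.ne, b2 v (by omega), a2 v hv]
    · simp only [Term.compile, exec_seq_reg, exec_assign_arr, tick_arr, b3, a3]
  | ite c t u ihc iht ihu =>
    obtain ⟨h0, h12⟩ := max_le_iff.1 hd
    obtain ⟨h1, h2⟩ := max_le_iff.1 h12
    obtain ⟨a1, a2, a3⟩ := ihc d h0 s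
    have ht : t.den indep ((c.compile d).exec indep s).reg s.arr = t.den indep s.reg s.arr :=
      t.den_congr indep _ fun v hv => a2 v (by omega)
    have hu : u.den indep ((c.compile d).exec indep s).reg s.arr = u.den indep s.reg s.arr :=
      u.den_congr indep _ fun v hv => a2 v (by omega)
    simp only [Term.compile, exec_seq_reg, exec_ite, Expr.eval_var, tick_reg, a1, Term.den]
    by_cases hc : c.den indep s.reg s.arr ≠ 0
    · rw [if_pos hc, if_pos hc]
      obtain ⟨b1, b2, b3⟩ := iht d h1
        ((((c.compile d).exec indep s).tick 1).tick ((Expr.var d).cost + 1))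
      refine ⟨?_, fun v hv => ?_, ?_⟩
      · rw [b1]; simp only [tick_reg, tick_arr, a3, ht]
      · rw [b2 v hv]; simp only [tick_reg, a2 v hv]
      · rw [b3]; simp only [tick_arr, a3]
    · rw [if_neg hc, if_neg hc]
      obtain ⟨b1, b2, b3⟩ := ihu d h2
        ((((c.compile d).exec indep s).tick 1).tick ((Expr.var d).cost + 1))
      refine ⟨?_, fun v hv => ?_, ?_⟩
      · rw [b1]; simp only [tick_reg, tick_arr, a3, hu]
      · rw [b2 v hv]; simp only [tick_reg, a2 v hv]
      · rw [b3]; simp only [tick_arr, a3]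
  | sum w t ih =>
    obtain ⟨h1, h2⟩ := max_le_iff.1 hd
    obtain ⟨h0, hw⟩ := max_le_iff.1 h1
    simp only [Term.compile, exec_seq_reg]
    set s₁ := (((Program.assign d (.const 0)).exec indep
      (((Program.assign (d + 1) (.var w)).exec indep s).tick 1)).tick 1) with hs₁
    have e0 : (Expr.var 0).eval s₁.reg s₁.arr = s.reg 0 := by
      simp [hs₁, show (0 : ℕ) ≠ d by omega]
    have key := exec_loop_induction indep (v := w) (e := .var 0)
      (c := .seq (t.compile (d + 2)) (.assign d (.add (.var d) (.var (d + 2))))) (s := s₁)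
      (fun k r => r.reg d = ∑ k ∈ Finset.range k, t.den indep (Function.update s.reg w k) s.arr ∧
        (∀ v < d, v ≠ w → r.reg v = s.reg v) ∧ r.reg (d + 1) = s.reg w ∧ r.arr = s.arr) ?_ ?_
    · rw [e0] at key
      obtain ⟨k1, k2, k3, k4⟩ := key
      refine ⟨?_, fun v hv => ?_, ?_⟩
      · simp only [exec_assign_reg, tick_reg, Term.den]
        rw [Function.update_of_ne (by omega), k1]
      · simp only [exec_assign_reg, tick_reg, tick_arr, Expr.eval_var]
        rcases eq_or_ne v w with rfl | hvw
        · rw [Function.update_self, k3]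
        · rw [Function.update_of_ne hvw, k2 v hv hvw]
      · simp only [exec_assign_arr, tick_arr, k4]
    · refine ⟨by simp [hs₁], fun v hv hvw => ?_, ?_, ?_⟩
      · simp [hs₁, hv.ne, show v ≠ d + 1 by omega]
      · simp [hs₁]
      · simp [hs₁]
    · rintro k r - ⟨k1, k2, k3, k4⟩
      obtain ⟨b1, b2, b3⟩ := ih (d + 2) (by omega) ((r.setReg w k).tick 1)
      have hden : t.den indep (Function.update r.reg w k) s.arr =
          t.den indep (Function.update s.reg w k) s.arr := by
        refine t.den_congr indep _ fun v hv => ?_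
        rcases eq_or_ne v w with rfl | hvw
        · simp
        · simp [hvw, k2 v (by omega) hvw]
      refine ⟨?_, fun v hv hvw => ?_, ?_, ?_⟩
      · simp only [exec_seq_reg, exec_assign_reg, tick_reg, Function.update_self, Expr.eval_add,
          Expr.eval_var, b1, b2 d (by omega), setReg_reg, tick_arr, setReg_arr, k4, hden]
        rw [Function.update_of_ne (by omega), k1, Finset.sum_range_succ]
      · simp only [exec_seq_reg, exec_assign_reg, tick_reg]
        rw [Function.update_of_ne hv.ne, b2 v (by omega)]
        simp [hvw, k2 v hv hvw]
      · simp only [exec_seq_reg, exec_assign_reg, tick_reg]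
        rw [Function.update_of_ne (by omega), b2 (d + 1) (by omega)]
        simp [show d + 1 ≠ w by omega, k3]
      · simp only [exec_seq_reg, exec_assign_arr, tick_arr, b3, setReg_arr, k4]
  | update a i e t ih =>
    obtain ⟨h1, h2⟩ := max_le_iff.1 hd
    obtain ⟨hi, he⟩ := max_le_iff.1 h1
    simp only [Term.compile, exec_seq_reg]
    set s₁ := (((Program.assign (d + 2) i).exec indep
      (((Program.assign (d + 1) (.get a i)).exec indep s).tick 1)).tick 1) with hs₁
    have r1 : ∀ v < d + 1, s₁.reg v = s.reg v := by
      intro v hv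
      simp [hs₁, show v ≠ d + 1 by omega, show v ≠ d + 2 by omega]
    have ei : ∀ arr, i.eval s₁.reg arr = i.eval s.reg arr :=
      fun arr => i.eval_congr arr fun v hv => r1 v (by omega)
    have ee : ∀ arr, e.eval s₁.reg arr = e.eval s.reg arr :=
      fun arr => e.eval_congr arr fun v hv => r1 v (by omega)
    have r2 : s₁.reg (d + 1) = s.arr a (i.eval s.reg s.arr) := by simp [hs₁]
    have r3 : s₁.reg (d + 2) = i.eval s.reg s.arr := by
      simp only [hs₁, exec_assign_reg, tick_reg, Function.update_self, tick_arr, exec_assign_arr]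
      exact i.eval_congr _ fun v hv => by simp [show v ≠ d + 1 by omega]
    have r4 : s₁.arr = s.arr := by simp [hs₁]
    obtain ⟨b1, b2, b3⟩ := ih (d + 3) (by omega)
      (((Program.store a i e).exec indep s₁).tick 1)
    set s₂ := (t.compile (d + 3)).exec indep (((Program.store a i e).exec indep s₁).tick 1)
    simp only [tick_reg, tick_arr, exec_store_reg, exec_store_arr, r4, ei, ee] at b1 b2 b3
    refine ⟨?_, fun v hv => ?_, ?_⟩
    · simp only [exec_store_reg, tick_reg, exec_assign_reg, Function.update_self, Expr.eval_var, b1,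
        Term.den]
      exact t.den_congr indep _ fun v hv => r1 v (by omega)
    · simp only [exec_store_reg, tick_reg, exec_assign_reg]
      rw [Function.update_of_ne hv.ne, b2 v (by omega), r1 v (by omega)]
    · simp only [exec_store_arr, tick_arr, exec_assign_arr, tick_reg, exec_assign_reg,
        Expr.eval_var, b3, show d + 2 ≠ d by omega, show d + 1 ≠ d by omega, ne_eq,
        not_false_eq_true, Function.update_of_ne, b2 (d + 1) (by omega), b2 (d + 2) (by omega), r2,
        r3]
      simp

/-! ### Running times -/

/-- Programs that do not write into register `0` and all of whose loops run up to its value. -/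
def Program.Tame : Program → Prop
  | .skip => True
  | .assign v _ => v ≠ 0
  | .store _ _ _ => True
  | .query v _ => v ≠ 0
  | .seq c d => c.Tame ∧ d.Tame
  | .ite _ c d => c.Tame ∧ d.Tame
  | .loop v e c => v ≠ 0 ∧ e = .var 0 ∧ c.Tame

/-- A bound on the numbers of steps and oracle calls of a tame program. -/
noncomputable def Program.time : Program → Polynomial ℕ
  | .skip => 1
  | .assign _ e => Polynomial.C (e.cost + 1)
  | .store _ i e => Polynomial.C (i.cost + e.cost + 1)
  | .query _ _ => 1
  | .seq c d => c.time + d.time + 1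
  | .ite e c d => Polynomial.C (e.cost + 1) + c.time + d.time
  | .loop _ e c => Polynomial.C (e.cost + 1) + Polynomial.X * (c.time + 1)

/-- Register `0` keeps its value throughout, so every loop, however deeply nested, has the same
number of rounds. Conditionals are charged for both branches. -/
theorem Program.Tame.exec_le {c : Program} (hc : c.Tame) (s : Config) :
    (c.exec indep s).reg 0 = s.reg 0 ∧
    (c.exec indep s).calls ≤ s.calls + c.time.eval (s.reg 0) ∧
    (c.exec indep s).steps ≤ s.steps + c.time.eval (s.reg 0) := by
  induction c generalizing s with
  | skip => simp [Program.exec, Program.time, Config.tick]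
  | assign v e =>
    refine ⟨?_, ?_⟩
    · rw [exec_assign_reg, Function.update_of_ne (Ne.symm hc)]
    · simp [Program.exec, Program.time, Config.tick, Config.setReg]
  | store a i e => simp [Program.exec, Program.time, Config.tick, Config.setArr]
  | query v a =>
    refine ⟨?_, ?_⟩
    · rw [exec_query_reg, Function.update_of_ne (Ne.symm hc)]
    · simp [Program.exec, Program.time, Config.tick, Config.setReg]
  | seq c d ihc ihd =>
    obtain ⟨a1, a2, a3⟩ := ihc hc.1 s
    obtain ⟨b1, b2, b3⟩ := ihd hc.2 ((c.exec indep s).tick 1)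
    simp only [tick_reg, a1] at b1 b2 b3
    simp only [exec_seq_reg, Program.time, Polynomial.eval_add, Polynomial.eval_one]
    simp only [Config.tick] at b2 b3 ⊢
    exact ⟨b1, by omega, by omega⟩
  | ite e c d ihc ihd =>
    obtain ⟨a1, a2, a3⟩ := ihc hc.1 (s.tick (e.cost + 1))
    obtain ⟨b1, b2, b3⟩ := ihd hc.2 (s.tick (e.cost + 1))
    rw [exec_ite]
    simp only [tick_reg] at a1 a2 a3 b1 b2 b3
    simp only [Program.time, Polynomial.eval_add, Polynomial.eval_C]
    simp only [Config.tick] at a1 a2 a3 b1 b2 b3 ⊢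
    split_ifs
    · exact ⟨a1, by omega, by omega⟩
    · exact ⟨b1, by omega, by omega⟩
  | loop v e c ih =>
    obtain ⟨hv, rfl, hc⟩ := hc
    have key := exec_loop_induction indep (v := v) (e := .var 0) (c := c) (s := s)
      (fun k r => r.reg 0 = s.reg 0 ∧ r.calls ≤ s.calls + k * (c.time.eval (s.reg 0) + 1) ∧
        r.steps ≤ s.steps + ((Expr.var 0).cost + 1) + k * (c.time.eval (s.reg 0) + 1)) ?_ ?_
    · obtain ⟨k1, k2, k3⟩ := key
      simp only [Expr.eval_var] at k1 k2 k3
      simp only [Program.time, Polynomial.eval_add, Polynomial.eval_C, Polynomial.eval_mul,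
        Polynomial.eval_X, Polynomial.eval_one]
      exact ⟨k1, by omega, by omega⟩
    · simp [Config.tick]
    · rintro k r - ⟨k1, k2, k3⟩
      obtain ⟨a1, a2, a3⟩ := ih hc ((r.setReg v k).tick 1)
      simp only [tick_reg, setReg_reg, Function.update_of_ne (Ne.symm hv), k1] at a1 a2 a3
      simp only [Config.tick, Config.setReg] at a1 a2 a3 ⊢
      rw [Nat.succ_mul]
      exact ⟨a1, by omega, by omega⟩

/-- Terms that do not bind register `0`. -/
def Term.Tame : Term → Prop
  | .ex _ => True
  | .query _ => True
  | .add t u => t.Tame ∧ u.Tame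
  | .sub t u => t.Tame ∧ u.Tame
  | .ite c t u => c.Tame ∧ t.Tame ∧ u.Tame
  | .sum v t => v ≠ 0 ∧ t.Tame
  | .update _ _ _ t => t.Tame

lemma Term.Tame.compile {t : Term} (ht : t.Tame) {d : ℕ} (hd : d ≠ 0) : (t.compile d).Tame := by
  induction t generalizing d with
  | ex e => exact hd
  | query a => exact hd
  | add t u iht ihu => exact ⟨iht ht.1 hd, ihu ht.2 (by omega), hd⟩
  | sub t u iht ihu => exact ⟨iht ht.1 hd, ihu ht.2 (by omega), hd⟩
  | ite c t u ihc iht ihu => exact ⟨ihc ht.1 hd, iht ht.2.1 hd, ihu ht.2.2 hd⟩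
  | sum v t ih =>
    exact ⟨Nat.succ_ne_zero d, hd, ⟨ht.1, rfl, ih ht.2 (by omega), hd⟩, ht.1⟩
  | update a i e t ih =>
    exact ⟨Nat.succ_ne_zero _, Nat.succ_ne_zero _, trivial, ih ht (by omega), hd, trivial⟩

end Machine
/-! ### Split systems -/

section SplitSystem

variable {α ι κ : Type*} [DecidableEq α]

/-- A family of sets with slacks, as it arises from the hyperedges of a split matroid and a basis
from which the elements of `P` have to be replaced by those of `Q`. -/
structure SplitSystem (P Q : Finset α) (A : ι → Finset α) (s : ι → ℤ) : Prop where
  nonneg : ∀ i, 0 ≤ s i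
  -- The slack is still nonnegative once all of P has been replaced by Q.
  target : ∀ i, ((Q ∩ A i).card : ℤ) ≤ s i + (P ∩ A i).card
  -- This is the only trace of splitness; for cuts it comes from `IsMain.pair_le`.
  pair : ∀ i j, i ≠ j →
    ((Q ∩ (A i ∩ A j)).card : ℤ) + (P \ (A i ∪ A j)).card ≤ s i + s j

/-- The slack after `p` has been replaced by `q`. -/
def nextSlack (A : ι → Finset α) (s : ι → ℤ) (p q : α) (i : ι) : ℤ :=
  s i + (if p ∈ A i then 1 else 0) - (if q ∈ A i then 1 else 0)

/-- No tight set is violated when `p` is replaced by `q`. -/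
def Allowed (A : ι → Finset α) (s : ι → ℤ) (p q : α) : Prop :=
  ∀ i, s i = 0 → q ∈ A i → p ∈ A i

/-- Two different tight sets that partition both `P` and `Q`. -/
structure TightPartition (P Q : Finset α) (A : ι → Finset α) (s : ι → ℤ) (i j : ι) : Prop where
  ne : i ≠ j
  left : s i = 0
  right : s j = 0
  memP : ∀ x ∈ P, x ∈ A j ↔ x ∉ A i
  memQ : ∀ x ∈ Q, x ∈ A j ↔ x ∉ A i

/-- Two tight partitions that obstruct exactly `2 * d` exchanges. -/
structure Obstruction (P Q : Finset α) (A : ι → Finset α) (s : ι → ℤ) (B : κ → Finset α)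
    (t : κ → ℤ) (i₁ i₂ : ι) (j₁ j₂ : κ) (d : ℕ) : Prop where
  fst : TightPartition P Q A s i₁ i₂
  snd : TightPartition P Q B t j₁ j₂
  card_eq : (P ∩ (A i₁ ∩ B j₁)).card = (Q ∩ (A i₁ ∩ B j₁)).card + d
  pos : 0 < d

/-- There is an obstruction. -/
def Obstructed (P Q : Finset α) (A : ι → Finset α) (s : ι → ℤ) (B : κ → Finset α)
    (t : κ → ℤ) (d : ℕ) : Prop :=
  ∃ i₁ i₂ j₁ j₂, Obstruction P Q A s B t i₁ i₂ j₁ j₂ d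

variable {P Q : Finset α} {A : ι → Finset α} {s : ι → ℤ} {B : κ → Finset α} {t : κ → ℤ}
  {i j i₁ i₂ : ι} {j₁ j₂ : κ} {p q x y : α} {d : ℕ}

lemma card_erase_inter (hp : p ∈ P) (C : Finset α) :
    (((P.erase p) ∩ C).card : ℤ) = (P ∩ C).card - (if p ∈ C then 1 else 0) := by
  rw [Finset.erase_inter]
  split_ifs with h
  · rw [Finset.card_erase_of_mem (Finset.mem_inter.2 ⟨hp, h⟩)]
    have : 0 < (P ∩ C).card := Finset.card_pos.2 ⟨p, Finset.mem_inter.2 ⟨hp, h⟩⟩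
    omega
  · rw [Finset.erase_eq_of_notMem (by simp [h])]; simp

lemma card_erase_sdiff (hp : p ∈ P) (C : Finset α) :
    (((P.erase p) \ C).card : ℤ) = (P \ C).card - (if p ∈ C then 0 else 1) := by
  rw [Finset.erase_sdiff_comm]
  split_ifs with h
  · rw [Finset.erase_eq_of_notMem (by simp [h])]; simp
  · rw [Finset.card_erase_of_mem (Finset.mem_sdiff.2 ⟨hp, h⟩)]
    have : 0 < (P \ C).card := Finset.card_pos.2 ⟨p, Finset.mem_sdiff.2 ⟨hp, h⟩⟩
    omega

/-- In the pair bound, the right side minus the left side grows by at least 1 through p and drops by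
at most 1 through q, so it survives every exchange. Allowedness is what keeps the slacks
nonnegative. -/
lemma SplitSystem.next (h : SplitSystem P Q A s) (hp : p ∈ P) (hq : q ∈ Q)
    (ha : Allowed A s p q) :
    SplitSystem (P.erase p) (Q.erase q) A (nextSlack A s p q) where
  nonneg i := by
    have h1 := h.nonneg i
    have h2 := ha i
    unfold nextSlack
    split_ifs <;> grind
  target i := by
    have h1 := h.target i
    rw [card_erase_inter hp, card_erase_inter hq]
    unfold nextSlack
    split_ifs <;> omega
  pair i j hij := by
    have h1 := h.pair i j hij
    rw [card_erase_sdiff hp, card_erase_inter hq]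
    unfold nextSlack
    by_cases h1 : p ∈ A i <;> by_cases h2 : p ∈ A j <;> by_cases h3 : q ∈ A i <;>
      by_cases h4 : q ∈ A j <;> simp [h1, h2, h3, h4] <;> omega

/-- The pair bound leaves no room: different tight sets are disjoint on Q and, by the next lemma,
together cover P. -/
lemma SplitSystem.notMem_of_add_le_zero (h : SplitSystem P Q A s) (hij : i ≠ j)
    (hs : s i + s j ≤ 0) (hx : x ∈ Q) (hi : x ∈ A i) : x ∉ A j := by
  intro hj
  have h1 := h.pair i j hij
  have : 0 < (Q ∩ (A i ∩ A j)).card := Finset.card_pos.2 ⟨x, by simp [*]⟩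
  omega

lemma SplitSystem.mem_of_add_le_zero (h : SplitSystem P Q A s) (hij : i ≠ j)
    (hs : s i + s j ≤ 0) (hx : x ∈ P) (hi : x ∉ A i) : x ∈ A j := by
  by_contra hj
  have h1 := h.pair i j hij
  have : 0 < (P \ (A i ∪ A j)).card := Finset.card_pos.2 ⟨x, by simp [*]⟩
  omega

/-- The common element of Q uses up the single unit of the pair bound. -/
lemma SplitSystem.mem_of_add_le_one (h : SplitSystem P Q A s) (hij : i ≠ j)
    (hs : s i + s j ≤ 1) (hy : y ∈ Q) (hyi : y ∈ A i) (hyj : y ∈ A j) (hx : x ∈ P)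
    (hi : x ∉ A i) : x ∈ A j := by
  by_contra hj
  have h1 := h.pair i j hij
  have : 0 < (P \ (A i ∪ A j)).card := Finset.card_pos.2 ⟨x, by simp [*]⟩
  have : 0 < (Q ∩ (A i ∩ A j)).card := Finset.card_pos.2 ⟨y, by simp [*]⟩
  omega

lemma TightPartition.symm (h : TightPartition P Q A s i j) : TightPartition P Q A s j i :=
  ⟨h.ne.symm, h.right, h.left, fun x hx => by rw [h.memP x hx, not_not],
    fun x hx => by rw [h.memQ x hx, not_not]⟩

lemma card_inter_add_card_inter {i j : ι} (h : ∀ x ∈ P, x ∈ A j ↔ x ∉ A i) (C : Finset α) :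
    (P ∩ (A i ∩ C)).card + (P ∩ (A j ∩ C)).card = (P ∩ C).card := by
  rw [← Finset.card_union_of_disjoint]
  · congr 1; ext x; simp only [Finset.mem_union, Finset.mem_inter]; grind
  · rw [Finset.disjoint_left]; intro x; simp only [Finset.mem_inter]; grind

lemma card_inter_add_card_inter' {i j : ι} (h : ∀ x ∈ P, x ∈ A j ↔ x ∉ A i) :
    (P ∩ A i).card + (P ∩ A j).card = P.card := by
  rw [← Finset.card_union_of_disjoint]
  · congr 1; ext x; simp only [Finset.mem_union, Finset.mem_inter]; grind
  · rw [Finset.disjoint_left]; intro x; simp only [Finset.mem_inter]; grind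

/-- The two target inequalities have equal totals, so both are equalities. -/
lemma TightPartition.card_eq (h : TightPartition P Q A s i j) (hA : SplitSystem P Q A s)
    (hc : P.card = Q.card) : (P ∩ A i).card = (Q ∩ A i).card := by
  have h1 := hA.target i
  have h2 := hA.target j
  rw [h.left] at h1
  rw [h.right] at h2
  have := card_inter_add_card_inter' h.memP
  have := card_inter_add_card_inter' h.memQ
  omega

/-- The four cell counts of an obstruction. -/
lemma Obstruction.cards (h : Obstruction P Q A s B t i₁ i₂ j₁ j₂ d) (hA : SplitSystem P Q A s)
    (hB : SplitSystem P Q B t) (hc : P.card = Q.card) :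
    (P ∩ (A i₂ ∩ B j₂)).card = (Q ∩ (A i₂ ∩ B j₂)).card + d ∧
    (Q ∩ (A i₁ ∩ B j₂)).card = (P ∩ (A i₁ ∩ B j₂)).card + d ∧
    (Q ∩ (A i₂ ∩ B j₁)).card = (P ∩ (A i₂ ∩ B j₁)).card + d := by
  have a1 := h.fst.card_eq hA hc
  have a2 := h.fst.symm.card_eq hA hc
  have b1 := h.snd.card_eq hB hc
  have b2 := h.snd.symm.card_eq hB hc
  have e1 := card_inter_add_card_inter h.fst.memP (B j₁)
  have e2 := card_inter_add_card_inter h.fst.memP (B j₂)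
  have e3 := card_inter_add_card_inter h.fst.memQ (B j₁)
  have e4 := card_inter_add_card_inter h.fst.memQ (B j₂)
  have e5 := card_inter_add_card_inter h.snd.memP (A i₁)
  have e7 := card_inter_add_card_inter h.snd.memQ (A i₁)
  simp only [Finset.inter_comm (B _) (A _)] at e5 e7
  have := h.card_eq
  omega

lemma Obstruction.flip (h : Obstruction P Q A s B t i₁ i₂ j₁ j₂ d) (hA : SplitSystem P Q A s)
    (hB : SplitSystem P Q B t) (hc : P.card = Q.card) :
    Obstruction P Q A s B t i₂ i₁ j₂ j₁ d :=
  ⟨h.fst.symm, h.snd.symm, (h.cards hA hB hc).1, h.pos⟩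

lemma Obstruction.swap (h : Obstruction P Q A s B t i₁ i₂ j₁ j₂ d) :
    Obstruction P Q B t A s j₁ j₂ i₁ i₂ d :=
  ⟨h.snd, h.fst, by simpa only [Finset.inter_comm] using h.card_eq, h.pos⟩

/-- Representatives of the four cells that an obstruction makes nonempty. -/
lemma Obstruction.exists_mem (h : Obstruction P Q A s B t i₁ i₂ j₁ j₂ d)
    (hA : SplitSystem P Q A s) (hB : SplitSystem P Q B t) (hc : P.card = Q.card) :
    (∃ x ∈ P, x ∈ A i₁ ∧ x ∈ B j₁) ∧ (∃ x ∈ P, x ∈ A i₂ ∧ x ∈ B j₂) ∧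
    (∃ x ∈ Q, x ∈ A i₁ ∧ x ∈ B j₂) ∧ (∃ x ∈ Q, x ∈ A i₂ ∧ x ∈ B j₁) := by
  have h0 := h.card_eq
  have hd := h.pos
  obtain ⟨h1, h2, h3⟩ := h.cards hA hB hc
  have key : ∀ (R C D : Finset α), 0 < (R ∩ (C ∩ D)).card → ∃ x ∈ R, x ∈ C ∧ x ∈ D := by
    intro R C D hpos
    obtain ⟨x, hx⟩ := Finset.card_pos.1 hpos
    simp only [Finset.mem_inter] at hx
    exact ⟨x, hx⟩
  exact ⟨key _ _ _ (by omega), key _ _ _ (by omega), key _ _ _ (by omega), key _ _ _ (by omega)⟩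

/-- Each of the two diagonal cells contains at least d elements of P. -/
lemma Obstruction.two_mul_le (h : Obstruction P Q A s B t i₁ i₂ j₁ j₂ d)
    (hA : SplitSystem P Q A s) (hB : SplitSystem P Q B t) (hc : P.card = Q.card) :
    2 * d ≤ P.card := by
  have h0 := h.card_eq
  have h1 := (h.cards hA hB hc).1
  have e1 := card_inter_add_card_inter h.fst.memP (B j₁)
  have e2 := card_inter_add_card_inter h.fst.memP (B j₂)
  have e3 := card_inter_add_card_inter' h.snd.memP
  omega

/-- Both parts are tight, so p has to lie in the part of q. -/
lemma Allowed.mem_iff (hij : ∀ x ∈ P, x ∈ A j ↔ x ∉ A i) (hij' : ∀ x ∈ Q, x ∈ A j ↔ x ∉ A i)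
    (hi : s i = 0) (hj : s j = 0) (hp : p ∈ P) (hq : q ∈ Q) (h : Allowed A s p q) :
    p ∈ A i ↔ q ∈ A i := by
  have h1 := h i hi
  have h2 := h j hj
  have := hij p hp
  have := hij' q hq
  tauto

lemma TightPartition.next (h : TightPartition P Q A s i j) (hp : p ∈ P) (hq : q ∈ Q)
    (ha : Allowed A s p q) :
    TightPartition (P.erase p) (Q.erase q) A (nextSlack A s p q) i j where
  ne := h.ne
  left := by
    have := ha.mem_iff h.memP h.memQ h.left h.right hp hq
    simp [nextSlack, this, h.left]
  right := by
    have := ha.mem_iff h.symm.memP h.symm.memQ h.right h.left hp hq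
    simp [nextSlack, this, h.right]
  memP x hx := h.memP x (Finset.mem_of_mem_erase hx)
  memQ x hx := h.memQ x (Finset.mem_of_mem_erase hx)

/-- An allowed exchange removes p and q from the same cell, so the surplus d is invariant. -/
lemma Obstruction.next (h : Obstruction P Q A s B t i₁ i₂ j₁ j₂ d) (hp : p ∈ P) (hq : q ∈ Q)
    (ha : Allowed A s p q) (hb : Allowed B t p q) :
    Obstruction (P.erase p) (Q.erase q) A (nextSlack A s p q) B (nextSlack B t p q)
      i₁ i₂ j₁ j₂ d where
  fst := h.fst.next hp hq ha
  snd := h.snd.next hp hq hb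
  card_eq := by
    have h1 := ha.mem_iff h.fst.memP h.fst.memQ h.fst.left h.fst.right hp hq
    have h2 := hb.mem_iff h.snd.memP h.snd.memQ h.snd.left h.snd.right hp hq
    have e1 := card_erase_inter hp (A i₁ ∩ B j₁)
    have e2 := card_erase_inter hq (A i₁ ∩ B j₁)
    simp only [Finset.mem_inter, h1, h2] at e1 e2
    have := h.card_eq
    omega
  pos := h.pos

/-- Elements of the same cell can be exchanged. -/
lemma TightPartition.allowed (h : TightPartition P Q A s i j) (hA : SplitSystem P Q A s)
    (hq : q ∈ Q) (hpi : p ∈ A i) (hqi : q ∈ A i) : Allowed A s p q := by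
  intro k hk hqk
  by_cases hik : i = k
  · exact hik ▸ hpi
  · exact absurd hqk (hA.notMem_of_add_le_zero hik (by rw [h.left, hk]; rfl) hq hqi)

/-- Where an obstruction stops the exchanges. -/
lemma Obstruction.card_eq_of_stuck (h : Obstruction P Q A s B t i₁ i₂ j₁ j₂ d)
    (hA : SplitSystem P Q A s) (hB : SplitSystem P Q B t) (hc : P.card = Q.card)
    (hstuck : ∀ p ∈ P, ∀ q ∈ Q, ¬ (Allowed A s p q ∧ Allowed B t p q)) : P.card = 2 * d := by
  have key : ∀ {i i' : ι} {j j' : κ}, TightPartition P Q A s i i' → TightPartition P Q B t j j' →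
      (P ∩ (A i ∩ B j)).card = 0 ∨ (Q ∩ (A i ∩ B j)).card = 0 := by
    intro i i' j j' hi hj
    by_contra hcon
    push Not at hcon
    obtain ⟨x, hx⟩ := Finset.card_pos.1 (Nat.pos_of_ne_zero hcon.1)
    obtain ⟨y, hy⟩ := Finset.card_pos.1 (Nat.pos_of_ne_zero hcon.2)
    simp only [Finset.mem_inter] at hx hy
    exact hstuck x hx.1 y hy.1 ⟨hi.allowed hA hy.1 hx.2.1 hy.2.1, hj.allowed hB hy.1 hx.2.2 hy.2.2⟩
  have k1 := key h.fst h.snd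
  have k2 := key h.fst h.snd.symm
  have k3 := key h.fst.symm h.snd
  have k4 := key h.fst.symm h.snd.symm
  have h0 := h.card_eq
  have hd := h.pos
  obtain ⟨h1, h2, h3⟩ := h.cards hA hB hc
  have e1 := card_inter_add_card_inter h.fst.memP (B j₁)
  have e2 := card_inter_add_card_inter h.fst.memP (B j₂)
  have e3 := card_inter_add_card_inter' h.snd.memP
  omega

end SplitSystem
-- Getting stuck forces an obstruction
section SplitSystem

variable {α ι κ : Type*} [DecidableEq α]
variable {P Q : Finset α} {A : ι → Finset α} {s : ι → ℤ} {B : κ → Finset α} {t : κ → ℤ}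
  {i j i₁ i₂ : ι} {j₁ j₂ : κ} {p q x y : α} {d : ℕ}

lemma SplitSystem.eq_of_tight (hA : SplitSystem P Q A s) (hi : s i = 0) (hj : s j = 0)
    (hx : x ∈ Q) (hxi : x ∈ A i) (hxj : x ∈ A j) : i = j := by
  by_contra hij
  exact hA.notMem_of_add_le_zero hij (by omega) hx hxi hxj

lemma SplitSystem.exists_mem_of_tight (hA : SplitSystem P Q A s) (hi : s i = 0)
    (hx : x ∈ Q) (hxi : x ∈ A i) : ∃ y ∈ P, y ∈ A i := by
  have h1 := hA.target i
  have : 0 < (Q ∩ A i).card := Finset.card_pos.2 ⟨x, by simp [*]⟩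
  obtain ⟨y, hy⟩ := Finset.card_pos.1 (show 0 < (P ∩ A i).card by omega)
  simp only [Finset.mem_inter] at hy
  exact ⟨y, hy⟩

/-- The target inequality gives |Q| ≤ |P ∩ A i|, and P is no larger than Q. -/
lemma SplitSystem.subset_of_tight (hA : SplitSystem P Q A s) (hc : P.card = Q.card) (hi : s i = 0)
    (hQ : ∀ x ∈ Q, x ∈ A i) : ∀ x ∈ P, x ∈ A i := by
  have h1 := hA.target i
  rw [Finset.inter_eq_left.2 (fun x hx => hQ x hx), hi] at h1
  have h2 : P ∩ A i = P := Finset.eq_of_subset_of_card_le Finset.inter_subset_left (by omega)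
  exact fun x hx => Finset.inter_eq_left.1 h2 hx

/-- Otherwise the first system would allow q with every element of P. In the second system, q lies
in at most one tight set, and this set contains an element of P, which could be exchanged for q. -/
lemma exists_tight_of_stuck (hB : SplitSystem P Q B t) (hne : P.Nonempty)
    (hstuck : ∀ p ∈ P, ∀ q ∈ Q, ¬ (Allowed A s p q ∧ Allowed B t p q)) (hq : q ∈ Q) :
    ∃ i, s i = 0 ∧ q ∈ A i := by
  by_contra hcon
  push Not at hcon
  have hall : ∀ p, Allowed A s p q := fun p i hi hqi => absurd hqi (hcon i hi)
  obtain ⟨p₀, hp₀⟩ := hne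
  have h0 : ¬ Allowed B t p₀ q := fun h => hstuck p₀ hp₀ q hq ⟨hall _, h⟩
  unfold Allowed at h0
  push Not at h0
  obtain ⟨j, hj, hqj, -⟩ := h0
  obtain ⟨y, hy, hyj⟩ := hB.exists_mem_of_tight hj hq hqj
  exact hstuck y hy q hq ⟨hall _, fun k hk hqk => hB.eq_of_tight hj hk hq hqj hqk ▸ hyj⟩

/-- An obstruction is the only way to get stuck. -/
lemma obstructed_of_stuck (hA : SplitSystem P Q A s) (hB : SplitSystem P Q B t)
    (hc : P.card = Q.card) (hne : P.Nonempty)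
    (hstuck : ∀ p ∈ P, ∀ q ∈ Q, ¬ (Allowed A s p q ∧ Allowed B t p q)) :
    ∃ d, Obstructed P Q A s B t d := by
  have hstuck' : ∀ p ∈ P, ∀ q ∈ Q, ¬ (Allowed B t p q ∧ Allowed A s p q) :=
    fun p hp q hq h => hstuck p hp q hq h.symm
  have ha' : ∀ q : Q, ∃ i, s i = 0 ∧ (q : α) ∈ A i :=
    fun q => exists_tight_of_stuck hB hne hstuck q.2
  have hb' : ∀ q : Q, ∃ j, t j = 0 ∧ (q : α) ∈ B j :=
    fun q => exists_tight_of_stuck hA hne hstuck' q.2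
  -- Tight sets are disjoint on Q, so `a q` and `b q` index the only tight sets containing q. An
  -- element of P in both of them could be exchanged for q, which gives `disj`.
  choose a ha haq using ha'
  choose b hb hbq using hb'
  have disj : ∀ q : Q, ∀ p ∈ P, p ∈ A (a q) → p ∉ B (b q) := by
    intro q p hp hpa hpb
    refine hstuck p hp q q.2 ⟨fun k hk hqk => ?_, fun k hk hqk => ?_⟩
    · exact hA.eq_of_tight (ha q) hk q.2 (haq q) hqk ▸ hpa
    · exact hB.eq_of_tight (hb q) hk q.2 (hbq q) hqk ▸ hpb
  have hnea : ∀ q : Q, ∃ q' : Q, a q' ≠ a q := by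
    intro q
    by_contra hcon
    push Not at hcon
    have h1 := hA.subset_of_tight hc (ha q) (fun x hx => hcon ⟨x, hx⟩ ▸ haq ⟨x, hx⟩)
    obtain ⟨p, hp, hpb⟩ := hB.exists_mem_of_tight (hb q) q.2 (hbq q)
    exact disj q p hp (h1 p hp) hpb
  have hneb : ∀ q : Q, ∃ q' : Q, b q' ≠ b q := by
    intro q
    by_contra hcon
    push Not at hcon
    have h1 := hB.subset_of_tight hc (hb q) (fun x hx => hcon ⟨x, hx⟩ ▸ hbq ⟨x, hx⟩)
    obtain ⟨p, hp, hpb⟩ := hA.exists_mem_of_tight (ha q) q.2 (haq q)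
    exact disj q p hp hpb (h1 p hp)
  obtain ⟨q₀, hq₀⟩ : Q.Nonempty := Finset.card_pos.1 (hc ▸ Finset.card_pos.2 hne)
  -- Two nonconstant functions on the same set always differ simultaneously at some pair of
  -- arguments.
  obtain ⟨q, q', hqa, hqb⟩ : ∃ q q' : Q, a q ≠ a q' ∧ b q ≠ b q' := by
    obtain ⟨q, hq⟩ := hnea ⟨q₀, hq₀⟩
    obtain ⟨q', hq'⟩ := hneb q
    by_cases h : b q = b ⟨q₀, hq₀⟩
    · by_cases h' : a q' = a q
      · exact ⟨q', ⟨q₀, hq₀⟩, h'.symm ▸ hq, h ▸ hq'⟩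
      · exact ⟨q', q, h', hq'⟩
    · exact ⟨q, ⟨q₀, hq₀⟩, hq, h⟩
  have coverA : ∀ i j, s i = 0 → s j = 0 → i ≠ j → ∀ x ∈ P, x ∉ A i → x ∈ A j :=
    fun i j hi hj hij x hx => hA.mem_of_add_le_zero hij (by omega) hx
  have coverB : ∀ i j, t i = 0 → t j = 0 → i ≠ j → ∀ x ∈ P, x ∉ B i → x ∈ B j :=
    fun i j hi hj hij x hx => hB.mem_of_add_le_zero hij (by omega) hx
  -- The two sets of each system cover P, while `A (a q)` misses `B (b q)` on P, and likewise for
  -- q'. Hence all four induce the same bipartition of P.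
  have memP : ∀ x ∈ P, (x ∈ A (a q) ↔ x ∈ B (b q')) ∧ (x ∈ A (a q') ↔ x ∈ B (b q)) ∧
      (x ∈ A (a q') ↔ x ∉ A (a q)) := by
    intro x hx
    have h1 := coverA _ _ (ha q) (ha q') hqa x hx
    have h2 := coverB _ _ (hb q) (hb q') hqb x hx
    have h3 := disj q x hx
    have h4 := disj q' x hx
    tauto
  -- An element of P in `B (b z)` is outside `A (a z)`. If this were a third tight set, the element
  -- would lie in both `A (a q)` and `A (a q')`, which are complementary on P.
  have memA : ∀ z : Q, a z = a q ∨ a z = a q' := by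
    intro z
    by_contra hcon
    push Not at hcon
    obtain ⟨p, hp, hpb⟩ := hB.exists_mem_of_tight (hb z) z.2 (hbq z)
    have h1 := coverA _ _ (ha q) (ha z) hcon.1.symm p hp
    have h2 := coverA _ _ (ha q') (ha z) hcon.2.symm p hp
    have h3 := disj z p hp
    have h4 := memP p hp
    tauto
  have memB : ∀ z : Q, b z = b q ∨ b z = b q' := by
    intro z
    by_contra hcon
    push Not at hcon
    obtain ⟨p, hp, hpb⟩ := hA.exists_mem_of_tight (ha z) z.2 (haq z)
    have h1 := coverB _ _ (hb q) (hb z) hcon.1.symm p hp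
    have h2 := coverB _ _ (hb q') (hb z) hcon.2.symm p hp
    have h3 := disj z p hp
    have h4 := memP p hp
    tauto
  have memQA : ∀ x ∈ Q, x ∈ A (a q') ↔ x ∉ A (a q) := by
    intro x hx
    have h1 := haq ⟨x, hx⟩
    have h2 : x ∈ A (a q) → x ∉ A (a q') := fun hxq hxq' =>
      hqa (hA.eq_of_tight (ha q) (ha q') hx hxq hxq')
    rcases memA ⟨x, hx⟩ with h | h <;> rw [h] at h1 <;> tauto
  have memQB : ∀ x ∈ Q, x ∈ B (b q) ↔ x ∉ B (b q') := by
    intro x hx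
    have h1 := hbq ⟨x, hx⟩
    have h2 : x ∈ B (b q) → x ∉ B (b q') := fun hxq hxq' =>
      hqb (hB.eq_of_tight (hb q) (hb q') hx hxq hxq')
    rcases memB ⟨x, hx⟩ with h | h <;> rw [h] at h1 <;> tauto
  have hP : P ∩ (A (a q) ∩ B (b q')) = P ∩ A (a q) := by
    ext x; simp only [Finset.mem_inter]
    constructor
    · tauto
    · rintro ⟨h1, h2⟩; exact ⟨h1, h2, (memP x h1).1.1 h2⟩
  have hQ : Q ∩ (A (a q) ∩ B (b q')) = ∅ := by
    rw [Finset.eq_empty_iff_forall_notMem]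
    intro x hx
    simp only [Finset.mem_inter] at hx
    obtain ⟨p, hp, hpa⟩ := hA.exists_mem_of_tight (ha q) q.2 (haq q)
    refine hstuck p hp x hx.1 ⟨fun k hk hqk => ?_, fun k hk hqk => ?_⟩
    · exact hA.eq_of_tight (ha q) hk hx.1 hx.2.1 hqk ▸ hpa
    · exact hB.eq_of_tight (hb q') hk hx.1 hx.2.2 hqk ▸ (memP p hp).1.1 hpa
  -- The cell of `a q` and `b q'` holds all of P ∩ A (a q) and nothing of Q; this determines d.
  refine ⟨(P ∩ A (a q)).card, a q, a q', b q', b q, ?_, ?_, ?_, ?_⟩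
  · exact ⟨hqa, ha q, ha q', fun x hx => (memP x hx).2.2, memQA⟩
  · refine ⟨hqb.symm, hb q', hb q, fun x hx => ?_, memQB⟩
    have := memP x hx
    tauto
  · rw [hP, hQ]; simp
  · obtain ⟨p, hp, hpa⟩ := hA.exists_mem_of_tight (ha q) q.2 (haq q)
    exact Finset.card_pos.2 ⟨p, Finset.mem_inter.2 ⟨hp, hpa⟩⟩

end SplitSystem
-- Avoiding obstructions one exchange ahead
section SplitSystem

variable {α ι κ : Type*} [DecidableEq α]
variable {P Q : Finset α} {A : ι → Finset α} {s : ι → ℤ} {B : κ → Finset α} {t : κ → ℤ}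
  {i j i₁ i₂ k₁ k₂ : ι} {j₁ j₂ : κ} {p q x y x' y' x₁₁ x₂₂ y₁₂ y₂₁ : α} {d : ℕ}

/-- The exchange of `p` and `q` leads to an obstruction. -/
structure LeadsToObstruction (P Q : Finset α) (A : ι → Finset α) (s : ι → ℤ) (B : κ → Finset α)
    (t : κ → ℤ) (p q : α) (i₁ i₂ : ι) (j₁ j₂ : κ) (d : ℕ) : Prop where
  sysA : SplitSystem P Q A s
  sysB : SplitSystem P Q B t
  card_eq : P.card = Q.card
  memP : p ∈ P
  memQ : q ∈ Q
  allowedA : Allowed A s p q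
  allowedB : Allowed B t p q
  obs : Obstruction (P.erase p) (Q.erase q) A (nextSlack A s p q) B (nextSlack B t p q) i₁ i₂ j₁ j₂ d

lemma card_erase_eq_card_erase (hc : P.card = Q.card) (hp : p ∈ P) (hq : q ∈ Q) :
    (P.erase p).card = (Q.erase q).card := by
  rw [Finset.card_erase_of_mem hp, Finset.card_erase_of_mem hq, hc]

lemma LeadsToObstruction.flip (h : LeadsToObstruction P Q A s B t p q i₁ i₂ j₁ j₂ d) :
    LeadsToObstruction P Q A s B t p q i₂ i₁ j₂ j₁ d :=
  { h with
    obs := h.obs.flip (h.sysA.next h.memP h.memQ h.allowedA) (h.sysB.next h.memP h.memQ h.allowedB)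
      (card_erase_eq_card_erase h.card_eq h.memP h.memQ) }

lemma LeadsToObstruction.swap (h : LeadsToObstruction P Q A s B t p q i₁ i₂ j₁ j₂ d) :
    LeadsToObstruction P Q B t A s p q j₁ j₂ i₁ i₂ d :=
  ⟨h.sysB, h.sysA, h.card_eq, h.memP, h.memQ, h.allowedB, h.allowedA, h.obs.swap⟩

lemma LeadsToObstruction.exists_mem (h : LeadsToObstruction P Q A s B t p q i₁ i₂ j₁ j₂ d) :
    (∃ x ∈ P.erase p, x ∈ A i₁ ∧ x ∈ B j₁) ∧ (∃ x ∈ P.erase p, x ∈ A i₂ ∧ x ∈ B j₂) ∧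
    (∃ x ∈ Q.erase q, x ∈ A i₁ ∧ x ∈ B j₂) ∧ (∃ x ∈ Q.erase q, x ∈ A i₂ ∧ x ∈ B j₁) :=
  h.obs.exists_mem (h.sysA.next h.memP h.memQ h.allowedA) (h.sysB.next h.memP h.memQ h.allowedB)
      (card_erase_eq_card_erase h.card_eq h.memP h.memQ)

/-- A set that becomes tight by the exchange of `p` and `q`. -/
lemma slack_of_nextSlack_eq_zero (hs : ∀ i, 0 ≤ s i) (h : nextSlack A s p q i = 0)
    (hi : s i ≠ 0) : s i = 1 ∧ p ∉ A i ∧ q ∈ A i := by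
  have := hs i
  unfold nextSlack at h
  split_ifs at h <;> first | omega | (refine ⟨by omega, by assumption, by assumption⟩)

lemma slack_of_nextSlack_eq_zero' (h : nextSlack A s p q i = 0)
    (hi : s i = 0) : p ∈ A i ↔ q ∈ A i := by
  unfold nextSlack at h
  split_ifs at h <;> first | omega | tauto

/-- A set with positive slack does not obstruct. -/
lemma TightPartition.allowed_of_slack
    (h : TightPartition (P.erase p) (Q.erase q) A (nextSlack A s p q) i₁ i₂)
    (hA : SplitSystem P Q A s) (hs : s i₁ ≠ 0)
    (hx : x ∈ P.erase p) (hx2 : x ∈ A i₂) (hy : y ∈ Q.erase q) (hy1 : y ∈ A i₁) :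
    Allowed A s x y := by
  intro k hk hyk
  obtain ⟨h1, -, -⟩ := slack_of_nextSlack_eq_zero hA.nonneg h.left hs
  have hne : i₁ ≠ k := by rintro rfl; exact hs hk
  exact hA.mem_of_add_le_one hne (by omega) (Finset.mem_of_mem_erase hy) hy1 hyk
    (Finset.mem_of_mem_erase hx) ((h.memP x hx).1 hx2)

/-- If the second part was tight before, it is the only tight set containing y. If the first was, it
covers P together with any tight set containing y, and x is not in the first part. -/
lemma TightPartition.allowed_of_tight
    (h : TightPartition (P.erase p) (Q.erase q) A (nextSlack A s p q) i₁ i₂)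
    (hA : SplitSystem P Q A s) (hs : s i₁ = 0 ∨ s i₂ = 0)
    (hx : x ∈ P.erase p) (hx2 : x ∈ A i₂) (hy : y ∈ Q.erase q) (hy2 : y ∈ A i₂) :
    Allowed A s x y := by
  intro k hk hyk
  rcases hs with hs | hs
  · have hne : i₁ ≠ k := by rintro rfl; exact (h.memQ y hy).1 hy2 hyk
    exact hA.mem_of_add_le_zero hne (by omega) (Finset.mem_of_mem_erase hx) ((h.memP x hx).1 hx2)
  · exact hA.eq_of_tight hs hk (Finset.mem_of_mem_erase hy) hy2 hyk ▸ hx2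

/-- An exchange across a set with positive slack leads to an obstruction only in small systems. -/
lemma TightPartition.next_tightPartition
    (h : TightPartition (P.erase p) (Q.erase q) A (nextSlack A s p q) i₁ i₂)
    (hA : SplitSystem P Q A s) (hp : p ∈ P) (hq : q ∈ Q)
    (ha : Allowed A s p q) (hc : P.card = Q.card) (hs : s i₁ ≠ 0)
    (hx : x ∈ P.erase p) (hx2 : x ∈ A i₂) (hy : y ∈ Q.erase q) (hy1 : y ∈ A i₁)
    (hx' : x' ∈ P.erase p) (hx1' : x' ∈ A i₁) (hy' : y' ∈ Q.erase q) (hy2' : y' ∈ A i₂)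
    (h' : TightPartition (P.erase x) (Q.erase y) A (nextSlack A s x y) k₁ k₂) :
    (i₁ = k₁ ∨ i₁ = k₂) ∧ s i₂ ≠ 0 ∧ (∀ z ∈ P.erase p, z ∈ A i₁ → z = x') ∧
      (∀ z ∈ P.erase p, z ∈ A i₂ → z = x) ∧ (∀ z ∈ Q.erase q, z ∈ A i₁ → z = y) ∧
      (∀ z ∈ Q.erase q, z ∈ A i₂ → z = y') := by
  obtain ⟨h1, hp1, hq1⟩ := slack_of_nextSlack_eq_zero hA.nonneg h.left hs
  have hxP := Finset.mem_of_mem_erase hx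
  have hyQ := Finset.mem_of_mem_erase hy
  have hx1 : x ∉ A i₁ := (h.memP x hx).1 hx2
  have hy2 : y ∉ A i₂ := fun hy2 => (h.memQ y hy).1 hy2 hy1
  have hA' := hA.next hxP hyQ (h.allowed_of_slack hA hs hx hx2 hy hy1)
  -- Exchanging x for y makes `i₁` tight. The element q is still in Q and lies in it, so `i₁` is a
  -- part of the new partition.
  have hn1 : nextSlack A s x y i₁ = 0 := by simp [nextSlack, hx1, hy1, h1]
  have hn2 : nextSlack A s x y i₂ = s i₂ + 1 := by simp [nextSlack, hx2, hy2]
  have hqy : q ∈ Q.erase y :=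
    Finset.mem_erase.2 ⟨fun e => (Finset.mem_erase.1 hy).1 e.symm, hq⟩
  have hk : i₁ = k₁ ∨ i₁ = k₂ := by
    by_cases hqk : q ∈ A k₁
    · exact Or.inl (hA'.eq_of_tight hn1 h'.left hqy hq1 hqk)
    · exact Or.inr (hA'.eq_of_tight hn1 h'.right hqy hq1 ((h'.memQ q hqy).2 hqk))
  refine ⟨hk, ?_⟩
  obtain ⟨k, hk⟩ : ∃ k, TightPartition (P.erase x) (Q.erase y) A (nextSlack A s x y) i₁ k := by
    rcases hk with rfl | rfl
    · exact ⟨_, h'⟩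
    · exact ⟨_, h'.symm⟩
  have h2nn := hA.nonneg i₂
  have hki : k ≠ i₂ := by
    rintro rfl
    have := hk.right
    omega
  -- The right side becomes s i₂ + 1 ≤ 2. The left side is at least the number of remaining elements
  -- of Q in `A i₂` plus that of P in `A i₁`, both positive. So s i₂ = 1, and both sets are
  -- singletons.
  have hpair := hA'.pair k i₂ hki
  rw [hk.right, hn2] at hpair
  have hsubQ : Q.erase q ∩ A i₂ ⊆ Q.erase y ∩ (A k ∩ A i₂) := by
    intro z hz
    obtain ⟨hz, hz2⟩ := Finset.mem_inter.1 hz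
    have hzy : z ∈ Q.erase y :=
      Finset.mem_erase.2 ⟨fun e => hy2 (e ▸ hz2), Finset.mem_of_mem_erase hz⟩
    simp only [Finset.mem_inter]
    exact ⟨hzy, (hk.memQ z hzy).2 ((h.memQ z hz).1 hz2), hz2⟩
  have hsubP : P.erase p ∩ A i₁ ⊆ P.erase x \ (A k ∪ A i₂) := by
    intro z hz
    obtain ⟨hz, hz1⟩ := Finset.mem_inter.1 hz
    have hzx : z ∈ P.erase x :=
      Finset.mem_erase.2 ⟨fun e => hx1 (e ▸ hz1), Finset.mem_of_mem_erase hz⟩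
    simp only [Finset.mem_sdiff, Finset.mem_union, not_or]
    exact ⟨hzx, fun e => (hk.memP z hzx).1 e hz1, fun e => (h.memP z hz).1 e hz1⟩
  have hc1 := Finset.card_le_card hsubQ
  have hc2 := Finset.card_le_card hsubP
  have hm1 : y' ∈ Q.erase q ∩ A i₂ := Finset.mem_inter.2 ⟨hy', hy2'⟩
  have hm2 : x' ∈ P.erase p ∩ A i₁ := Finset.mem_inter.2 ⟨hx', hx1'⟩
  have hm3 : x ∈ P.erase p ∩ A i₂ := Finset.mem_inter.2 ⟨hx, hx2⟩
  have hm4 : y ∈ Q.erase q ∩ A i₁ := Finset.mem_inter.2 ⟨hy, hy1⟩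
  have hc3 := Finset.card_pos.2 ⟨_, hm1⟩
  have hc4 := Finset.card_pos.2 ⟨_, hm2⟩
  have hs2 : s i₂ ≠ 0 := by omega
  obtain ⟨hs2', -, -⟩ := slack_of_nextSlack_eq_zero hA.nonneg h.right hs2
  have hA0 := hA.next hp hq ha
  have hc0 := card_erase_eq_card_erase hc hp hq
  have hc5 := h.card_eq hA0 hc0
  have hc6 := h.symm.card_eq hA0 hc0
  have one : ∀ {R : Finset α} {u : α}, u ∈ R → R.card ≤ 1 → ∀ z ∈ R, z = u :=
    fun hu hR z hz => Finset.card_le_one.1 hR z hz _ hu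
  refine ⟨hs2, fun z hz hz1 => ?_, fun z hz hz1 => ?_, fun z hz hz1 => ?_, fun z hz hz1 => ?_⟩
  · exact one hm2 (by omega) z (Finset.mem_inter.2 ⟨hz, hz1⟩)
  · exact one hm3 (by omega) z (Finset.mem_inter.2 ⟨hz, hz1⟩)
  · exact one hm4 (by omega) z (Finset.mem_inter.2 ⟨hz, hz1⟩)
  · exact one hm1 (by omega) z (Finset.mem_inter.2 ⟨hz, hz1⟩)

/-- All allowed exchanges lead to an obstruction. -/
def AlwaysObstructed (P Q : Finset α) (A : ι → Finset α) (s : ι → ℤ) (B : κ → Finset α)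
    (t : κ → ℤ) : Prop :=
  ∀ x ∈ P, ∀ y ∈ Q, Allowed A s x y → Allowed B t x y →
    ∃ d, Obstructed (P.erase x) (Q.erase y) A (nextSlack A s x y) B (nextSlack B t x y) d

lemma AlwaysObstructed.swap (H : AlwaysObstructed P Q A s B t) : AlwaysObstructed P Q B t A s := by
  intro x hx y hy hb ha
  obtain ⟨d, i₁, i₂, j₁, j₂, h⟩ := H x hx y hy ha hb
  exact ⟨d, j₁, j₂, i₁, i₂, h.swap⟩

/-- The only way in which an exchange across a set with positive slack leads to an obstruction. -/
lemma LeadsToObstruction.cross (h : LeadsToObstruction P Q A s B t p q i₁ i₂ j₁ j₂ d)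
    (H : AlwaysObstructed P Q A s B t) (hs : s i₁ ≠ 0)
    (hx : x₁₁ ∈ P.erase p) (hxA : x₁₁ ∈ A i₁)
    (hx' : x₂₂ ∈ P.erase p) (hxA' : x₂₂ ∈ A i₂)
    (hy : y₁₂ ∈ Q.erase q) (hyA : y₁₂ ∈ A i₁)
    (hy' : y₂₁ ∈ Q.erase q) (hyA' : y₂₁ ∈ A i₂)
    (hB : Allowed B t x₂₂ y₁₂) :
    s i₂ ≠ 0 ∧ (∀ z ∈ P.erase p, z ∈ A i₁ → z = x₁₁) ∧ (∀ z ∈ P.erase p, z ∈ A i₂ → z = x₂₂) ∧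
    ∃ l₁ l₂, TightPartition (P.erase x₂₂) (Q.erase y₁₂) B (nextSlack B t x₂₂ y₁₂) l₁ l₂ ∧
      x₁₁ ∈ B l₁ ∧ p ∈ B l₂ ∧ q ∈ B l₂ := by
  have hxP := Finset.mem_of_mem_erase hx'
  have hyQ := Finset.mem_of_mem_erase hy
  have hA := h.obs.fst.allowed_of_slack h.sysA hs hx' hxA' hy hyA
  obtain ⟨h1, hp1, hq1⟩ := slack_of_nextSlack_eq_zero h.sysA.nonneg h.obs.fst.left hs
  obtain ⟨d', k₁, k₂, l₁, l₂, h'⟩ := H _ hxP _ hyQ hA hB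
  obtain ⟨hk, hs2, z1, z2, z3, z4⟩ := h.obs.fst.next_tightPartition h.sysA h.memP h.memQ h.allowedA
    h.card_eq hs hx' hxA' hy hyA hx hxA hy' hyA' h'.fst
  have hA' := h.sysA.next hxP hyQ hA
  have hB' := h.sysB.next hxP hyQ hB
  have hc' := card_erase_eq_card_erase h.card_eq hxP hyQ
  refine ⟨hs2, z1, z2, ?_⟩
  obtain ⟨k, l₁, l₂, h'⟩ : ∃ k l₁ l₂, Obstruction (P.erase x₂₂) (Q.erase y₁₂) A
      (nextSlack A s x₂₂ y₁₂) B (nextSlack B t x₂₂ y₁₂) i₁ k l₁ l₂ d' := by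
    rcases hk with rfl | rfl
    · exact ⟨_, _, _, h'⟩
    · exact ⟨_, _, _, h'.flip hA' hB' hc'⟩
  refine ⟨l₁, l₂, h'.snd, ?_⟩
  -- Each of these cells of the new obstruction is nonempty, and by the singleton statements only
  -- x₁₁, p and q are left to represent them.
  obtain ⟨⟨u, hu, huA, huB⟩, ⟨v, hv, hvA, hvB⟩, ⟨w, hw, hwA, hwB⟩, -⟩ := h'.exists_mem hA' hB' hc'
  have hu' : u ∈ P.erase p :=
    Finset.mem_erase.2 ⟨fun e => hp1 (e ▸ huA), Finset.mem_of_mem_erase hu⟩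
  have hvp : v = p := by
    by_contra hne
    have hv' : v ∈ P.erase p := Finset.mem_erase.2 ⟨hne, Finset.mem_of_mem_erase hv⟩
    have := z2 v hv' ((h.obs.fst.memP v hv').2 ((h'.fst.memP v hv).1 hvA))
    exact (Finset.mem_erase.1 hv).1 this
  have hwq : w = q := by
    by_contra hne
    have hw' : w ∈ Q.erase q := Finset.mem_erase.2 ⟨hne, Finset.mem_of_mem_erase hw⟩
    exact (Finset.mem_erase.1 hw).1 (z3 w hw' hwA)
  exact ⟨z1 u hu' huA ▸ huB, hvp ▸ hvB, hwq ▸ hwB⟩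

/-- Both crossing exchanges, of x₂₂ with y₁₂ and of x₁₁ with y₂₁, are allowed. The first shows that
P consists of x₁₁, x₂₂ and p and that the tight set `j₂` contains p and q. After the second, `j₂`
contains all of P, yet q makes it a part of an obstruction, whose other part would have to meet P.
-/
lemma LeadsToObstruction.false_of_tight_aux
    (h : LeadsToObstruction P Q A s B t p q i₁ i₂ j₁ j₂ d)
    (H : AlwaysObstructed P Q A s B t) (hs : s i₁ ≠ 0) (hs2 : s i₂ ≠ 0) (ht : t j₂ = 0) :
    False := by
  obtain ⟨⟨x₁₁, hx, hxA, hxB⟩, ⟨x₂₂, hx', hxA', hxB'⟩, ⟨y₁₂, hy, hyA, hyB⟩,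
    ⟨y₂₁, hy', hyA', hyB'⟩⟩ := h.exists_mem
  have hB := h.obs.snd.allowed_of_tight h.sysB (Or.inr ht) hx' hxB' hy hyB
  have hBf := h.obs.snd.symm.allowed_of_tight h.sysB (Or.inl ht) hx hxB hy' hyB'
  have hAf := h.obs.fst.symm.allowed_of_slack h.sysA hs2 hx hxA hy' hyA'
  obtain ⟨-, z1, z2, l₁, l₂, hl, hxl, hpl, hql⟩ :=
    h.cross H hs hx hxA hx' hxA' hy hyA hy' hyA' hB
  have hB1 := h.sysB.next (Finset.mem_of_mem_erase hx') (Finset.mem_of_mem_erase hy) hB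
  have hn : nextSlack B t x₂₂ y₁₂ j₂ = 0 := by simp [nextSlack, hxB', hyB, ht]
  have hx2 : x₁₁ ∉ B j₂ := fun e => (h.obs.snd.memP _ hx).1 e hxB
  have hy2 : y₂₁ ∉ B j₂ := fun e => (h.obs.snd.memQ _ hy').1 e hyB'
  have hx12 : x₁₁ ∈ P.erase x₂₂ :=
    Finset.mem_erase.2 ⟨fun e => hx2 (e ▸ hxB'), Finset.mem_of_mem_erase hx⟩
  have hlj : l₂ = j₂ := by
    by_contra hne
    exact hx2 (hB1.mem_of_add_le_zero hne (by rw [hl.right, hn]; rfl) hx12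
      fun e => (hl.memP _ hx12).1 e hxl)
  subst hlj
  obtain ⟨d', k₁, k₂, m₁, m₂, h'⟩ :=
    H _ (Finset.mem_of_mem_erase hx) _ (Finset.mem_of_mem_erase hy') hAf hBf
  have hA2 := h.sysA.next (Finset.mem_of_mem_erase hx) (Finset.mem_of_mem_erase hy') hAf
  have hB2 := h.sysB.next (Finset.mem_of_mem_erase hx) (Finset.mem_of_mem_erase hy') hBf
  have hc2 := card_erase_eq_card_erase h.card_eq (Finset.mem_of_mem_erase hx)
    (Finset.mem_of_mem_erase hy')
  have hn2 : nextSlack B t x₁₁ y₂₁ l₂ = 0 := by simp [nextSlack, hx2, hy2, ht]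
  have hqy : q ∈ Q.erase y₂₁ :=
    Finset.mem_erase.2 ⟨fun e => (Finset.mem_erase.1 hy').1 e.symm, h.memQ⟩
  have all : ∀ z ∈ P.erase x₁₁, z ∈ B l₂ := by
    intro z hz
    by_cases hzp : z = p
    · exact hzp ▸ hpl
    have hz' : z ∈ P.erase p := Finset.mem_erase.2 ⟨hzp, Finset.mem_of_mem_erase hz⟩
    by_cases hzA : z ∈ A i₁
    · exact absurd (z1 z hz' hzA) (Finset.mem_erase.1 hz).1
    · exact z2 z hz' ((h.obs.fst.memP z hz').2 hzA) ▸ hxB'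
  obtain ⟨⟨u, hu, -, huB⟩, ⟨v, hv, -, hvB⟩, -, -⟩ := h'.exists_mem hA2 hB2 hc2
  by_cases hqm : q ∈ B m₁
  · have := hB2.eq_of_tight hn2 h'.snd.left hqy hql hqm
    subst this
    exact (h'.snd.memP v hv).1 hvB (all v hv)
  · have := hB2.eq_of_tight hn2 h'.snd.right hqy hql ((h'.snd.memQ q hqy).2 hqm)
    subst this
    exact (h'.snd.memP u hu).1 (all u hu) huB

lemma LeadsToObstruction.false_of_tight (h : LeadsToObstruction P Q A s B t p q i₁ i₂ j₁ j₂ d)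
    (H : AlwaysObstructed P Q A s B t) (hs : s i₁ ≠ 0) (ht : t j₁ = 0 ∨ t j₂ = 0) : False := by
  obtain ⟨⟨x₁₁, hx, hxA, hxB⟩, ⟨x₂₂, hx', hxA', hxB'⟩, ⟨y₁₂, hy, hyA, hyB⟩,
    ⟨y₂₁, hy', hyA', hyB'⟩⟩ := h.exists_mem
  have hB := h.obs.snd.allowed_of_tight h.sysB ht hx' hxB' hy hyB
  have hs2 := (h.cross H hs hx hxA hx' hxA' hy hyA hy' hyA' hB).1
  rcases ht with ht | ht
  · exact h.flip.false_of_tight_aux H hs2 hs ht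
  · exact h.false_of_tight_aux H hs hs2 ht

/-- Otherwise the exchange makes a set `l₂` tight that contains q, as does `j₂`, while x₁₁ is in
neither. This needs total slack 2, but `j₂` has slack 1. -/
lemma LeadsToObstruction.not_allowed (h : LeadsToObstruction P Q A s B t p q i₁ i₂ j₁ j₂ d)
    (H : AlwaysObstructed P Q A s B t) (hs : s i₁ ≠ 0) (ht2 : t j₂ ≠ 0)
    (hx : x₁₁ ∈ P.erase p) (hxA : x₁₁ ∈ A i₁) (hxB : x₁₁ ∈ B j₁)
    (hx' : x₂₂ ∈ P.erase p) (hxA' : x₂₂ ∈ A i₂) (hxB' : x₂₂ ∈ B j₂)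
    (hy : y₁₂ ∈ Q.erase q) (hyA : y₁₂ ∈ A i₁) (hyB : y₁₂ ∈ B j₂)
    (hy' : y₂₁ ∈ Q.erase q) (hyA' : y₂₁ ∈ A i₂) :
    ¬ Allowed B t x₂₂ y₁₂ := by
  intro hB
  obtain ⟨-, z1, z2, l₁, l₂, hl, hxl, hpl, hql⟩ :=
    h.cross H hs hx hxA hx' hxA' hy hyA hy' hyA' hB
  have hB1 := h.sysB.next (Finset.mem_of_mem_erase hx') (Finset.mem_of_mem_erase hy) hB
  obtain ⟨h1, hp2, hq2⟩ := slack_of_nextSlack_eq_zero h.sysB.nonneg h.obs.snd.right ht2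
  have hn : nextSlack B t x₂₂ y₁₂ j₂ = 1 := by simp [nextSlack, hxB', hyB, h1]
  have hx2 : x₁₁ ∉ B j₂ := fun e => (h.obs.snd.memP _ hx).1 e hxB
  have hx12 : x₁₁ ∈ P.erase x₂₂ :=
    Finset.mem_erase.2 ⟨fun e => hx2 (e ▸ hxB'), Finset.mem_of_mem_erase hx⟩
  have hqy : q ∈ Q.erase y₁₂ :=
    Finset.mem_erase.2 ⟨fun e => (Finset.mem_erase.1 hy).1 e.symm, h.memQ⟩
  have hlj : l₂ ≠ j₂ := by
    rintro rfl
    have := hl.right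
    omega
  exact hx2 (hB1.mem_of_add_le_one hlj (by rw [hl.right, hn]; rfl) hqy hql hq2 hx12
    fun e => (hl.memP _ hx12).1 e hxl)

/-- By `not_allowed`, for both systems, y₁₂ lies in a tight set `k` of the first and a tight set `l`
of the second. The pair bounds with `i₁` and `j₂` put p into both, so p can be exchanged for y₁₂.
This makes `i₁` tight, so it is a part of a tight partition; the other part shares y₂₁ with `i₂`,
and neither contains x₁₁. That needs total slack 2, but only 1 is available. -/
lemma LeadsToObstruction.false_of_slack (h : LeadsToObstruction P Q A s B t p q i₁ i₂ j₁ j₂ d)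
    (H : AlwaysObstructed P Q A s B t) (hs1 : s i₁ ≠ 0) (hs2 : s i₂ ≠ 0)
    (ht2 : t j₂ ≠ 0) : False := by
  obtain ⟨⟨x₁₁, hx, hxA, hxB⟩, ⟨x₂₂, hx', hxA', hxB'⟩, ⟨y₁₂, hy, hyA, hyB⟩,
    ⟨y₂₁, hy', hyA', hyB'⟩⟩ := h.exists_mem
  have b1 := h.not_allowed H hs1 ht2 hx hxA hxB hx' hxA' hxB' hy hyA hyB hy' hyA'
  have b2 := h.flip.swap.not_allowed H.swap ht2 hs1 hx' hxB' hxA' hx hxB hxA hy hyB hyA hy' hyB'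
  unfold Allowed at b1 b2
  push Not at b1 b2
  obtain ⟨l, hl, hyl, hxl⟩ := b1
  obtain ⟨k, hk, hyk, hxk⟩ := b2
  have hyQ := Finset.mem_of_mem_erase hy
  obtain ⟨hA1, hpA1, hqA1⟩ := slack_of_nextSlack_eq_zero h.sysA.nonneg h.obs.fst.left hs1
  obtain ⟨hA2, hpA2, hqA2⟩ := slack_of_nextSlack_eq_zero h.sysA.nonneg h.obs.fst.right hs2
  obtain ⟨hB2, hpB2, hqB2⟩ := slack_of_nextSlack_eq_zero h.sysB.nonneg h.obs.snd.right ht2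
  have hpk : p ∈ A k := by
    have hne : i₁ ≠ k := by rintro rfl; exact hs1 hk
    exact h.sysA.mem_of_add_le_one hne (by omega) hyQ hyA hyk h.memP hpA1
  have hpl : p ∈ B l := by
    have hne : j₂ ≠ l := by rintro rfl; exact ht2 hl
    exact h.sysB.mem_of_add_le_one hne (by omega) hyQ hyB hyl h.memP hpB2
  have aA : Allowed A s p y₁₂ := fun k' hk' hyk' => h.sysA.eq_of_tight hk hk' hyQ hyk hyk' ▸ hpk
  have aB : Allowed B t p y₁₂ := fun k' hk' hyk' => h.sysB.eq_of_tight hl hk' hyQ hyl hyk' ▸ hpl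
  obtain ⟨d', k₁, k₂, m₁, m₂, h'⟩ := H _ h.memP _ hyQ aA aB
  have hA' := h.sysA.next h.memP hyQ aA
  have hn1 : nextSlack A s p y₁₂ i₁ = 0 := by simp [nextSlack, hpA1, hyA, hA1]
  have hy2 : y₁₂ ∉ A i₂ := fun e => (h.obs.fst.memQ _ hy).1 e hyA
  have hn2 : nextSlack A s p y₁₂ i₂ = 1 := by simp [nextSlack, hpA2, hy2, hA2]
  have hqy : q ∈ Q.erase y₁₂ :=
    Finset.mem_erase.2 ⟨fun e => (Finset.mem_erase.1 hy).1 e.symm, h.memQ⟩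
  obtain ⟨S, hS⟩ : ∃ S, TightPartition (P.erase p) (Q.erase y₁₂) A (nextSlack A s p y₁₂) i₁ S := by
    by_cases hqk : q ∈ A k₁
    · have := hA'.eq_of_tight hn1 h'.fst.left hqy hqA1 hqk
      exact ⟨k₂, this ▸ h'.fst⟩
    · have := hA'.eq_of_tight hn1 h'.fst.right hqy hqA1 ((h'.fst.memQ q hqy).2 hqk)
      exact ⟨k₁, this ▸ h'.fst.symm⟩
  have hSi : S ≠ i₂ := by
    rintro rfl
    have := hS.right
    omega
  have hyy : y₂₁ ∈ Q.erase y₁₂ :=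
    Finset.mem_erase.2 ⟨fun e => hy2 (e ▸ hyA'), Finset.mem_of_mem_erase hy'⟩
  have hyS := (hS.memQ _ hyy).2 ((h.obs.fst.memQ _ hy').1 hyA')
  have := hA'.mem_of_add_le_one hSi (by rw [hS.right, hn2]; rfl) hyy hyS hyA' hx
    fun e => (hS.memP _ hx).1 e hxA
  exact (h.obs.fst.memP _ hx).1 this hxA

/-- Two sets that were tight before already had to partition p and q as well, by disjointness on Q
and covering of P. -/
lemma TightPartition.of_next
    (h : TightPartition (P.erase p) (Q.erase q) A (nextSlack A s p q) i j)
    (hA : SplitSystem P Q A s) (hp : p ∈ P) (hq : q ∈ Q) (hi : s i = 0) (hj : s j = 0) :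
    TightPartition P Q A s i j ∧ (p ∈ A i ↔ q ∈ A i) := by
  have h1 := slack_of_nextSlack_eq_zero' h.left hi
  have h2 := slack_of_nextSlack_eq_zero' h.right hj
  have h3 : q ∈ A i → q ∉ A j := fun e e' => h.ne (hA.eq_of_tight hi hj hq e e')
  have h4 : p ∉ A i → p ∈ A j := hA.mem_of_add_le_zero h.ne (by omega) hp
  refine ⟨⟨h.ne, hi, hj, fun x hx => ?_, fun x hx => ?_⟩, h1⟩
  · by_cases hxp : x = p
    · subst hxp; tauto
    · exact h.memP x (Finset.mem_erase.2 ⟨hxp, hx⟩)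
  · by_cases hxq : x = q
    · subst hxq; tauto
    · exact h.memQ x (Finset.mem_erase.2 ⟨hxq, hx⟩)

/-- Without an obstruction, there is an exchange after which there is still no obstruction. -/
theorem exists_allowed_not_obstructed (hA : SplitSystem P Q A s) (hB : SplitSystem P Q B t)
    (hc : P.card = Q.card) (hne : P.Nonempty) (hno : ∀ d, ¬ Obstructed P Q A s B t d) :
    ∃ p ∈ P, ∃ q ∈ Q, Allowed A s p q ∧ Allowed B t p q ∧
      ∀ d, ¬ Obstructed (P.erase p) (Q.erase q) A (nextSlack A s p q) B (nextSlack B t p q) d := by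
  by_contra hcon
  have H : AlwaysObstructed P Q A s B t := by
    intro x hx y hy ha hb
    by_contra h
    push Not at h
    exact hcon ⟨x, hx, y, hy, ha, hb, h⟩
  obtain ⟨p, hp, q, hq, ha, hb⟩ : ∃ p ∈ P, ∃ q ∈ Q, Allowed A s p q ∧ Allowed B t p q := by
    by_contra h
    push Not at h
    obtain ⟨d, hd⟩ := obstructed_of_stuck hA hB hc hne
      (fun p hp q hq h' => h p hp q hq h'.1 h'.2)
    exact hno d hd
  obtain ⟨d, i₁, i₂, j₁, j₂, hobs⟩ := H p hp q hq ha hb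
  have h : LeadsToObstruction P Q A s B t p q i₁ i₂ j₁ j₂ d := ⟨hA, hB, hc, hp, hq, ha, hb, hobs⟩
  -- If all four sets were tight before, the obstruction was already there. Otherwise, up to
  -- interchanging systems or parts, a set with positive slack faces a system with a tight part, or
  -- all four slacks were positive.
  by_cases hs : s i₁ = 0 ∧ s i₂ = 0
  · by_cases ht : t j₁ = 0 ∧ t j₂ = 0
    · obtain ⟨h1, h1'⟩ := hobs.fst.of_next hA hp hq hs.1 hs.2
      obtain ⟨h2, h2'⟩ := hobs.snd.of_next hB hp hq ht.1 ht.2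
      refine hno d ⟨i₁, i₂, j₁, j₂, h1, h2, ?_, hobs.pos⟩
      have e1 := card_erase_inter hp (A i₁ ∩ B j₁)
      have e2 := card_erase_inter hq (A i₁ ∩ B j₁)
      simp only [Finset.mem_inter, h1', h2'] at e1 e2
      have := hobs.card_eq
      omega
    · by_cases ht1 : t j₁ = 0
      · exact h.flip.swap.false_of_tight H.swap (fun e => ht ⟨ht1, e⟩) (Or.inl hs.2)
      · exact h.swap.false_of_tight H.swap ht1 (Or.inl hs.1)
  · by_cases ht : t j₁ = 0 ∨ t j₂ = 0
    · by_cases hs1 : s i₁ = 0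
      · exact h.flip.false_of_tight H (fun e => hs ⟨hs1, e⟩) ht.symm
      · exact h.false_of_tight H hs1 ht
    · push Not at ht
      by_cases hs' : s i₁ = 0 ∨ s i₂ = 0
      · exact h.swap.false_of_tight H.swap ht.1 hs'
      · push Not at hs'
        exact h.false_of_slack H hs'.1 hs'.2 ht.2

end SplitSystem
/-! ### Exchanges, tight sets, and connectivity of matroids -/

section Combinatorics

variable {α : Type*} [Finite α] {M : Matroid α} {X B F U W K : Set α} {p q x y z : α}

/-- The rank of a set as a natural number. -/
noncomputable def rk (M : Matroid α) (F : Set α) : ℕ := (M.eRk F).toNat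

/-- Replacing `p` by `q` in the base `X` yields a base. -/
def Exch (M : Matroid α) (X : Set α) (p q : α) : Prop :=
  p ∈ X ∧ q ∉ X ∧ M.IsBase (insert q (X \ {p}))

lemma cast_rk (M : Matroid α) (F : Set α) : (rk M F : ℕ∞) = M.eRk F :=
  ENat.natCast_toNat ((M.eRk_le_encard F).trans_lt (Set.toFinite F).encard_lt_top).ne

lemma _root_.Matroid.Indep.ncard_le_rk {I : Set α} (hI : M.Indep I) (hIF : I ⊆ F) :
    I.ncard ≤ rk M F := by
  have h := hI.encard_le_eRk_of_subset hIF
  rw [← cast_rk, ← (Set.toFinite I).cast_ncard_eq] at h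
  exact_mod_cast h

lemma _root_.Matroid.IsBase.ncard_inter_le_rk (hX : M.IsBase X) (F : Set α) :
    (X ∩ F).ncard ≤ rk M F :=
  (hX.indep.subset Set.inter_subset_left).ncard_le_rk Set.inter_subset_right

lemma exists_isBase_ncard_inter_eq (hE : M.E = Set.univ) (F : Set α) :
    ∃ B, M.IsBase B ∧ (B ∩ F).ncard = rk M F := by
  obtain ⟨I, hI⟩ := M.exists_isBasis F (by simp [hE])
  obtain ⟨B, hB, rfl⟩ := hI.exists_isBase
  refine ⟨B, hB, ?_⟩
  have h := hI.encard_eq_eRk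
  rw [← cast_rk, ← (Set.toFinite (B ∩ F)).cast_ncard_eq] at h
  exact_mod_cast h

lemma ncard_exchange (hp : p ∈ X) (hq : q ∉ X) : (insert q (X \ {p})).ncard = X.ncard :=
  Set.ncard_exchange hq hp

/-- A set is tight for a base if and only if no exchange leads into it. -/
theorem ncard_inter_eq_rk_iff (hE : M.E = Set.univ) (hX : M.IsBase X) (F : Set α) :
    (X ∩ F).ncard = rk M F ↔ ∀ p q, Exch M X p q → q ∈ F → p ∈ F := by
  constructor
  · rintro h p q ⟨hp, hq, hb⟩ hqF
    by_contra hpF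
    have h1 := hb.ncard_inter_le_rk F
    have h2 : insert q (X \ {p}) ∩ F = insert q (X ∩ F) := by
      ext x; simp only [Set.mem_inter_iff, Set.mem_insert_iff, Set.mem_sdiff,
        Set.mem_singleton_iff]
      constructor
      · tauto
      · rintro (rfl | ⟨h1, h2⟩)
        · exact ⟨Or.inl rfl, hqF⟩
        · exact ⟨Or.inr ⟨h1, fun e => hpF (e ▸ h2)⟩, h2⟩
    rw [h2, Set.ncard_insert_of_notMem (fun h => hq h.1), h] at h1
    omega
  · intro h
    refine le_antisymm (hX.ncard_inter_le_rk F) ?_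
    by_contra hlt
    push Not at hlt
    obtain ⟨B, hB, hBF⟩ := exists_isBase_ncard_inter_eq hE F
    have hI1 := hX.indep.subset (Set.inter_subset_left (t := F))
    have hI2 := hB.indep.subset (Set.inter_subset_left (t := F))
    -- If X ∩ F is not largest, some q ∈ F augments it. Extending the result to a base inside X + q
    -- drops one element p outside F: an exchange into F.
    obtain ⟨q, ⟨hqB, hqX⟩, hq⟩ := hI1.exists_insert_of_encard_lt hI2 (by
      rw [← (Set.toFinite (X ∩ F)).cast_ncard_eq, ← (Set.toFinite (B ∩ F)).cast_ncard_eq]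
      exact_mod_cast hBF ▸ hlt)
    have hqX' : q ∉ X := fun hh => hqX ⟨hh, hqB.2⟩
    obtain ⟨J, hJ, hIJ⟩ := hq.subset_isBasis_of_subset
      (Set.insert_subset_insert (Set.inter_subset_left (t := F)) : _ ⊆ insert q X)
      (by simp [hE])
    have hJb : M.IsBase J := hJ.isBase_of_spanning
      (hX.spanning.superset (Set.subset_insert q X) (by simp [hE]))
    have hcard := hX.ncard_eq_ncard_of_isBase hJb
    have hqJ : q ∈ J := hIJ (Set.mem_insert _ _)
    obtain ⟨p, hpX, hpJ⟩ : ∃ p ∈ X, p ∉ J := by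
      by_contra hcon
      push Not at hcon
      have : X = J := Set.eq_of_subset_of_ncard_le hcon hcard.ge
      exact hqX' (this ▸ hqJ)
    have hJeq : J = insert q (X \ {p}) := by
      refine Set.eq_of_subset_of_ncard_le ?_ ?_
      · intro x hx
        rcases hJ.subset hx with rfl | hxX
        · exact Set.mem_insert _ _
        · exact Set.mem_insert_of_mem _ ⟨hxX, fun e => hpJ (e ▸ hx)⟩
      · rw [ncard_exchange hpX hqX', hcard]
    have hpF := h p q ⟨hpX, hqX', hJeq ▸ hJb⟩ hqB.2
    exact hpJ (hIJ (Set.mem_insert_of_mem _ ⟨hpX, hpF⟩))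

lemma ncard_inter_add_ncard_sdiff (X U : Set α) : (X ∩ U).ncard + (X \ U).ncard = X.ncard :=
  Set.ncard_inter_add_ncard_sdiff_eq_ncard X U (Set.toFinite X)

/-- A separator: all bases have the same number of elements in it. -/
def Sep (M : Matroid α) (U : Set α) : Prop :=
  ∀ B, M.IsBase B → (B ∩ U).ncard = rk M U

/-- Both U and its complement are tight for X, so |X ∩ U| and |X \ U| are upper bounds for all
bases; the totals agree. -/
lemma sep_of_exch (hE : M.E = Set.univ) (hX : M.IsBase X)
    (h : ∀ p q, Exch M X p q → (p ∈ U ↔ q ∈ U)) : Sep M U := by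
  intro B hB
  have h1 := (ncard_inter_eq_rk_iff hE hX U).2 fun p q hpq => (h p q hpq).2
  have h2 := (ncard_inter_eq_rk_iff hE hX Uᶜ).2 fun p q hpq hq => fun hp => hq ((h p q hpq).1 hp)
  have h3 := hB.ncard_inter_le_rk U
  have h4 := hB.ncard_inter_le_rk Uᶜ
  have h5 := hX.ncard_eq_ncard_of_isBase hB
  have h6 := ncard_inter_add_ncard_sdiff X U
  have h7 := ncard_inter_add_ncard_sdiff B U
  rw [Set.sdiff_eq] at h6 h7
  omega

lemma ncard_inter_exchange (hp : p ∈ X) (hq : q ∉ X) (F : Set α) :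
    (((insert q (X \ {p})) ∩ F).ncard : ℤ) =
      (X ∩ F).ncard + (open Classical in if q ∈ F then 1 else 0)
        - (open Classical in if p ∈ F then 1 else 0) := by
  classical
  have h1 : ((insert q (X \ {p})) ∩ F).ncard =
      ((X ∩ F) \ {p}).ncard + (if q ∈ F then 1 else 0) := by
    split_ifs with h
    · rw [← Set.ncard_insert_of_notMem (a := q) (s := (X ∩ F) \ {p}) (fun hh => hq hh.1.1)]
      congr 1; ext x; simp only [Set.mem_inter_iff, Set.mem_insert_iff, Set.mem_sdiff,
        Set.mem_singleton_iff]
      grind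
    · congr 1; ext x; simp only [Set.mem_inter_iff, Set.mem_insert_iff, Set.mem_sdiff,
        Set.mem_singleton_iff]
      grind
  rw [h1]
  by_cases hpF : p ∈ F
  · have := Set.ncard_sdiff_singleton_add_one (a := p) (s := X ∩ F) ⟨hp, hpF⟩
    simp only [hpF, if_true]
    push_cast
    omega
  · rw [Set.sdiff_singleton_eq_self fun hh => hpF hh.2]
    simp [hpF]

lemma Sep.mem_iff (hU : Sep M U) (hX : M.IsBase X) (h : Exch M X p q) : p ∈ U ↔ q ∈ U := by
  have h1 := ncard_inter_exchange h.1 h.2.1 U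
  rw [hU _ h.2.2, hU X hX] at h1
  split_ifs at h1 <;> first | omega | tauto

/-- Two elements that no separator separates. -/
def Conn (M : Matroid α) (x y : α) : Prop := ∀ U, Sep M U → (x ∈ U ↔ y ∈ U)

/-- The connected component of an element. -/
def cls (M : Matroid α) (x : α) : Set α := {y | Conn M x y}

lemma Conn.symm (h : Conn M x y) : Conn M y x := fun U hU => (h U hU).symm

lemma Conn.trans (h : Conn M x y) (h' : Conn M y z) : Conn M x z :=
  fun U hU => (h U hU).trans (h' U hU)

lemma mem_cls_self (M : Matroid α) (x : α) : x ∈ cls M x := fun _ _ => Iff.rfl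

lemma cls_eq (h : Conn M x y) : cls M x = cls M y :=
  Set.ext fun _ => ⟨fun hz => h.symm.trans hz, fun hz => h.trans hz⟩

lemma Exch.conn (hX : M.IsBase X) (h : Exch M X p q) : Conn M p q := fun _ hU => hU.mem_iff hX h

lemma sep_cls (hE : M.E = Set.univ) (x : α) : Sep M (cls M x) := by
  obtain ⟨X, hX⟩ := M.exists_isBase
  exact sep_of_exch hE hX fun p q h =>
    ⟨fun hp => hp.trans (h.conn hX), fun hq => hq.trans (h.conn hX).symm⟩

lemma Sep.cls_subset (hU : Sep M U) (hx : x ∈ U) : cls M x ⊆ U := fun _ hy => (hy U hU).1 hx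

/-- The exchange graph of the base `X` is connected on `W`. -/
def ConnOn (M : Matroid α) (X W : Set α) : Prop :=
  ∀ U ⊆ W, U.Nonempty → (∀ x y, Exch M X x y → x ∈ W → y ∈ W → (x ∈ U ↔ y ∈ U)) → U = W

/-- A union of connected components of the exchange graph of a single base is already a separator.
-/
lemma connOn_cls (hE : M.E = Set.univ) (hX : M.IsBase X) (z : α) : ConnOn M X (cls M z) := by
  rintro U hU ⟨u, hu⟩ h
  refine hU.antisymm ?_
  have hsep : Sep M U := sep_of_exch hE hX fun x y hxy => by
    have h1 := (sep_cls hE z).mem_iff hX hxy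
    by_cases hx : x ∈ cls M z
    · exact h x y hxy hx (h1.1 hx)
    · exact ⟨fun e => absurd (hU e) hx, fun e => absurd (h1.2 (hU e)) hx⟩
  have := hsep.cls_subset hu
  rwa [← cls_eq (hU hu)] at this

/-- A connected set with a neighbour inside for each of its elements, unless it is a singleton. -/
lemma ConnOn.exists_exch (h : ConnOn M X W) (hx : x ∈ W) (hy : y ∈ W) (hxy : x ≠ y) :
    ∃ u ∈ W, Exch M X x u ∨ Exch M X u x := by
  by_contra hcon
  push Not at hcon
  have := h {x} (by simpa using hx) (Set.singleton_nonempty x) fun a b hab ha hb => by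
    simp only [Set.mem_singleton_iff]
    exact ⟨fun e => absurd (e ▸ hab) (hcon b hb).1, fun e => absurd (e ▸ hab) (hcon a ha).2⟩
  rw [← this] at hy
  exact hxy hy.symm

/-- A cocyclic part of a component: its complement spans a hyperedge, at the base `X`. -/
structure IsCut (M : Matroid α) (X K W : Set α) : Prop where
  base : M.IsBase X
  eq_cls : ∃ z, K = cls M z
  sub : W ⊆ K
  -- Equivalently, the complement of W is tight for X.
  closed : ∀ x y, Exch M X x y → x ∈ W → y ∈ W
  -- Connectedness of both sides makes the face a facet. The four nonemptiness conditions below make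
  -- its hyperplane meet the relative interior.
  connOn : ConnOn M X W
  connOn_sdiff : ConnOn M X (K \ W)
  memX : (W ∩ X).Nonempty
  notMemX : (W \ X).Nonempty
  sdiff_memX : ((K \ W) ∩ X).Nonempty
  sdiff_notMemX : ((K \ W) \ X).Nonempty

/-- A missing exchange inside a component is caused by a cut. -/
theorem exists_isCut (hE : M.E = Set.univ) (hX : M.IsBase X) (hp : p ∈ X) (hq : q ∉ X)
    (hpq : Conn M p q) (hno : ¬ Exch M X p q) :
    ∃ W, IsCut M X (cls M p) W ∧ p ∈ W ∧ q ∉ W := by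
  set K := cls M p with hK
  -- Remove q and its neighbours in the exchange graph from the component. The cut is the connected
  -- component of p in the rest, written as an intersection.
  set N := K \ {x | x = q ∨ Exch M X x q} with hN
  set S : Set (Set α) := {U | p ∈ U ∧ U ⊆ N ∧
    ∀ x y, Exch M X x y → x ∈ N → y ∈ N → (x ∈ U ↔ y ∈ U)} with hS
  have hpN : p ∈ N := ⟨mem_cls_self M p, by
    rintro (rfl | h)
    · exact hq hp
    · exact hno h⟩
  set W := ⋂₀ S with hW
  have hpW : p ∈ W := fun U hU => hU.1
  have hWN : W ⊆ N := Set.sInter_subset_of_mem ⟨hpN, subset_rfl, fun _ _ _ hx hy => by simp [hx, hy]⟩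
  have hWe : ∀ x y, Exch M X x y → x ∈ N → y ∈ N → (x ∈ W ↔ y ∈ W) := fun x y hxy hx hy =>
    ⟨fun h U hU => (hU.2.2 x y hxy hx hy).1 (h U hU),
      fun h U hU => (hU.2.2 x y hxy hx hy).2 (h U hU)⟩
  have hWK : W ⊆ K := hWN.trans Set.sdiff_subset
  have hclosed : ∀ x y, Exch M X x y → x ∈ W → y ∈ W := by
    intro x y hxy hx
    refine (hWe x y hxy (hWN hx) ⟨(hWK hx).trans (hxy.conn hX), ?_⟩).1 hx
    -- The element y is not q, since x is no neighbour of q, and it is not a neighbour of q, since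
    -- it is outside X.
    rintro (rfl | h)
    · exact (hWN hx).2 (Or.inr hxy)
    · exact hxy.2.1 h.1
  have hqK : q ∈ K := hpq
  have hqW : q ∉ W := fun h => (hWN h).2 (Or.inl rfl)
  have hconn : ConnOn M X W := by
    rintro U hU ⟨u, hu⟩ h
    by_cases hpU : p ∈ U
    · refine hU.antisymm (Set.sInter_subset_of_mem ⟨hpU, hU.trans hWN, fun x y hxy hx hy => ?_⟩)
      have h1 := hWe x y hxy hx hy
      by_cases hxW : x ∈ W
      · exact h x y hxy hxW (h1.1 hxW)
      · exact ⟨fun e => absurd (hU e) hxW, fun e => absurd (h1.2 (hU e)) hxW⟩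
    · exfalso
      have : W ⊆ W \ U := Set.sInter_subset_of_mem
        ⟨⟨hpW, hpU⟩, Set.sdiff_subset.trans hWN, fun x y hxy hx hy => by
          have h1 := hWe x y hxy hx hy
          by_cases hxW : x ∈ W
          · have := h x y hxy hxW (h1.1 hxW)
            simp only [Set.mem_sdiff, this, h1]
          · exact ⟨fun e => absurd e.1 hxW, fun e => absurd (h1.2 e.1) hxW⟩⟩
      exact (this (hU hu)).2 hu
  have hKc : ConnOn M X K := connOn_cls hE hX p
  have hnbr : ∀ x, Exch M X x q → x ∈ K \ W := fun x hx =>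
    ⟨hpq.trans (hx.conn hX).symm, fun h => (hWN h).2 (Or.inr hx)⟩
  have hconn' : ConnOn M X (K \ W) := by
    -- A union of components of K \ W without q contains no neighbour of q and has no edge to W, so
    -- it would be all of K. Hence every component of K \ W contains q, and there is only one.
    have key : ∀ U ⊆ K \ W, U.Nonempty →
        (∀ x y, Exch M X x y → x ∈ K \ W → y ∈ K \ W → (x ∈ U ↔ y ∈ U)) → q ∈ U := by
      intro U hU hne h
      by_contra hqU
      have hUN : U ⊆ N := by
        refine fun x hx => ⟨(hU hx).1, ?_⟩
        rintro (rfl | hxq)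
        · exact hqU hx
        · exact hqU ((h x q hxq (hU hx) ⟨hqK, hqW⟩).1 hx)
      have := hKc U (fun x hx => (hU hx).1) hne fun x y hxy hx hy => by
        constructor
        · intro hxU
          have hyW : y ∉ W := by
            intro hyW
            exact (hU hxU).2 ((hWe x y hxy (hUN hxU) (hWN hyW)).2 hyW)
          exact (h x y hxy (hU hxU) ⟨hy, hyW⟩).1 hxU
        · intro hyU
          have hxW : x ∉ W := fun hxW => (hU hyU).2 (hclosed x y hxy hxW)
          exact (h x y hxy ⟨hx, hxW⟩ (hU hyU)).2 hyU
      exact hqU (this ▸ hqK)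
    intro U hU hne h
    have hqU := key U hU hne h
    by_contra hne'
    have hne'' : ((K \ W) \ U).Nonempty := by
      rw [Set.nonempty_iff_ne_empty]
      intro he
      exact hne' (hU.antisymm (Set.sdiff_eq_empty.1 he))
    have := key ((K \ W) \ U) Set.sdiff_subset hne'' fun x y hxy hx hy => by
      simp only [Set.mem_sdiff, h x y hxy hx hy]
      have := h x y hxy hx hy
      simp only [Set.mem_sdiff] at hx hy
      tauto
    exact this.2 hqU
  have hpqne : p ≠ q := fun e => hq (e ▸ hp)
  obtain ⟨u, huK, hu⟩ := hKc.exists_exch (mem_cls_self M p) hqK hpqne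
  obtain ⟨v, hvK, hv⟩ := hKc.exists_exch hqK (mem_cls_self M p) hpqne.symm
  have hu' : Exch M X p u := hu.resolve_right fun h => h.2.1 hp
  have hv' : Exch M X v q := hv.resolve_left fun h => hq h.1
  exact ⟨W, ⟨hX, ⟨p, rfl⟩, hWK, hclosed, hconn, hconn', ⟨p, hpW, hp⟩,
    ⟨u, hclosed p u hu' hpW, hu'.2.1⟩, ⟨v, hnbr v hv', hv'.1⟩, ⟨q, ⟨hqK, hqW⟩, hq⟩⟩, hpW, hqW⟩

/-- A cut is met least by its base. -/
lemma IsCut.ncard_inter_le (hE : M.E = Set.univ) (h : IsCut M X K W) (hB : M.IsBase B) :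
    (X ∩ W).ncard ≤ (B ∩ W).ncard := by
  have h1 := (ncard_inter_eq_rk_iff hE h.base Wᶜ).2 fun p q hpq hq hp => hq (h.closed p q hpq hp)
  have h2 := hB.ncard_inter_le_rk Wᶜ
  have h3 := h.base.ncard_eq_ncard_of_isBase hB
  have h4 := ncard_inter_add_ncard_sdiff X W
  have h5 := ncard_inter_add_ncard_sdiff B W
  rw [Set.sdiff_eq] at h4 h5
  omega

/-- Other bases that meet the cut in the same number of elements see it as closed, too. -/
lemma IsCut.closed_of_ncard_eq (hE : M.E = Set.univ) (h : IsCut M X K W) (hB : M.IsBase B)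
    (hBW : (B ∩ W).ncard = (X ∩ W).ncard) : ∀ x y, Exch M B x y → x ∈ W → y ∈ W := by
  have h1 := (ncard_inter_eq_rk_iff hE h.base Wᶜ).2 fun p q hpq hq hp => hq (h.closed p q hpq hp)
  have h3 := h.base.ncard_eq_ncard_of_isBase hB
  have h4 := ncard_inter_add_ncard_sdiff X W
  have h5 := ncard_inter_add_ncard_sdiff B W
  rw [Set.sdiff_eq] at h4 h5
  have h6 := (ncard_inter_eq_rk_iff hE hB Wᶜ).1 (by omega)
  intro x y hxy hx
  by_contra hy
  exact h6 x y hxy hy hx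

end Combinatorics
-- Numerical comparison of two cuts
section TwoCuts

variable {α : Type*} [Finite α] {M : Matroid α} {X Y K W W' : Set α}

/-- Nested cuts without coloops in between are equal. -/
lemma IsCut.eq_of_ncard_sdiff_le (hE : M.E = Set.univ) (h : IsCut M X K W) (h' : IsCut M Y K W')
    (hle : (W \ W').ncard + (Y ∩ W').ncard ≤ (X ∩ W).ncard) : W = W' := by
  have h1 := h.ncard_inter_le hE h'.base
  have h2 := ncard_inter_add_ncard_sdiff (Y ∩ W) W'
  have h3 : ((Y ∩ W) ∩ W').ncard ≤ (Y ∩ W').ncard :=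
    Set.ncard_le_ncard (fun x hx => ⟨hx.1.1, hx.2⟩) (Set.toFinite _)
  have h4 : ((Y ∩ W) \ W').ncard ≤ (W \ W').ncard :=
    Set.ncard_le_ncard (fun x hx => ⟨hx.1.2, hx.2⟩) (Set.toFinite _)
  -- By `hle`, there is equality in |Y ∩ W| ≤ |W \ W'| + |Y ∩ W'|, and Y meets W least. So W \ W' ⊆
  -- Y, Y ∩ W' ⊆ W, and W is closed at Y.
  have e1 : (Y ∩ W) ∩ W' = Y ∩ W' := Set.eq_of_subset_of_ncard_le
    (fun x hx => ⟨hx.1.1, hx.2⟩) (by omega)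
  have e2 : (Y ∩ W) \ W' = W \ W' := Set.eq_of_subset_of_ncard_le
    (fun x hx => ⟨hx.1.2, hx.2⟩) (by omega)
  have hcl := h.closed_of_ncard_eq hE h'.base (by omega)
  have hsub : ∀ x ∈ W, x ∉ W' → x ∈ Y := fun x hx hx' => (e2.symm ▸ (⟨hx, hx'⟩ : x ∈ W \ W') :
    x ∈ (Y ∩ W) \ W').1.1
  have hsub' : ∀ x ∈ Y, x ∈ W' → x ∈ W := fun x hx hx' => (e1.symm ▸ (⟨hx, hx'⟩ : x ∈ Y ∩ W') :
    x ∈ (Y ∩ W) ∩ W').1.2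
  have hWW' : W ⊆ W' := by
    by_contra hcon
    have hne : (W \ W').Nonempty := Set.sdiff_nonempty.2 hcon
    -- No exchange ends in W \ W' ⊆ Y, and those starting there end in W ∩ W'. So W \ W' is isolated
    -- in the connected set K \ W'.
    have := h'.connOn_sdiff (W \ W') (fun x hx => ⟨h.sub hx.1, hx.2⟩) hne fun x y hxy hx hy => by
      constructor
      · intro hxU
        exact absurd (hsub y (hcl x y hxy hxU.1) hy.2) hxy.2.1
      · intro hyU
        exact absurd (hsub y hyU.1 hyU.2) hxy.2.1
    obtain ⟨z, hz, hzY⟩ := h'.sdiff_notMemX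
    rw [← this] at hz
    exact hzY (hsub z hz.1 hz.2)
  refine hWW'.antisymm ?_
  by_contra hcon
  have hne : (W' \ W).Nonempty := Set.sdiff_nonempty.2 hcon
  have := h'.connOn (W' \ W) Set.sdiff_subset hne fun x y hxy hx hy => by
    have hxW := hsub' x hxy.1 hx
    exact ⟨fun e => absurd hxW e.2, fun e => absurd (hcl x y hxy hxW) e.2⟩
  obtain ⟨z, hz, -⟩ := h.memX
  exact (this.symm ▸ hWW' hz : z ∈ W' \ W).2 hz

/-- A component is not the union of two cuts closed at the same base. -/
lemma IsCut.sdiff_not_closed (hE : M.E = Set.univ) (h : IsCut M X K W)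
    (hcl : ∀ x y, Exch M X x y → x ∈ K \ W → y ∈ K \ W) : False := by
  obtain ⟨z, rfl⟩ := h.eq_cls
  have := connOn_cls hE h.base z W h.sub (h.memX.mono Set.inter_subset_left) fun x y hxy hx hy =>
    ⟨h.closed x y hxy, fun hyW => by
      by_contra hxW
      exact (hcl x y hxy ⟨hx, hxW⟩).2 hyW⟩
  obtain ⟨w, hw, -⟩ := h.sdiff_memX
  exact hw.2 (this.symm ▸ hw.1)

/-- Two cuts of a component are not independent of each other. -/
lemma IsCut.lt_ncard_inter_add (hE : M.E = Set.univ) (h : IsCut M X K W) (h' : IsCut M Y K W') :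
    (X ∩ W).ncard + (Y ∩ W').ncard < (W ∩ W').ncard + (X ∩ K).ncard := by
  by_contra hle
  push Not at hle
  have h1 := h'.ncard_inter_le hE h.base
  have h2 := Set.ncard_union_add_ncard_inter (X ∩ W) (X ∩ W') (Set.toFinite _) (Set.toFinite _)
  have s1 : (X ∩ W) ∪ (X ∩ W') ⊆ X ∩ K := by
    rintro x (hx | hx)
    · exact ⟨hx.1, h.sub hx.2⟩
    · exact ⟨hx.1, h'.sub hx.2⟩
  have s2 : (X ∩ W) ∩ (X ∩ W') ⊆ W ∩ W' := fun x hx => ⟨hx.1.2, hx.2.2⟩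
  have h3 := Set.ncard_le_ncard s1 (Set.toFinite _)
  have h4 := Set.ncard_le_ncard s2 (Set.toFinite _)
  -- All estimates are equalities: W ∩ W' ⊆ X, X ∩ K ⊆ W ∪ W', and both cuts are closed at X. Then W
  -- ∩ W' and K \ (W ∪ W') are isolated in the exchange graph, hence empty, and K falls into two
  -- closed halves.
  have e1 := Set.eq_of_subset_of_ncard_le s1 (by omega)
  have e2 := Set.eq_of_subset_of_ncard_le s2 (by omega)
  have hcl := h'.closed_of_ncard_eq hE h.base (by omega)
  have hX : ∀ x ∈ W, x ∈ W' → x ∈ X := fun x hx hx' =>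
    (e2.symm ▸ (⟨hx, hx'⟩ : x ∈ W ∩ W') : x ∈ (X ∩ W) ∩ (X ∩ W')).1.1
  have hcov : ∀ x ∈ X, x ∈ K → x ∈ W ∨ x ∈ W' := fun x hx hx' =>
    (e1.symm ▸ (⟨hx, hx'⟩ : x ∈ X ∩ K) : x ∈ (X ∩ W) ∪ (X ∩ W')).imp And.right And.right
  have hKc : ConnOn M X K := by
    obtain ⟨z, rfl⟩ := h.eq_cls
    exact connOn_cls hE h.base z
  have hdisj : ∀ x ∈ W, x ∉ W' := by
    intro u hu hu'
    have := hKc (W ∩ W') (fun x hx => h.sub hx.1) ⟨u, hu, hu'⟩ fun x y hxy hx hy =>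
      ⟨fun e => absurd (hX y (h.closed x y hxy e.1) (hcl x y hxy e.2)) hxy.2.1,
        fun e => absurd (hX y e.1 e.2) hxy.2.1⟩
    obtain ⟨z, hz, hzX⟩ := h.notMemX
    have hz' : z ∈ W ∩ W' := this.symm ▸ h.sub hz
    exact hzX (hX z hz'.1 hz'.2)
  have hcov' : ∀ x ∈ K, x ∈ W ∨ x ∈ W' := by
    by_contra hcon
    push Not at hcon
    obtain ⟨u, hu, hu1, hu2⟩ := hcon
    have := hKc (K \ (W ∪ W')) Set.sdiff_subset ⟨u, hu, by simp [hu1, hu2]⟩ fun x y hxy hx hy => by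
      have h1 := hcov x hxy.1 hx
      refine ⟨fun e => absurd h1 e.2, fun e => ?_⟩
      rcases h1 with h1 | h1
      · exact absurd (Or.inl (h.closed x y hxy h1)) e.2
      · exact absurd (Or.inr (hcl x y hxy h1)) e.2
    obtain ⟨z, hz, -⟩ := h.memX
    have hz' : z ∈ K \ (W ∪ W') := this.symm ▸ h.sub hz
    exact hz'.2 (Or.inl hz)
  refine h.sdiff_not_closed hE fun x y hxy hx => ?_
  have hx' := (hcov' x hx.1).resolve_left hx.2
  have hy' := hcl x y hxy hx'
  exact ⟨h'.sub hy', fun hy => hdisj y hy hy'⟩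

end TwoCuts

/-! ### The base polytope -/

section Polytope

variable {α : Type*} [Fintype α] {M : Matroid α} {X Y B U W W' K K' : Set α} {i j : α}

/-- The vertex of the base polytope that belongs to a set. -/
noncomputable def chi (B : Set α) : α → ℝ := B.indicator 1

open Classical in
/-- The total weight of a set, as a linear map. -/
noncomputable def wt (U : Set α) : (α → ℝ) →ₗ[ℝ] ℝ where
  toFun x := ∑ i, (if i ∈ U then x i else 0)
  map_add' x y := by
    rw [← Finset.sum_add_distrib]
    exact Finset.sum_congr rfl fun i _ => by split_ifs <;> simp
  map_smul' c x := by
    simp only [Finset.smul_sum, RingHom.id_apply]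
    exact Finset.sum_congr rfl fun i _ => by split_ifs <;> simp

open Classical in
lemma wt_apply (U : Set α) (x : α → ℝ) : wt U x = ∑ i, (if i ∈ U then x i else 0) := rfl

lemma wt_chi (U B : Set α) : wt U (chi B) = ((B ∩ U).ncard : ℝ) := by
  classical
  rw [wt_apply, Set.ncard_eq_toFinset_card', Finset.card_eq_sum_ones, Nat.cast_sum]
  rw [← Finset.sum_filter_of_ne (p := (· ∈ (B ∩ U).toFinset))]
  · refine Finset.sum_congr (by ext; simp) fun i hi => ?_
    simp only [Set.mem_toFinset, Set.mem_inter_iff] at hi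
    simp [chi, hi.1, hi.2]
  · intro i _ hi
    simp only [chi, Set.indicator] at hi
    split_ifs at hi with h1 h2
    · simpa using ⟨h2, h1⟩
    · simp at hi
    · simp at hi

lemma wt_congr {x y : α → ℝ} (h : ∀ i ∈ U, x i = y i) : wt U x = wt U y := by
  classical
  rw [wt_apply, wt_apply]
  exact Finset.sum_congr rfl fun i _ => by split_ifs with hi <;> simp [h, hi]

lemma wt_eq_zero {x : α → ℝ} (h : ∀ i ∈ U, x i = 0) : wt U x = 0 := by
  rw [wt_congr (y := 0) h, map_zero]

lemma mem_rankHyperplane {F : Set α} {x : α → ℝ} :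
    x ∈ rankHyperplane M F ↔ wt F x = rk M F := by rfl

lemma chi_mem (hB : M.IsBase B) : chi B ∈ basePolytope M := subset_convexHull ℝ _ ⟨B, hB, rfl⟩

lemma wt_of_mem_basePolytope (hU : Sep M U) {x : α → ℝ} (hx : x ∈ basePolytope M) :
    wt U x = rk M U := by
  have hconv : Convex ℝ {x : α → ℝ | wt U x = rk M U} :=
    convex_hyperplane (wt U).isLinear _
  refine convexHull_min ?_ hconv hx
  rintro _ ⟨B, hB, rfl⟩
  have := wt_chi U B
  rw [hU B hB] at this
  exact this

lemma wt_of_mem_vectorSpan (hU : Sep M U) {v : α → ℝ} (hv : v ∈ vectorSpan ℝ (basePolytope M)) :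
    wt U v = 0 := by
  have : vectorSpan ℝ (basePolytope M) ≤ (wt U).ker := by
    rw [vectorSpan, Submodule.span_le]
    rintro _ ⟨x, hx, y, hy, rfl⟩
    simp only [SetLike.mem_coe, LinearMap.mem_ker, vsub_eq_sub, map_sub,
      wt_of_mem_basePolytope hU hx, wt_of_mem_basePolytope hU hy, sub_self]
  exact this hv

open Classical in
lemma chi_exchange {p q : α} (hp : p ∈ X) (hq : q ∉ X) :
    chi (insert q (X \ {p})) - chi X = Pi.single q 1 - Pi.single p (1 : ℝ) := by
  ext i
  by_cases h1 : i = q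
  · subst h1
    have : i ≠ p := fun e => hq (e ▸ hp)
    simp [chi, hq, this]
  · by_cases h2 : i = p
    · subst h2; simp [chi, hp, h1]
    · by_cases h3 : i ∈ X <;> simp [chi, h1, h2, h3]

open Classical in
/-- Differences of unit vectors spread along connected sets. -/
lemma ConnOn.single_sub_single_mem {S : Submodule ℝ (α → ℝ)} (h : ConnOn M X W)
    (hS : ∀ x y, Exch M X x y → x ∈ W → y ∈ W → Pi.single y 1 - Pi.single x (1 : ℝ) ∈ S)
    (hi : i ∈ W) (hj : j ∈ W) : Pi.single i 1 - Pi.single j (1 : ℝ) ∈ S := by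
  have := h {j | j ∈ W ∧ Pi.single i 1 - Pi.single j (1 : ℝ) ∈ S} (fun j hj => hj.1)
    ⟨i, hi, by simp⟩ fun x y hxy hx hy => by
      have h1 := hS x y hxy hx hy
      simp only [Set.mem_ofPred_eq, hx, hy, true_and]
      constructor
      · intro h2
        have := S.sub_mem h2 h1
        simpa using this
      · intro h2
        have := S.add_mem h2 h1
        simpa using this
  exact (this.symm ▸ hj : j ∈ {j | j ∈ W ∧ Pi.single i 1 - Pi.single j (1 : ℝ) ∈ S}).2

open Classical in
/-- A vector whose weight vanishes on each block is spanned by differences inside the blocks. -/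
lemma mem_of_single_sub_single_mem {β : Type*} {S : Submodule ℝ (α → ℝ)} (b : α → β)
    (hS : ∀ i j, b i = b j → Pi.single i 1 - Pi.single j (1 : ℝ) ∈ S) {y : α → ℝ}
    (hy : ∀ i, wt {j | b j = b i} y = 0) : y ∈ S := by
  have hρ : ∀ c : Set.range b, ∃ j, b j = c := fun c => c.2
  choose ρ hρ using hρ
  set r : α → α := fun i => ρ ⟨b i, i, rfl⟩ with hr
  have hr1 : ∀ i, b (r i) = b i := fun i => hρ _
  have hr2 : ∀ i j, b i = b j → r i = r j := fun i j hij => by simp only [hr, hij]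
  -- Each unit vector is moved to the representative of its block; the moved terms cancel because
  -- the blocks have weight zero.
  have hdec : y = ∑ i, y i • (Pi.single i 1 - Pi.single (r i) (1 : ℝ)) := by
    have h0 : ∑ i, y i • (Pi.single (r i) (1 : ℝ) : α → ℝ) = 0 := by
      ext k
      simp only [Finset.sum_apply, Pi.smul_apply, smul_eq_mul, Pi.zero_apply]
      by_cases hk : ∃ i, r i = k
      · obtain ⟨i, rfl⟩ := hk
        rw [← hy i, wt_apply]
        refine Finset.sum_congr rfl fun j _ => ?_
        by_cases hji : b j = b i
        · simp [hji, hr2 j i hji]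
        · have : r j ≠ r i := fun e => hji (by rw [← hr1 j, ← hr1 i, e])
          simp [hji, this.symm]
      · push Not at hk
        exact Finset.sum_eq_zero fun j _ => by simp [(hk j).symm]
    simp only [smul_sub, Finset.sum_sub_distrib, h0, sub_zero]
    ext k
    simp [Finset.sum_apply, Pi.single_apply]
  rw [hdec]
  exact S.sum_mem fun i _ => S.smul_mem _ (hS i (r i) (hr1 i).symm)

open Classical in
lemma single_sub_single_mem_vectorSpan (hX : M.IsBase X) {p q : α} (h : Exch M X p q) :
    Pi.single q 1 - Pi.single p (1 : ℝ) ∈ vectorSpan ℝ (basePolytope M) := by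
  rw [← chi_exchange h.1 h.2.1]
  exact vsub_mem_vectorSpan ℝ (chi_mem h.2.2) (chi_mem hX)

lemma cls_eq_iff {x y : α} : cls M x = cls M y ↔ Conn M x y :=
  ⟨fun h => (h.symm ▸ mem_cls_self M y : y ∈ cls M x), cls_eq⟩

lemma setOf_cls_eq (i : α) : {j | cls M j = cls M i} = cls M i := by
  ext j
  rw [Set.mem_ofPred_eq, cls_eq_iff]
  exact ⟨Conn.symm, Conn.symm⟩

/-- The linear span of the base polytope is determined by the components. -/
lemma mem_vectorSpan_iff (hE : M.E = Set.univ) {v : α → ℝ} :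
    v ∈ vectorSpan ℝ (basePolytope M) ↔ ∀ z, wt (cls M z) v = 0 := by
  classical
  refine ⟨fun h z => wt_of_mem_vectorSpan (sep_cls hE z) h, fun h => ?_⟩
  obtain ⟨X, hX⟩ := M.exists_isBase
  refine mem_of_single_sub_single_mem (cls M) (fun i j hij => ?_) fun i => ?_
  · refine (connOn_cls hE hX i).single_sub_single_mem
      (fun x y hxy _ _ => single_sub_single_mem_vectorSpan hX hxy) (mem_cls_self M i) ?_
    exact hij ▸ mem_cls_self M j
  · rw [setOf_cls_eq]; exact h i

lemma IsCut.rk_compl (hE : M.E = Set.univ) (h : IsCut M X K W) : (X ∩ Wᶜ).ncard = rk M Wᶜ :=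
  (ncard_inter_eq_rk_iff hE h.base Wᶜ).2 fun p q hpq hq hp => hq (h.closed p q hpq hp)

lemma IsCut.chi_mem_rankFace_iff (hE : M.E = Set.univ) (h : IsCut M X K W) (hB : M.IsBase B) :
    chi B ∈ rankFace M Wᶜ ↔ (B ∩ W).ncard = (X ∩ W).ncard := by
  have h3 := h.base.ncard_eq_ncard_of_isBase hB
  have h4 := ncard_inter_add_ncard_sdiff X W
  have h5 := ncard_inter_add_ncard_sdiff B W
  have h6 := h.rk_compl hE
  rw [Set.sdiff_eq] at h4 h5
  rw [rankFace, Set.mem_inter_iff, mem_rankHyperplane, wt_chi, Nat.cast_inj]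
  constructor
  · rintro ⟨-, h7⟩; omega
  · intro h7; exact ⟨chi_mem hB, by omega⟩

lemma ncard_inter_exchange_of_iff {p q : α} (hp : p ∈ X) (hq : q ∉ X) (hpq : p ∈ W ↔ q ∈ W) :
    (insert q (X \ {p}) ∩ W).ncard = (X ∩ W).ncard := by
  have := ncard_inter_exchange hp hq W
  by_cases h : q ∈ W
  · rw [if_pos h, if_pos (hpq.2 h)] at this
    omega
  · rw [if_neg h, if_neg (fun e => h (hpq.1 e))] at this
    omega

/-- An exchange of X that does not cross W is an edge of the face. Since the exchange graph is
connected on W, on K \ W and on the other components, these edges span all vectors whose weight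
vanishes on each of these blocks. -/
lemma IsCut.vectorSpan_rankFace (hE : M.E = Set.univ) (h : IsCut M X K W) :
    vectorSpan ℝ (rankFace M Wᶜ) = vectorSpan ℝ (basePolytope M) ⊓ (wt W).ker := by
  classical
  apply le_antisymm
  · refine le_inf (vectorSpan_mono ℝ Set.inter_subset_left) ?_
    rw [vectorSpan, Submodule.span_le]
    rintro _ ⟨x, hx, y, hy, rfl⟩
    have hu : Sep M Set.univ := fun B hB => by
      obtain ⟨B', hB', hc⟩ := exists_isBase_ncard_inter_eq hE Set.univ
      rw [← hc, Set.inter_univ, Set.inter_univ, hB.ncard_eq_ncard_of_isBase hB']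
    have hsum : ∀ x : α → ℝ, wt W x + wt Wᶜ x = wt Set.univ x := fun x => by
      simp only [wt_apply, ← Finset.sum_add_distrib]
      exact Finset.sum_congr rfl fun i _ => by by_cases hi : i ∈ W <;> simp [hi]
    have e1 := wt_of_mem_basePolytope hu hx.1
    have e2 := wt_of_mem_basePolytope hu hy.1
    have e3 := mem_rankHyperplane.1 hx.2
    have e4 := mem_rankHyperplane.1 hy.2
    have e5 := hsum x
    have e6 := hsum y
    simp only [SetLike.mem_coe, LinearMap.mem_ker, vsub_eq_sub, map_sub]
    linarith
  · rintro v ⟨hv, hvW⟩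
    have hvW : wt W v = 0 := hvW
    have hcls := (mem_vectorSpan_iff hE).1 hv
    have hedge : ∀ x y, Exch M X x y → (x ∈ W ↔ y ∈ W) →
        Pi.single y 1 - Pi.single x (1 : ℝ) ∈ vectorSpan ℝ (rankFace M Wᶜ) := by
      intro x y hxy hiff
      rw [← chi_exchange hxy.1 hxy.2.1]
      exact vsub_mem_vectorSpan ℝ ((h.chi_mem_rankFace_iff hE hxy.2.2).2
        (ncard_inter_exchange_of_iff hxy.1 hxy.2.1 hiff)) ((h.chi_mem_rankFace_iff hE h.base).2 rfl)
    obtain ⟨z, hz⟩ := h.eq_cls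
    have hKi : ∀ i ∈ K, cls M i = K := fun i hi => by
      subst hz; exact (cls_eq hi).symm
    refine mem_of_single_sub_single_mem (fun i => (i ∈ W, cls M i)) (fun i j hij => ?_) fun i => ?_
    · simp only [Prod.mk.injEq, eq_iff_iff] at hij
      obtain ⟨h1, h2⟩ := hij
      by_cases hiW : i ∈ W
      · exact h.connOn.single_sub_single_mem
          (fun x y hxy hx hy => hedge x y hxy (by simp [hx, hy])) hiW (h1.1 hiW)
      · have hjW : j ∉ W := fun e => hiW (h1.2 e)
        have hji : j ∈ cls M i := h2 ▸ mem_cls_self M j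
        by_cases hiK : i ∈ K
        · have hjK : j ∈ K := hKi i hiK ▸ hji
          exact h.connOn_sdiff.single_sub_single_mem
            (fun x y hxy hx hy => hedge x y hxy (by simp [hx.2, hy.2])) ⟨hiK, hiW⟩ ⟨hjK, hjW⟩
        · have hd : ∀ x ∈ cls M i, x ∉ W := fun x hx hxW =>
            hiK (hKi x (h.sub hxW) ▸ cls_eq hx ▸ mem_cls_self M i)
          exact (connOn_cls hE h.base i).single_sub_single_mem
            (fun x y hxy hx hy => hedge x y hxy (by simp [hd x hx, hd y hy]))
            (mem_cls_self M i) hji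
    · simp only [Prod.mk.injEq, eq_iff_iff]
      by_cases hiW : i ∈ W
      · rw [← hvW]
        congr 2
        ext j
        simp only [Set.mem_ofPred_eq, hiW, iff_true]
        exact ⟨fun e => e.1, fun e => ⟨e, by rw [hKi j (h.sub e), hKi i (h.sub hiW)]⟩⟩
      · have hs : wt {j | (j ∈ W ↔ i ∈ W) ∧ cls M j = cls M i} v + wt (cls M i ∩ W) v
            = wt (cls M i) v := by
          simp only [wt_apply, ← Finset.sum_add_distrib]
          refine Finset.sum_congr rfl fun j _ => ?_
          have hj : cls M j = cls M i ↔ j ∈ cls M i := by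
            rw [cls_eq_iff]; exact ⟨Conn.symm, Conn.symm⟩
          by_cases hjW : j ∈ W <;> by_cases hji : j ∈ cls M i <;> simp [hiW, hjW, hj, hji]
        rw [hcls i] at hs
        have h0 : wt (cls M i ∩ W) v = 0 := by
          by_cases hiK : i ∈ K
          · rw [hKi i hiK, Set.inter_eq_right.2 h.sub, hvW]
          · refine wt_eq_zero fun x hx => ?_
            exact absurd (hKi x (h.sub hx.2) ▸ cls_eq hx.1 ▸ mem_cls_self M i) hiK
        linarith

/-- Otherwise K \ W would be closed as well. A crossing exchange shows that the weight of W is not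
constant on the polytope. -/
lemma IsCut.exists_crossing (hE : M.E = Set.univ) (h : IsCut M X K W) :
    ∃ x y, Exch M X x y ∧ x ∉ W ∧ y ∈ W := by
  by_contra hcon
  push Not at hcon
  refine h.sdiff_not_closed hE fun x y hxy hx => ⟨?_, hcon x y hxy hx.2⟩
  obtain ⟨z, rfl⟩ := h.eq_cls
  exact hx.1.trans (hxy.conn h.base)

/-- An element of W can be added to X ∩ Wᶜ without losing independence: if it is outside X, it has a
neighbour in W by connectedness. So it is not in the closure of Wᶜ. -/
lemma IsCut.isFlat (hE : M.E = Set.univ) (h : IsCut M X K W) : M.IsFlat Wᶜ := by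
  rw [Matroid.isFlat_iff_closure_eq]
  refine Set.Subset.antisymm ?_ (M.subset_closure _ (by simp [hE]))
  intro q hq hqW
  have key : M.Indep (insert q (X ∩ Wᶜ)) := by
    by_cases hqX : q ∈ X
    · exact h.base.indep.subset (Set.insert_subset hqX Set.inter_subset_left)
    · obtain ⟨y, hy, hyX⟩ := h.memX
      obtain ⟨u, hu, hux⟩ := h.connOn.exists_exch hqW hy (fun e => hqX (e ▸ hyX))
      have hux := hux.resolve_left fun e => hqX e.1
      refine hux.2.2.indep.subset (Set.insert_subset_insert fun x hx => ⟨hx.1, ?_⟩)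
      rintro rfl
      exact hx.2 hu
  have hsub : insert q (X ∩ Wᶜ) ⊆ M.closure Wᶜ :=
    Set.insert_subset hq (Set.inter_subset_right.trans (M.subset_closure _ (by simp [hE])))
  have h1 := key.ncard_le_rk hsub
  rw [rk, M.eRk_closure_eq, ← rk, ← h.rk_compl hE,
    Set.ncard_insert_of_notMem (fun e => e.2 hqW)] at h1
  omega

/-- The direction of the face is the kernel of a nonzero functional on the direction of the
polytope. -/
lemma IsCut.isFlacet (hE : M.E = Set.univ) (h : IsCut M X K W) : IsFlacet M Wᶜ := by
  classical
  refine ⟨h.isFlat hE, ⟨_, (h.chi_mem_rankFace_iff hE h.base).2 rfl⟩, ?_⟩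
  rw [h.vectorSpan_rankFace hE]
  set V := vectorSpan ℝ (basePolytope M)
  have hmap : ((wt W).domRestrict V).ker.map V.subtype = V ⊓ (wt W).ker := by
    ext v
    simp only [Submodule.mem_map, LinearMap.mem_ker, Submodule.mem_inf, Submodule.subtype_apply]
    constructor
    · rintro ⟨w, hw, rfl⟩; exact ⟨w.2, hw⟩
    · rintro ⟨h1, h2⟩; exact ⟨⟨v, h1⟩, h2, rfl⟩
  rw [← hmap, Submodule.finrank_map_subtype_eq]
  obtain ⟨x, y, hxy, hx, hy⟩ := h.exists_crossing hE
  refine Module.Dual.finrank_ker_add_one_of_ne_zero (f := (wt W).domRestrict V) fun h0 => ?_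
  have h1 := LinearMap.congr_fun h0 ⟨_, single_sub_single_mem_vectorSpan h.base hxy⟩
  have h2 : wt W (Pi.single y 1 - Pi.single x (1 : ℝ)) = 0 := h1
  rw [← chi_exchange hxy.1 hxy.2.1, map_sub, wt_chi, wt_chi, sub_eq_zero, Nat.cast_inj] at h2
  have h3 := ncard_inter_exchange hxy.1 hxy.2.1 W
  simp only [hx, hy, if_true, if_false] at h3
  omega

end Polytope
-- Interior points on the hyperplanes of cuts, and the split inequality
section RelativeInterior

variable {α : Type*} [Fintype α] {M : Matroid α} {X Y B U W W' K K' : Set α} {i j : α}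
  {x g : α → ℝ}

/-- A convenient sufficient condition for points in the relative interior of the ambient
polytope. -/
def IsInner (M : Matroid α) (x : α → ℝ) : Prop :=
  (∀ z, wt (cls M z) x = rk M (cls M z)) ∧ ∀ i, (0 < x i ∧ x i < 1) ∨ cls M i = {i}

lemma sep_univ (hE : M.E = Set.univ) : Sep M (Set.univ : Set α) := by
  obtain ⟨X, hX⟩ := M.exists_isBase
  exact sep_of_exch hE hX fun _ _ _ => by simp

lemma mem_affineSpan_iff (hE : M.E = Set.univ) :
    x ∈ affineSpan ℝ (basePolytope M) ↔ ∀ z, wt (cls M z) x = rk M (cls M z) := by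
  obtain ⟨X, hX⟩ := M.exists_isBase
  have hc := chi_mem hX
  have hc' := mem_affineSpan ℝ hc
  have hw : ∀ z, wt (cls M z) (chi X) = rk M (cls M z) := fun z =>
    wt_of_mem_basePolytope (sep_cls hE z) hc
  constructor
  · intro h z
    have h1 := AffineSubspace.vsub_mem_direction h hc'
    rw [direction_affineSpan, mem_vectorSpan_iff hE] at h1
    have := h1 z
    rw [vsub_eq_sub, map_sub, hw] at this
    linarith
  · intro h
    have h1 : x - chi X ∈ (affineSpan ℝ (basePolytope M)).direction := by
      rw [direction_affineSpan, mem_vectorSpan_iff hE]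
      intro z
      rw [map_sub, h, hw, sub_self]
    have := AffineSubspace.vadd_mem_of_mem_direction h1 hc'
    simpa using this

lemma wt_singleton (i : α) (x : α → ℝ) : wt {i} x = x i := by
  classical
  simp [wt_apply]

lemma rk_univ (hE : M.E = Set.univ) : rk M Set.univ = M.eRank.toNat := by
  rw [rk, ← M.eRk_ground, hE]

/-- Points of the affine span whose free coordinates are between `0` and `1`. -/
lemma mem_ambientPolytope (hE : M.E = Set.univ) (hx : x ∈ affineSpan ℝ (basePolytope M))
    (h : ∀ i, cls M i ≠ {i} → 0 < x i ∧ x i < 1) : x ∈ ambientPolytope M := by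
  classical
  refine ⟨⟨fun i => ?_, ?_⟩, hx⟩
  · by_cases hi : cls M i = {i}
    · have h1 := (mem_affineSpan_iff hE).1 hx i
      rw [hi, wt_singleton] at h1
      obtain ⟨B, hB, hc⟩ := exists_isBase_ncard_inter_eq hE {i}
      have h2 : (B ∩ {i}).ncard ≤ 1 :=
        (Set.ncard_le_ncard Set.inter_subset_right (Set.toFinite _)).trans (by simp)
      rw [hc] at h2
      rw [h1]
      exact ⟨by positivity, by exact_mod_cast h2⟩
    · exact ⟨(h i hi).1.le, (h i hi).2.le⟩
  · obtain ⟨X, hX⟩ := M.exists_isBase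
    have h1 := AffineSubspace.vsub_mem_direction hx (mem_affineSpan ℝ (chi_mem hX))
    rw [direction_affineSpan] at h1
    have h2 := wt_of_mem_vectorSpan (sep_univ hE) h1
    rw [vsub_eq_sub, map_sub, wt_of_mem_basePolytope (sep_univ hE) (chi_mem hX), rk_univ hE] at h2
    have h3 : wt Set.univ x = ∑ i, x i := by simp [wt_apply]
    rw [← h3]
    linarith

/-- Strict bounds on the free coordinates define an open set, and all its points in the affine span
belong to the polytope. -/
lemma IsInner.mem_intrinsicInterior (hE : M.E = Set.univ) (h : IsInner M x) :
    x ∈ intrinsicInterior ℝ (ambientPolytope M) := by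
  have hx := (mem_affineSpan_iff hE).2 h.1
  have hxD := mem_ambientPolytope hE hx fun i hi => (h.2 i).resolve_right hi
  have hle : affineSpan ℝ (ambientPolytope M) ≤ affineSpan ℝ (basePolytope M) :=
    affineSpan_le.2 Set.inter_subset_right
  rw [_root_.mem_intrinsicInterior]
  refine ⟨⟨x, mem_affineSpan ℝ hxD⟩, ?_, rfl⟩
  rw [mem_interior]
  refine ⟨(fun y : affineSpan ℝ (ambientPolytope M) => (y : α → ℝ)) ⁻¹'
    {z | ∀ i, cls M i ≠ {i} → 0 < z i ∧ z i < 1}, ?_, ?_, ?_⟩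
  · rintro ⟨z, hz⟩ hz'
    exact mem_ambientPolytope hE (hle hz) hz'
  · refine IsOpen.preimage continuous_subtype_val ?_
    have : {z : α → ℝ | ∀ i, cls M i ≠ {i} → 0 < z i ∧ z i < 1} =
        ⋂ i, {z : α → ℝ | cls M i ≠ {i} → 0 < z i ∧ z i < 1} := by
      ext z; simp
    rw [this]
    refine isOpen_iInter_of_finite fun i => ?_
    by_cases hi : cls M i = {i}
    · simp [hi]
    · simp only [ne_eq, hi, not_false_eq_true, true_imp_iff]
      exact (isOpen_lt continuous_const (continuous_apply i)).inter
        (isOpen_lt (continuous_apply i) continuous_const)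
  · exact fun i hi => (h.2 i).resolve_right hi

lemma wt_const_ite (U R : Set α) (t : ℝ) :
    (open Classical in wt U (fun i => if i ∈ R then t else 0)) = t * (U ∩ R).ncard := by
  classical
  have h : (fun i => if i ∈ R then t else 0) = t • chi R := by
    ext i; by_cases hi : i ∈ R <;> simp [chi, hi]
  have h' := wt_chi U R
  rw [Set.inter_comm] at h'
  rw [← h', ← smul_eq_mul, ← map_smul, ← h]

open Classical in
/-- The function that spreads `t` evenly over `R`. -/
noncomputable def spread (R : Set α) (t : ℝ) : α → ℝ := fun i => if i ∈ R then t / R.ncard else 0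

lemma wt_spread_of_subset {R : Set α} {t : ℝ} (h : R ⊆ U) (ht : R.ncard = 0 → t = 0) :
    wt U (spread R t) = t := by
  have := wt_const_ite U R (t / R.ncard)
  rw [Set.inter_eq_right.2 h] at this
  refine this.trans ?_
  rcases Nat.eq_zero_or_pos R.ncard with h0 | h0
  · simp [h0, ht h0]
  · field_simp

lemma wt_spread_of_disjoint {R : Set α} {t : ℝ} (h : Disjoint U R) : wt U (spread R t) = 0 :=
  wt_eq_zero fun i hi => by simp [spread, Set.disjoint_left.1 h hi]

/-- The rank of each component is distributed evenly. A component with several elements admits an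
exchange, so its rank is strictly between 0 and its size. -/
lemma IsInner.exists (hE : M.E = Set.univ) : ∃ x, IsInner M x := by
  classical
  refine ⟨fun i => rk M (cls M i) / (cls M i).ncard, fun z => ?_, fun i => ?_⟩
  · have h1 : wt (cls M z) (fun i => (rk M (cls M i) / (cls M i).ncard : ℝ)) =
        wt (cls M z) (spread (cls M z) (rk M (cls M z))) := by
      refine wt_congr fun i hi => ?_
      rw [spread, if_pos hi, cls_eq hi]
    rw [h1, wt_spread_of_subset subset_rfl]
    intro h0
    rw [Set.ncard_eq_zero (Set.toFinite _)] at h0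
    exact absurd (h0 ▸ mem_cls_self M z : z ∈ (∅ : Set α)) (Set.notMem_empty z)
  · by_cases hi : cls M i = {i}
    · exact Or.inr hi
    · left
      obtain ⟨X, hX⟩ := M.exists_isBase
      obtain ⟨j, hj, hji⟩ : ∃ j ∈ cls M i, i ≠ j := by
        by_contra hcon
        push Not at hcon
        exact hi (Set.Subset.antisymm (fun j hj => (hcon j hj).symm)
          (by simpa using mem_cls_self M i))
      have hconn := connOn_cls hE hX i
      obtain ⟨u, hu, hiu⟩ := hconn.exists_exch (mem_cls_self M i) hj hji
      obtain ⟨a, b, ha, hb, haX, hbX⟩ : ∃ a b, a ∈ cls M i ∧ b ∈ cls M i ∧ a ∈ X ∧ b ∉ X := by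
        rcases hiu with h | h
        · exact ⟨i, u, mem_cls_self M i, hu, h.1, h.2.1⟩
        · exact ⟨u, i, hu, mem_cls_self M i, h.1, h.2.1⟩
      have h1 : 0 < (X ∩ cls M i).ncard :=
        (Set.ncard_pos (Set.toFinite _)).2 ⟨a, haX, ha⟩
      have h2 : (X ∩ cls M i).ncard < (cls M i).ncard :=
        Set.ncard_lt_ncard ⟨Set.inter_subset_right, fun h => hbX (h hb).1⟩ (Set.toFinite _)
      rw [sep_cls hE i X hX] at h1 h2
      have h3 : (0 : ℝ) < (cls M i).ncard := by exact_mod_cast h1.trans h2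
      exact ⟨div_pos (by exact_mod_cast h1) h3, (div_lt_one h3).2 (by exact_mod_cast h2)⟩

open Classical in
/-- An inner point can be changed on a component. -/
lemma IsInner.piecewise (h : IsInner M x) (hK : ∃ z, K = cls M z)
    (hg : wt K g = rk M K) (hg' : ∀ i ∈ K, 0 < g i ∧ g i < 1) :
    IsInner M (fun i => if i ∈ K then g i else x i) := by
  obtain ⟨z, rfl⟩ := hK
  refine ⟨fun w => ?_, fun i => ?_⟩
  · by_cases hw : Conn M z w
    · rw [← cls_eq hw, ← hg]
      exact wt_congr fun i hi => by simp [hi]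
    · rw [← h.1 w]
      refine wt_congr fun i hi => ?_
      have : i ∉ cls M z := fun hi' => hw (hi'.trans hi.symm)
      simp [this]
  · by_cases hi : i ∈ cls M z
    · simp [hi, hg' i hi]
    · simpa [hi] using h.2 i

lemma spread_apply {R : Set α} {t : ℝ} (hi : i ∈ R) : spread R t i = t / R.ncard := by
  simp [spread, hi]

lemma spread_apply_of_notMem {R : Set α} {t : ℝ} (hi : i ∉ R) : spread R t i = 0 := by
  simp [spread, hi]

lemma spread_bounds {R : Set α} {t : ℝ} (hi : i ∈ R) (h0 : 0 < t) (h1 : t < R.ncard) :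
    0 < spread R t i ∧ spread R t i < 1 := by
  rw [spread_apply hi]
  have : (0 : ℝ) < R.ncard := h0.trans h1
  exact ⟨div_pos h0 this, (div_lt_one this).2 h1⟩

lemma IsCut.rk_eq (hE : M.E = Set.univ) (h : IsCut M X K W) (hB : M.IsBase B) :
    (B ∩ K).ncard = rk M K := by
  obtain ⟨z, rfl⟩ := h.eq_cls
  exact sep_cls hE z B hB

/-- The four nonemptiness conditions of a cut in numbers; they give both sides room for coordinates
strictly between 0 and 1. -/
lemma IsCut.bounds (hE : M.E = Set.univ) (h : IsCut M X K W) :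
    0 < (X ∩ W).ncard ∧ (X ∩ W).ncard < W.ncard ∧ (X ∩ W).ncard < rk M K ∧
      rk M K - (X ∩ W).ncard < (K \ W).ncard := by
  have h1 : (X ∩ W).ncard + (X ∩ (K \ W)).ncard = rk M K := by
    rw [← h.rk_eq hE h.base, ← ncard_inter_add_ncard_sdiff (X ∩ K) W]
    congr 2
    · ext x; exact ⟨fun hx => ⟨⟨hx.1, h.sub hx.2⟩, hx.2⟩, fun hx => ⟨hx.1.1, hx.2⟩⟩
    · ext x; simp only [Set.mem_inter_iff, Set.mem_sdiff]; tauto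
  have h2 : 0 < (X ∩ W).ncard := (Set.ncard_pos (Set.toFinite _)).2 (Set.inter_comm W X ▸ h.memX)
  have h3 : 0 < (X ∩ (K \ W)).ncard :=
    (Set.ncard_pos (Set.toFinite _)).2 (Set.inter_comm (K \ W) X ▸ h.sdiff_memX)
  obtain ⟨a, ha, haX⟩ := h.notMemX
  obtain ⟨b, hb, hbX⟩ := h.sdiff_notMemX
  have h4 : (X ∩ W).ncard < W.ncard :=
    Set.ncard_lt_ncard ⟨Set.inter_subset_right, fun e => haX (e ha).1⟩ (Set.toFinite _)
  have h5 : (X ∩ (K \ W)).ncard < (K \ W).ncard :=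
    Set.ncard_lt_ncard ⟨Set.inter_subset_right, fun e => hbX (e hb).1⟩ (Set.toFinite _)
  omega

/-- The even distribution on both sides of a cut. -/
lemma IsCut.exists_spread (hE : M.E = Set.univ) (h : IsCut M X K W) :
    ∃ g : α → ℝ, wt K g = rk M K ∧ wt W g = (X ∩ W).ncard ∧ ∀ i ∈ K, 0 < g i ∧ g i < 1 := by
  obtain ⟨b1, b2, b3, b4⟩ := h.bounds hE
  have c1 : (0 : ℝ) < (X ∩ W).ncard := by exact_mod_cast b1
  have c2 : ((X ∩ W).ncard : ℝ) < W.ncard := by exact_mod_cast b2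
  have c3 : ((X ∩ W).ncard : ℝ) < rk M K := by exact_mod_cast b3
  have c4 : (rk M K : ℝ) - (X ∩ W).ncard < (K \ W).ncard := by
    rw [← Nat.cast_sub b3.le]; exact_mod_cast b4
  refine ⟨spread W (X ∩ W).ncard + spread (K \ W) (rk M K - (X ∩ W).ncard), ?_, ?_, fun i hi => ?_⟩
  · rw [map_add, wt_spread_of_subset h.sub (by omega),
      wt_spread_of_subset Set.sdiff_subset (by omega)]
    ring
  · rw [map_add, wt_spread_of_subset subset_rfl (by omega),
      wt_spread_of_disjoint Set.disjoint_sdiff_right, add_zero]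
  · by_cases hiW : i ∈ W
    · rw [Pi.add_apply, spread_apply_of_notMem (R := K \ W) (fun e => e.2 hiW), add_zero]
      exact spread_bounds hiW c1 c2
    · rw [Pi.add_apply, spread_apply_of_notMem (R := W) hiW, zero_add]
      exact spread_bounds ⟨hi, hiW⟩ (by linarith) c4

/-- A point of the affine span with the right weight of the cut is on the hyperplane. -/
lemma IsCut.mem_rankHyperplane (hE : M.E = Set.univ) (h : IsCut M X K W)
    (hx : x ∈ affineSpan ℝ (basePolytope M)) (hW : wt W x = (X ∩ W).ncard) :
    x ∈ rankHyperplane M Wᶜ := by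
  rw [SplitExchange.mem_rankHyperplane, ← h.rk_compl hE]
  have h1 := AffineSubspace.vsub_mem_direction hx (mem_affineSpan ℝ (chi_mem h.base))
  rw [direction_affineSpan] at h1
  have h2 := wt_of_mem_vectorSpan (sep_univ hE) h1
  have hsum : ∀ x : α → ℝ, wt W x + wt Wᶜ x = wt Set.univ x := fun x => by
    classical
    simp only [wt_apply, ← Finset.sum_add_distrib]
    exact Finset.sum_congr rfl fun i _ => by by_cases hi : i ∈ W <;> simp [hi]
  rw [vsub_eq_sub, map_sub, ← hsum, ← hsum, wt_chi, wt_chi] at h2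
  linarith

/-- An even distribution on both sides of the cut is an interior point on the hyperplane. -/
lemma IsCut.isSplitFlacet (hE : M.E = Set.univ) (h : IsCut M X K W) : IsSplitFlacet M Wᶜ := by
  classical
  refine ⟨h.isFlacet hE, ?_⟩
  obtain ⟨x, hx⟩ := IsInner.exists hE
  obtain ⟨g, hg, hgW, hg'⟩ := h.exists_spread hE
  have hin := hx.piecewise h.eq_cls hg hg'
  refine ⟨_, h.mem_rankHyperplane hE ((mem_affineSpan_iff hE).2 hin.1) ?_,
    hin.mem_intrinsicInterior hE⟩
  rw [← hgW]
  exact wt_congr fun i hi => by simp [h.sub hi]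

/-- Different cuts define different facets. -/
lemma IsCut.rankFace_ne (hE : M.E = Set.univ) (h : IsCut M X K W) (h' : IsCut M Y K' W')
    (hne : W ≠ W') : rankFace M Wᶜ ≠ rankFace M W'ᶜ := by
  intro heq
  have hX : (X ∩ W').ncard = (Y ∩ W').ncard :=
    (h'.chi_mem_rankFace_iff hE h.base).1 (heq ▸ (h.chi_mem_rankFace_iff hE h.base).2 rfl)
  -- An exchange that does not cross W stays on the common face, so it does not cross W' either.
  have hedge : ∀ x y, Exch M X x y → (x ∈ W ↔ y ∈ W) → (x ∈ W' ↔ y ∈ W') := by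
    intro x y hxy hiff
    have h1 := (h'.chi_mem_rankFace_iff hE hxy.2.2).1 (heq ▸ (h.chi_mem_rankFace_iff hE hxy.2.2).2
      (ncard_inter_exchange_of_iff hxy.1 hxy.2.1 hiff))
    have h2 := ncard_inter_exchange hxy.1 hxy.2.1 W'
    rw [h1, hX] at h2
    split_ifs at h2 <;> first | omega | tauto
  -- Within one component, W' is a union of the connected sides W and K \ W. It cannot be K \ W,
  -- which is not closed at X. In another component, W' would have to be everything.
  by_cases hK : K = K'
  · subst hK
    have d1 : (W ∩ W').Nonempty → W ∩ W' = W := fun hn =>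
      h.connOn _ Set.inter_subset_left hn fun x y hxy hx hy => by
        simp only [Set.mem_inter_iff, hx, hy, true_and]
        exact hedge x y hxy (by simp [hx, hy])
    have d2 : ((K \ W) ∩ W').Nonempty → (K \ W) ∩ W' = K \ W := fun hn =>
      h.connOn_sdiff _ Set.inter_subset_left hn fun x y hxy hx hy => by
        simp only [Set.mem_inter_iff, hx, hy, true_and]
        exact hedge x y hxy (by simp [hx.2, hy.2])
    obtain ⟨a, ha, -⟩ := h'.memX
    obtain ⟨b, hb, -⟩ := h'.sdiff_memX
    by_cases hn : (W ∩ W').Nonempty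
    · have s1 : W ⊆ W' := Set.inter_eq_left.1 (d1 hn)
      have hn2 : ¬ ((K \ W) ∩ W').Nonempty := fun hn2 => by
        have s2 : K \ W ⊆ W' := Set.inter_eq_left.1 (d2 hn2)
        by_cases hbW : b ∈ W
        · exact hb.2 (s1 hbW)
        · exact hb.2 (s2 ⟨hb.1, hbW⟩)
      refine hne (s1.antisymm fun x hx => ?_)
      by_contra hxW
      exact hn2 ⟨x, ⟨h'.sub hx, hxW⟩, hx⟩
    · have hn2 : ((K \ W) ∩ W').Nonempty := ⟨a, ⟨h'.sub ha, fun e => hn ⟨a, e, ha⟩⟩, ha⟩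
      have s2 : K \ W ⊆ W' := Set.inter_eq_left.1 (d2 hn2)
      have hcl := h'.closed_of_ncard_eq hE h.base hX
      refine h.sdiff_not_closed hE fun x y hxy hx => ?_
      have hy := hcl x y hxy (s2 hx)
      exact ⟨h'.sub hy, fun e => hn ⟨y, e, hy⟩⟩
  · obtain ⟨z, hz⟩ := h.eq_cls
    obtain ⟨z', hz'⟩ := h'.eq_cls
    have hd : ∀ x ∈ K', x ∉ W := by
      intro x hx hxW
      have hxK := h.sub hxW
      rw [hz] at hxK
      rw [hz'] at hx
      exact hK (by rw [hz, hz', cls_eq hxK, cls_eq hx])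
    have := (hz' ▸ connOn_cls hE h.base z' : ConnOn M X K') W' h'.sub
      (h'.memX.mono Set.inter_subset_left) fun x y hxy hx hy =>
        hedge x y hxy (by simp [hd x hx, hd y hy])
    obtain ⟨b, hb, -⟩ := h'.sdiff_memX
    exact hb.2 (this.symm ▸ hb.1)

/-- Cuts in different components cross. -/
lemma IsCut.eq_component (hE : M.E = Set.univ) (hM : IsSplit M) (h : IsCut M X K W)
    (h' : IsCut M Y K' W') : K = K' := by
  classical
  by_contra hK
  have hd : ∀ x ∈ K, x ∉ K' := by
    obtain ⟨z, rfl⟩ := h.eq_cls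
    obtain ⟨z', rfl⟩ := h'.eq_cls
    exact fun x hx hx' => hK ((cls_eq hx).trans (cls_eq hx').symm)
  have hne : W ≠ W' := by
    rintro rfl
    obtain ⟨a, ha, -⟩ := h.memX
    exact hd a (h.sub ha) (h'.sub ha)
  -- Even distributions for the two cuts can be prescribed independently on disjoint components,
  -- which gives an interior point on both hyperplanes.
  obtain ⟨x, hx⟩ := IsInner.exists hE
  obtain ⟨g, hg, hgW, hg'⟩ := h.exists_spread hE
  obtain ⟨f, hf, hfW, hf'⟩ := h'.exists_spread hE
  have hin := (hx.piecewise h.eq_cls hg hg').piecewise h'.eq_cls hf hf'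
  have hsp := (mem_affineSpan_iff hE).2 hin.1
  have := hM _ _ (h.isSplitFlacet hE) (h'.isSplitFlacet hE) (h.rankFace_ne hE h' hne)
  refine Set.eq_empty_iff_forall_notMem.1 this _
    ⟨⟨h.mem_rankHyperplane hE hsp ?_, h'.mem_rankHyperplane hE hsp ?_⟩,
      hin.mem_intrinsicInterior hE⟩
  · rw [← hgW]
    exact wt_congr fun i hi => by simp [h.sub hi, hd i (h.sub hi)]
  · rw [← hfW]
    exact wt_congr fun i hi => by simp [h'.sub hi]

/-- Interpolation between the four parts of two cuts. -/
lemma exists_overlap {w₁₁ w₁₀ w₀₁ w₀₀ a b r : ℝ} (n₁₁ : 0 ≤ w₁₁) (n₁₀ : 0 ≤ w₁₀) (n₀₁ : 0 ≤ w₀₁)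
    (n₀₀ : 0 ≤ w₀₀) (a0 : 0 < a) (a1 : a < w₁₁ + w₁₀) (b0 : 0 < b) (b1 : b < w₁₁ + w₀₁)
    (ra0 : a < r) (ra1 : r - a < w₀₁ + w₀₀) (rb0 : b < r) (rb1 : r - b < w₁₀ + w₀₀)
    (h₀₀ : r - a - b < w₀₀) (h₁₀ : a - b < w₁₀) (h₀₁ : b - a < w₀₁) (h₁₁ : a + b - r < w₁₁) :
    ∃ u, ((w₁₁ = 0 ∧ u = 0) ∨ (0 < u ∧ u < w₁₁)) ∧
      ((w₁₀ = 0 ∧ a - u = 0) ∨ (0 < a - u ∧ a - u < w₁₀)) ∧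
      ((w₀₁ = 0 ∧ b - u = 0) ∨ (0 < b - u ∧ b - u < w₀₁)) ∧
      ((w₀₀ = 0 ∧ r - a - b + u = 0) ∨ (0 < r - a - b + u ∧ r - a - b + u < w₀₀)) := by
  -- Here u is the weight of the intersection; it determines the other three. An empty part must get
  -- weight 0, which fixes u. If no part is empty, u can be chosen in an open interval.
  rcases n₁₁.eq_or_lt with e | n₁₁
  · exact ⟨0, Or.inl ⟨e.symm, rfl⟩, Or.inr ⟨by linarith, by linarith⟩,
      Or.inr ⟨by linarith, by linarith⟩, Or.inr ⟨by linarith, by linarith⟩⟩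
  rcases n₀₀.eq_or_lt with e | n₀₀
  · exact ⟨a + b - r, Or.inr ⟨by linarith, by linarith⟩, Or.inr ⟨by linarith, by linarith⟩,
      Or.inr ⟨by linarith, by linarith⟩, Or.inl ⟨e.symm, by ring⟩⟩
  rcases n₁₀.eq_or_lt with e | n₁₀
  · exact ⟨a, Or.inr ⟨by linarith, by linarith⟩, Or.inl ⟨e.symm, by ring⟩,
      Or.inr ⟨by linarith, by linarith⟩, Or.inr ⟨by linarith, by linarith⟩⟩
  rcases n₀₁.eq_or_lt with e | n₀₁
  · exact ⟨b, Or.inr ⟨by linarith, by linarith⟩, Or.inr ⟨by linarith, by linarith⟩,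
      Or.inl ⟨e.symm, by ring⟩, Or.inr ⟨by linarith, by linarith⟩⟩
  obtain ⟨u, hu1, hu2⟩ := exists_between
    (show max (max 0 (a - w₁₀)) (max (b - w₀₁) (a + b - r)) <
      min (min w₁₁ a) (min b (a + b - r + w₀₀)) by
      simp only [max_lt_iff, lt_min_iff]
      refine ⟨⟨?_, ?_⟩, ?_, ?_⟩ <;> refine ⟨⟨?_, ?_⟩, ?_, ?_⟩ <;> linarith)
  simp only [max_lt_iff, lt_min_iff] at hu1 hu2
  exact ⟨u, Or.inr ⟨by linarith, by linarith⟩, Or.inr ⟨by linarith, by linarith⟩,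
      Or.inr ⟨by linarith, by linarith⟩, Or.inr ⟨by linarith, by linarith⟩⟩

/-- The main inequality for two hyperedges of a split matroid. -/
theorem IsCut.ncard_sdiff_union_le (hE : M.E = Set.univ) (hM : IsSplit M) (h : IsCut M X K W)
    (h' : IsCut M Y K W') (hne : W ≠ W') :
    (K \ (W ∪ W')).ncard + (X ∩ W).ncard + (Y ∩ W').ncard ≤ rk M K := by
  classical
  by_contra hlt
  push Not at hlt
  obtain ⟨p1, p2, p3, p4⟩ := h.bounds hE
  obtain ⟨q1, q2, q3, q4⟩ := h'.bounds hE
  have c1 := ncard_inter_add_ncard_sdiff W W'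
  have c2 := ncard_inter_add_ncard_sdiff W' W
  have c3 := ncard_inter_add_ncard_sdiff (K \ W) W'
  have c4 := ncard_inter_add_ncard_sdiff (K \ W') W
  rw [Set.inter_comm W' W] at c2
  have e1 : (K \ W) ∩ W' = W' \ W := by
    ext x; exact ⟨fun hx => ⟨hx.2, hx.1.2⟩, fun hx => ⟨⟨h'.sub hx.1, hx.2⟩, hx.1⟩⟩
  have e2 : (K \ W') ∩ W = W \ W' := by
    ext x; exact ⟨fun hx => ⟨hx.2, hx.1.2⟩, fun hx => ⟨⟨h.sub hx.1, hx.2⟩, hx.1⟩⟩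
  rw [e1, Set.sdiff_sdiff] at c3
  rw [e2, Set.sdiff_sdiff, Set.union_comm] at c4
  -- The negated claim and `f1`, `f2`, `f3` say that none of the four parts is filled by the weight
  -- forced into it; these are the last four hypotheses of `exists_overlap`.
  have f1 := h.lt_ncard_inter_add hE h'
  rw [h.rk_eq hE h.base] at f1
  have f2 : ¬ (W \ W').ncard + (Y ∩ W').ncard ≤ (X ∩ W).ncard :=
    fun e => hne (h.eq_of_ncard_sdiff_le hE h' e)
  have f3 : ¬ (W' \ W).ncard + (X ∩ W).ncard ≤ (Y ∩ W').ncard :=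
    fun e => hne (h'.eq_of_ncard_sdiff_le hE h e).symm
  set w₁₁ := (W ∩ W').ncard
  set w₁₀ := (W \ W').ncard
  set w₀₁ := (W' \ W).ncard
  set w₀₀ := (K \ (W ∪ W')).ncard
  set a := (X ∩ W).ncard
  set b := (Y ∩ W').ncard
  set r := rk M K
  obtain ⟨u, u11, u10, u01, u00⟩ := exists_overlap (w₁₁ := w₁₁) (w₁₀ := w₁₀) (w₀₁ := w₀₁)
    (w₀₀ := w₀₀) (a := a) (b := b) (r := r) (by positivity) (by positivity) (by positivity)
    (by positivity) (by exact_mod_cast p1) (by exact_mod_cast (show a < w₁₁ + w₁₀ by omega))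
    (by exact_mod_cast q1) (by exact_mod_cast (show b < w₁₁ + w₀₁ by omega))
    (by exact_mod_cast p3) (by rw [sub_lt_iff_lt_add]; exact_mod_cast (by omega))
    (by exact_mod_cast q3) (by rw [sub_lt_iff_lt_add]; exact_mod_cast (by omega))
    (by rw [sub_lt_iff_lt_add, sub_lt_iff_lt_add]; exact_mod_cast (by omega))
    (by rw [sub_lt_iff_lt_add]; exact_mod_cast (by omega))
    (by rw [sub_lt_iff_lt_add]; exact_mod_cast (by omega))
    (by rw [sub_lt_iff_lt_add]; exact_mod_cast (by omega))
  have zero : ∀ {m : ℕ} {t : ℝ}, ((m : ℝ) = 0 ∧ t = 0 ∨ 0 < t ∧ t < m) → m = 0 → t = 0 := by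
    rintro m t (⟨-, h⟩ | ⟨h1, h2⟩) h0
    · exact h
    · rw [h0] at h2; norm_num at h2; linarith
  have bnd : ∀ {R : Set α} {t : ℝ} {i : α}, ((R.ncard : ℝ) = 0 ∧ t = 0 ∨ 0 < t ∧ t < R.ncard) →
      i ∈ R → 0 < spread R t i ∧ spread R t i < 1 := by
    rintro R t i (⟨h1, -⟩ | ⟨h1, h2⟩) hi
    · rw [Nat.cast_eq_zero, Set.ncard_eq_zero (Set.toFinite _)] at h1
      exact absurd (h1 ▸ hi) (Set.notMem_empty i)
    · exact spread_bounds hi h1 h2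
  set g : α → ℝ := spread (W ∩ W') u + spread (W \ W') (a - u) + spread (W' \ W) (b - u) +
    spread (K \ (W ∪ W')) (r - a - b + u) with hg
  have dj : ∀ {S T : Set α}, (∀ x ∈ S, x ∉ T) → Disjoint S T :=
    fun h => Set.disjoint_left.2 fun x hx => h x hx
  have gK : wt K g = rk M K := by
    rw [hg, map_add, map_add, map_add, wt_spread_of_subset (fun x hx => h.sub hx.1) (zero u11),
      wt_spread_of_subset (fun x hx => h.sub hx.1) (zero u10),
      wt_spread_of_subset (fun x hx => h'.sub hx.1) (zero u01),
      wt_spread_of_subset Set.sdiff_subset (zero u00)]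
    ring
  have gW : wt W g = a := by
    rw [hg, map_add, map_add, map_add, wt_spread_of_subset Set.inter_subset_left (zero u11),
      wt_spread_of_subset Set.sdiff_subset (zero u10),
      wt_spread_of_disjoint (dj fun x hx hx' => hx'.2 hx),
      wt_spread_of_disjoint (dj fun x hx hx' => hx'.2 (Or.inl hx))]
    ring
  have gW' : wt W' g = b := by
    rw [hg, map_add, map_add, map_add, wt_spread_of_subset Set.inter_subset_right (zero u11),
      wt_spread_of_subset Set.sdiff_subset (zero u01),
      wt_spread_of_disjoint (dj fun x hx hx' => hx'.2 hx),
      wt_spread_of_disjoint (dj fun x hx hx' => hx'.2 (Or.inr hx))]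
    ring
  have gb : ∀ i ∈ K, 0 < g i ∧ g i < 1 := by
    intro i hi
    simp only [hg, Pi.add_apply]
    by_cases hiW : i ∈ W <;> by_cases hiW' : i ∈ W'
    · have := bnd u11 (i := i) ⟨hiW, hiW'⟩
      simpa [spread_apply_of_notMem, hiW, hiW'] using this
    · have := bnd u10 (i := i) ⟨hiW, hiW'⟩
      simpa [spread_apply_of_notMem, hiW, hiW'] using this
    · have := bnd u01 (i := i) ⟨hiW', hiW⟩
      simpa [spread_apply_of_notMem, hiW, hiW'] using this
    · have := bnd u00 (i := i) ⟨hi, by simp [hiW, hiW']⟩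
      simpa [spread_apply_of_notMem, hiW, hiW'] using this
  obtain ⟨x, hx⟩ := IsInner.exists hE
  have hin := hx.piecewise h.eq_cls gK gb
  have hsp := (mem_affineSpan_iff hE).2 hin.1
  have := hM _ _ (h.isSplitFlacet hE) (h'.isSplitFlacet hE) (h.rankFace_ne hE h' hne)
  refine Set.eq_empty_iff_forall_notMem.1 this _
    ⟨⟨h.mem_rankHyperplane hE hsp ?_, h'.mem_rankHyperplane hE hsp ?_⟩,
      hin.mem_intrinsicInterior hE⟩
  · rw [← gW]
    exact wt_congr fun i hi => by simp [h.sub hi]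
  · rw [← gW']
    exact wt_congr fun i hi => by simp [h'.sub hi]

end RelativeInterior
-- Recognizing obstructions from the exchange relations
section Pattern

variable {α ι κ : Type*} [DecidableEq α]
variable {P Q P' Q' : Finset α} {A : ι → Finset α} {s : ι → ℤ} {B : κ → Finset α} {t : κ → ℤ}
  {i j i₁ i₂ : ι} {j₁ j₂ : κ} {p q x y : α} {d : ℕ} {e₁ e₂ f₁ f₂ : α → α → Prop}

open Classical in
/-- How an obstruction is seen in the exchange relations of the two bases. -/
def Pattern (P Q : Finset α) (e₁ e₂ : α → α → Prop) : Prop :=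
  -- For an obstruction, a and b represent the cells (1,1) and (2,2) of P, and c and e the cells
  -- (1,2) and (2,1) of Q. The relations then mean equality of parts, and the last line says that P
  -- and Q have different numbers of elements in cell (1,1).
  ∃ a ∈ P, ∃ b ∈ P, ∃ c ∈ Q, ∃ e ∈ Q, e₁ a c ∧ ¬ e₁ a e ∧ ¬ e₁ b c ∧ e₁ b e ∧
    e₂ a e ∧ ¬ e₂ a c ∧ e₂ b c ∧ ¬ e₂ b e ∧
    (∀ p ∈ P, ¬ (e₁ p c ∧ e₁ p e) ∧ ¬ (e₂ p c ∧ e₂ p e)) ∧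
    (∀ q ∈ Q, ¬ (e₁ a q ∧ e₁ b q) ∧ ¬ (e₂ a q ∧ e₂ b q)) ∧
    (P.filter fun p => e₁ p c ∧ e₂ p e).card ≠ (Q.filter fun q => e₁ a q ∧ e₂ a q).card

lemma Pattern.congr (h₁ : ∀ p ∈ P, ∀ q ∈ Q, e₁ p q ↔ f₁ p q)
    (h₂ : ∀ p ∈ P, ∀ q ∈ Q, e₂ p q ↔ f₂ p q) (h : Pattern P Q e₁ e₂) : Pattern P Q f₁ f₂ := by
  classical
  obtain ⟨a, ha, b, hb, c, hc, e, he, k1, k2, k3, k4, k5, k6, k7, k8, k9, k10, k11⟩ := h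
  have g1 : (P.filter fun p => e₁ p c ∧ e₂ p e) = P.filter fun p => f₁ p c ∧ f₂ p e :=
    Finset.filter_congr fun p hp => by rw [h₁ p hp c hc, h₂ p hp e he]
  have g2 : (Q.filter fun q => e₁ a q ∧ e₂ a q) = Q.filter fun q => f₁ a q ∧ f₂ a q :=
    Finset.filter_congr fun q hq => by rw [h₁ a ha q hq, h₂ a ha q hq]
  rw [g1, g2] at k11
  refine ⟨a, ha, b, hb, c, hc, e, he, (h₁ a ha c hc).1 k1, fun h => k2 ((h₁ a ha e he).2 h),
    fun h => k3 ((h₁ b hb c hc).2 h), (h₁ b hb e he).1 k4, (h₂ a ha e he).1 k5,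
    fun h => k6 ((h₂ a ha c hc).2 h), (h₂ b hb c hc).1 k7, fun h => k8 ((h₂ b hb e he).2 h),
    fun p hp => ?_, fun q hq => ?_, k11⟩
  · rw [← h₁ p hp c hc, ← h₁ p hp e he, ← h₂ p hp c hc, ← h₂ p hp e he]; exact k9 p hp
  · rw [← h₁ a ha q hq, ← h₁ b hb q hq, ← h₂ a ha q hq, ← h₂ b hb q hq]; exact k10 q hq

/-- Patterns live inside one component. -/
lemma pattern_filter_iff (K : α → Prop) [DecidablePred K]
    (h₁ : ∀ p ∈ P, ∀ q ∈ Q, e₁ p q → (K p ↔ K q)) (h₂ : ∀ p ∈ P, ∀ q ∈ Q, e₂ p q → (K p ↔ K q))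
    (h : ∀ a ∈ P, ∀ b ∈ P, ∀ c ∈ Q, ∀ e ∈ Q, e₁ a c → ¬ e₁ b c → e₁ b e → e₂ a e → K a) :
    Pattern P Q e₁ e₂ ↔ Pattern (P.filter K) (Q.filter K) e₁ e₂ := by
  classical
  have key : ∀ a ∈ P, ∀ c ∈ Q, ∀ e, K c → K a →
      (P.filter fun p => e₁ p c ∧ e₂ p e) = ((P.filter K).filter fun p => e₁ p c ∧ e₂ p e) ∧
      (Q.filter fun q => e₁ a q ∧ e₂ a q) = ((Q.filter K).filter fun q => e₁ a q ∧ e₂ a q) := by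
    intro a ha c hc e hKc hKa
    constructor
    · ext p
      simp only [Finset.mem_filter]
      exact ⟨fun ⟨hp, h'⟩ => ⟨⟨hp, (h₁ p hp c hc h'.1).2 hKc⟩, h'⟩, fun ⟨⟨hp, _⟩, h'⟩ => ⟨hp, h'⟩⟩
    · ext q
      simp only [Finset.mem_filter]
      exact ⟨fun ⟨hq, h'⟩ => ⟨⟨hq, (h₁ a ha q hq h'.1).1 hKa⟩, h'⟩, fun ⟨⟨hq, _⟩, h'⟩ => ⟨hq, h'⟩⟩
  constructor
  · rintro ⟨a, ha, b, hb, c, hc, e, he, k1, k2, k3, k4, k5, k6, k7, k8, k9, k10, k11⟩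
    have hKa := h a ha b hb c hc e he k1 k3 k4 k5
    have hKc := (h₁ a ha c hc k1).1 hKa
    have hKe := (h₂ a ha e he k5).1 hKa
    have hKb := (h₁ b hb e he k4).2 hKe
    obtain ⟨u1, u2⟩ := key a ha c hc e hKc hKa
    exact ⟨a, Finset.mem_filter.2 ⟨ha, hKa⟩, b, Finset.mem_filter.2 ⟨hb, hKb⟩,
      c, Finset.mem_filter.2 ⟨hc, hKc⟩, e, Finset.mem_filter.2 ⟨he, hKe⟩, k1, k2, k3, k4, k5, k6,
      k7, k8, fun p hp => k9 p (Finset.mem_filter.1 hp).1,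
      fun q hq => k10 q (Finset.mem_filter.1 hq).1, u1 ▸ u2 ▸ k11⟩
  · rintro ⟨a, ha, b, hb, c, hc, e, he, k1, k2, k3, k4, k5, k6, k7, k8, k9, k10, k11⟩
    obtain ⟨ha, hKa⟩ := Finset.mem_filter.1 ha
    obtain ⟨hb, hKb⟩ := Finset.mem_filter.1 hb
    obtain ⟨hc, hKc⟩ := Finset.mem_filter.1 hc
    obtain ⟨he, hKe⟩ := Finset.mem_filter.1 he
    obtain ⟨u1, u2⟩ := key a ha c hc e hKc hKa
    refine ⟨a, ha, b, hb, c, hc, e, he, k1, k2, k3, k4, k5, k6, k7, k8, fun p hp => ?_,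
      fun q hq => ?_, by rw [u1, u2]; exact k11⟩
    · by_cases hK : K p
      · exact k9 p (Finset.mem_filter.2 ⟨hp, hK⟩)
      · exact ⟨fun h' => hK ((h₁ p hp c hc h'.1).2 hKc), fun h' => hK ((h₂ p hp c hc h'.1).2 hKc)⟩
    · by_cases hK : K q
      · exact k10 q (Finset.mem_filter.2 ⟨hq, hK⟩)
      · exact ⟨fun h' => hK ((h₁ a ha q hq h'.1).1 hKa), fun h' => hK ((h₂ a ha q hq h'.1).1 hKa)⟩

lemma TightPartition.allowed_iff (h : TightPartition P Q A s i j) (hA : SplitSystem P Q A s)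
    (hp : p ∈ P) (hq : q ∈ Q) : Allowed A s p q ↔ (p ∈ A i ↔ q ∈ A i) := by
  constructor
  · exact fun ha => ha.mem_iff h.memP h.memQ h.left h.right hp hq
  · intro hiff
    by_cases hqi : q ∈ A i
    · exact h.allowed hA hq (hiff.2 hqi) hqi
    · exact h.symm.allowed hA hq ((h.memP p hp).2 fun e => hqi (hiff.1 e)) ((h.memQ q hq).2 hqi)

/-- Recognizing tight partitions from allowed exchanges. -/
lemma SplitSystem.exists_tightPartition (hA : SplitSystem P Q A s) {a b c e : α} (ha : a ∈ P)
    (hb : b ∈ P) (hc : c ∈ Q) (he : e ∈ Q) (h1 : Allowed A s a c) (h2 : ¬ Allowed A s a e)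
    (h3 : ¬ Allowed A s b c) (h4 : Allowed A s b e)
    (hP : ∀ p ∈ P, ¬ (Allowed A s p c ∧ Allowed A s p e))
    (hQ : ∀ q ∈ Q, ¬ (Allowed A s a q ∧ Allowed A s b q)) :
    ∃ i j, TightPartition P Q A s i j ∧ a ∈ A i ∧ b ∈ A j ∧ c ∈ A i ∧ e ∈ A j := by
  unfold Allowed at h2 h3
  push Not at h2 h3
  obtain ⟨j, hj, hej, haj⟩ := h2
  obtain ⟨i, hi, hci, hbi⟩ := h3
  have hai := h1 i hi hci
  have hbj := h4 j hj hej
  have hij : i ≠ j := by rintro rfl; exact haj hai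
  refine ⟨i, j, ⟨hij, hi, hj, fun x hx => ⟨fun hxj hxi => ?_, ?_⟩, fun x hx => ⟨fun hxj hxi => ?_,
    fun hxi => ?_⟩⟩, hai, hbj, hci, hej⟩
  -- An element of P in both parts could be exchanged for c as well as for e.
  · exact hP x hx ⟨fun k hk hck => hA.eq_of_tight hi hk hc hci hck ▸ hxi,
      fun k hk hek => hA.eq_of_tight hj hk he hej hek ▸ hxj⟩
  · exact hA.mem_of_add_le_zero hij (by omega) hx
  · exact hij (hA.eq_of_tight hi hj hx hxi hxj)
  -- An element of Q outside both parts could be exchanged with a as well as with b, since any tight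
  -- set containing it covers P together with either part.
  · by_contra hxj
    refine hQ x hx ⟨fun k hk hxk => ?_, fun k hk hxk => ?_⟩
    · have hne : j ≠ k := by rintro rfl; exact hxj hxk
      exact hA.mem_of_add_le_zero hne (by omega) ha haj
    · have hne : i ≠ k := by rintro rfl; exact hxi hxk
      exact hA.mem_of_add_le_zero hne (by omega) hb hbi

/-- The two counts in `Pattern` are the numbers of elements of P and Q in one cell. -/
lemma filter_allowed_eq (hP : TightPartition P Q A s i₁ i₂) (hQ : TightPartition P Q B t j₁ j₂)
    (hA : SplitSystem P Q A s) (hB : SplitSystem P Q B t) {a c e : α} (ha : a ∈ P) (hc : c ∈ Q)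
    (he : e ∈ Q) (haA : a ∈ A i₁) (haB : a ∈ B j₁) (hcA : c ∈ A i₁) (heB : e ∈ B j₁) :
    (open Classical in P.filter fun p => Allowed A s p c ∧ Allowed B t p e) = P ∩ (A i₁ ∩ B j₁) ∧
    (open Classical in Q.filter fun q => Allowed A s a q ∧ Allowed B t a q) =
      Q ∩ (A i₁ ∩ B j₁) := by
  constructor
  · ext p
    simp only [Finset.mem_filter, Finset.mem_inter]
    refine and_congr_right fun hp => ?_
    rw [hP.allowed_iff hA hp hc, hQ.allowed_iff hB hp he]
    simp [hcA, heB]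
  · ext q
    simp only [Finset.mem_filter, Finset.mem_inter]
    refine and_congr_right fun hq => ?_
    rw [hP.allowed_iff hA ha hq, hQ.allowed_iff hB ha hq]
    simp [haA, haB]

/-- Obstructions are recognized by their pattern. -/
theorem pattern_allowed_iff (hA : SplitSystem P Q A s) (hB : SplitSystem P Q B t)
    (hc : P.card = Q.card) :
    Pattern P Q (Allowed A s) (Allowed B t) ↔ ∃ d, Obstructed P Q A s B t d := by
  classical
  constructor
  · rintro ⟨a, ha, b, hb, c, hc', e, he, k1, k2, k3, k4, k5, k6, k7, k8, k9, k10, k11⟩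
    obtain ⟨i₁, i₂, hi, aA, bA, cA, eA⟩ := hA.exists_tightPartition ha hb hc' he k1 k2 k3 k4
      (fun p hp => (k9 p hp).1) (fun q hq => (k10 q hq).1)
    obtain ⟨j₁, j₂, hj, aB, bB, eB, cB⟩ := hB.exists_tightPartition ha hb he hc' k5 k6 k8 k7
      (fun p hp h => (k9 p hp).2 h.symm) (fun q hq => (k10 q hq).2)
    obtain ⟨f1, f2⟩ := filter_allowed_eq hi hj hA hB ha hc' he aA aB cA eB
    rw [f1, f2] at k11
    -- The surplus of P must be positive in the leading cell; if Q prevails there, the cell of `i₁`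
    -- and `j₂` is taken instead.
    rcases lt_or_gt_of_ne k11 with hlt | hgt
    · have e1 := card_inter_add_card_inter hj.memP (A i₁)
      have e2 := card_inter_add_card_inter hj.memQ (A i₁)
      have e3 := hi.card_eq hA hc
      simp only [Finset.inter_comm (B _) (A _)] at e1 e2
      exact ⟨(P ∩ (A i₁ ∩ B j₂)).card - (Q ∩ (A i₁ ∩ B j₂)).card, i₁, i₂, j₂, j₁, hi, hj.symm,
        by omega, by omega⟩
    · exact ⟨(P ∩ (A i₁ ∩ B j₁)).card - (Q ∩ (A i₁ ∩ B j₁)).card, i₁, i₂, j₁, j₂, hi, hj,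
        by omega, by omega⟩
  · rintro ⟨d, i₁, i₂, j₁, j₂, h⟩
    obtain ⟨⟨a, ha, haA, haB⟩, ⟨b, hb, hbA, hbB⟩, ⟨c, hc', hcA, hcB⟩, ⟨e, he, heA, heB⟩⟩ :=
      h.exists_mem hA hB hc
    obtain ⟨f1, f2⟩ := filter_allowed_eq h.fst h.snd hA hB ha hc' he haA haB hcA heB
    have hbA' := (h.fst.memP b hb).1 hbA
    have hbB' := (h.snd.memP b hb).1 hbB
    have heA' := (h.fst.memQ e he).1 heA
    have hcB' := (h.snd.memQ c hc').1 hcB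
    refine ⟨a, ha, b, hb, c, hc', e, he, ?_⟩
    rw [f1, f2, h.card_eq]
    have hd := h.pos
    rw [h.fst.allowed_iff hA ha hc', h.fst.allowed_iff hA ha he, h.fst.allowed_iff hA hb hc',
      h.fst.allowed_iff hA hb he, h.snd.allowed_iff hB ha hc', h.snd.allowed_iff hB ha he,
      h.snd.allowed_iff hB hb hc', h.snd.allowed_iff hB hb he]
    refine ⟨by tauto, by tauto, by tauto, by tauto, by tauto, by tauto, by tauto, by tauto,
      fun p hp => ?_, fun q hq => ?_, by omega⟩
    · rw [h.fst.allowed_iff hA hp hc', h.fst.allowed_iff hA hp he, h.snd.allowed_iff hB hp hc',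
        h.snd.allowed_iff hB hp he]
      tauto
    · rw [h.fst.allowed_iff hA ha hq, h.fst.allowed_iff hA hb hq, h.snd.allowed_iff hB ha hq,
        h.snd.allowed_iff hB hb hq]
      tauto

end Pattern

/-! ### The split systems of a basis pair -/

section Game

variable {α : Type*} [Fintype α] {M : Matroid α} {X Y D K W : Set α} {p q : α}

/-- The cuts of a matroid. -/
def Cut (M : Matroid α) : Type _ := {W : Set α // ∃ X K, IsCut M X K W}

/-- The least number of elements of a base in a cut. -/
noncomputable def low (M : Matroid α) (W : Cut M) : ℕ := (W.2.choose ∩ W.1).ncard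

/-- All bases at which W is a cut meet it least, so the chosen base does not matter. -/
lemma IsCut.low_eq (hE : M.E = Set.univ) (h : IsCut M X K W) :
    low M ⟨W, X, K, h⟩ = (X ∩ W).ncard := by
  obtain ⟨K', h'⟩ := (⟨W, X, K, h⟩ : Cut M).2.choose_spec
  exact le_antisymm (h'.ncard_inter_le hE h.base) (h.ncard_inter_le hE h'.base)

/-- How many elements more than necessary a base has in a cut. -/
noncomputable def slack (M : Matroid α) (Y : Set α) (W : Cut M) : ℤ :=
  (Y ∩ W.1).ncard - low M W

lemma IsCut.slack_eq (hE : M.E = Set.univ) (h : IsCut M X K W) (Y : Set α) :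
    slack M Y ⟨W, X, K, h⟩ = (Y ∩ W).ncard - (X ∩ W).ncard := by
  simp only [slack, h.low_eq hE]

lemma slack_nonneg (hE : M.E = Set.univ) (hY : M.IsBase Y) (W : Cut M) : 0 ≤ slack M Y W := by
  obtain ⟨W, X, K, h⟩ := W
  have := h.ncard_inter_le hE hY
  rw [h.slack_eq hE]
  omega

/-- A cut is closed at every base with slack 0. Conversely, a missing exchange yields a cut at Y
itself, which has slack 0. -/
lemma exch_iff_slack (hE : M.E = Set.univ) (hY : M.IsBase Y) (hp : p ∈ Y) (hq : q ∉ Y)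
    (hpq : Conn M p q) :
    Exch M Y p q ↔ ∀ W : Cut M, slack M Y W = 0 → p ∈ W.1 → q ∈ W.1 := by
  constructor
  · rintro hx ⟨W, X, K, h⟩ hs hpW
    rw [h.slack_eq hE] at hs
    exact h.closed_of_ncard_eq hE hY (by omega) p q hx hpW
  · intro hall
    by_contra hno
    obtain ⟨W, hW, hpW, hqW⟩ := exists_isCut hE hY hp hq hpq hno
    refine hqW (hall ⟨W, Y, _, hW⟩ ?_ hpW)
    rw [hW.slack_eq hE]
    simp

/-- A component, or nothing, outside of which there are no cuts. -/
structure IsMain (M : Matroid α) (K : Set α) : Prop where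
  eq_cls : K = ∅ ∨ ∃ z, K = cls M z
  unique : ∀ X K' W, IsCut M X K' W → K' = K

lemma exists_isMain (hE : M.E = Set.univ) (hM : IsSplit M) : ∃ K, IsMain M K := by
  by_cases h : ∃ X K W, IsCut M X K W
  · obtain ⟨X, K, W, h⟩ := h
    exact ⟨K, .inr h.eq_cls, fun X' K' W' h' => h'.eq_component hE hM h⟩
  · push Not at h
    exact ⟨∅, .inl rfl, fun X' K' W' h' => absurd h' (h X' K' W')⟩

lemma IsMain.sub (hK : IsMain M K) (W : Cut M) : W.1 ⊆ K := by
  obtain ⟨W, X, K', h⟩ := W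
  exact hK.unique X K' W h ▸ h.sub

lemma IsMain.conn (hK : IsMain M K) (hp : p ∈ K) (hq : q ∈ K) : Conn M p q := by
  rcases hK.eq_cls with rfl | ⟨z, rfl⟩
  · exact absurd hp (Set.notMem_empty p)
  · exact hp.symm.trans hq

lemma IsMain.mem_iff (hK : IsMain M K) (h : Conn M p q) : p ∈ K ↔ q ∈ K := by
  rcases hK.eq_cls with rfl | ⟨z, rfl⟩
  · simp
  · exact ⟨fun hp => Conn.trans hp h, fun hq => Conn.trans hq h.symm⟩

lemma IsMain.ncard_inter_eq (hE : M.E = Set.univ) (hK : IsMain M K) (hY : M.IsBase Y)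
    (hD : M.IsBase D) : (Y ∩ K).ncard = (D ∩ K).ncard := by
  rcases hK.eq_cls with rfl | ⟨z, rfl⟩
  · simp
  · rw [sep_cls hE z _ hY, sep_cls hE z _ hD]

lemma ncard_sdiff_inter (Y D U : Set α) :
    ((Y \ D) ∩ U).ncard + (Y ∩ D ∩ U).ncard = (Y ∩ U).ncard := by
  rw [← Set.ncard_union_eq _ (Set.toFinite _) (Set.toFinite _)]
  · congr 1; ext x; simp only [Set.mem_union, Set.mem_inter_iff, Set.mem_sdiff]; tauto
  · rw [Set.disjoint_left]; intro x; simp only [Set.mem_inter_iff, Set.mem_sdiff]; tauto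

lemma ncard_sdiff_inter_add (Y D U : Set α) :
    ((Y \ D) ∩ U).ncard + (D ∩ U).ncard = ((D \ Y) ∩ U).ncard + (Y ∩ U).ncard := by
  have h1 := ncard_sdiff_inter Y D U
  have h2 := ncard_sdiff_inter D Y U
  rw [Set.inter_comm D Y] at h2
  omega

/-- The elements of `Y` in `K` that have to be replaced on the way to `D`. -/
noncomputable def excess (K Y D : Set α) : Finset α := (Set.toFinite ((Y \ D) ∩ K)).toFinset

lemma mem_excess {x : α} : x ∈ excess K Y D ↔ (x ∈ Y ∧ x ∉ D) ∧ x ∈ K := by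
  simp [excess]

lemma IsMain.card_excess (hE : M.E = Set.univ) (hK : IsMain M K) (hY : M.IsBase Y)
    (hD : M.IsBase D) : (excess K Y D).card = (excess K D Y).card := by
  have h1 := hK.ncard_inter_eq hE hY hD
  have h2 := ncard_sdiff_inter_add Y D K
  rw [excess, excess, ← Set.ncard_eq_toFinset_card, ← Set.ncard_eq_toFinset_card]
  omega

/-- The complements of the cuts. -/
noncomputable def outer (W : Cut M) : Finset α := (Set.toFinite W.1ᶜ).toFinset

/-- The cuts as finite sets. -/
noncomputable def inner (W : Cut M) : Finset α := (Set.toFinite W.1).toFinset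

lemma mem_outer {W : Cut M} : p ∈ outer W ↔ p ∉ W.1 := by simp [outer]

lemma mem_inner {W : Cut M} : p ∈ inner W ↔ p ∈ W.1 := by simp [inner]

lemma card_eq_ncard {S : Finset α} {T : Set α} (h : ∀ x, x ∈ S ↔ x ∈ T) : S.card = T.ncard := by
  rw [← Set.ncard_coe_finset]
  congr 1
  ext x
  simp [h]

/-- Inclusion and exclusion on Y ∩ K turns the inequality `IsCut.ncard_sdiff_union_le` into a bound
on slacks. -/
lemma IsMain.pair_le (hE : M.E = Set.univ) (hM : IsSplit M) (hK : IsMain M K) (hY : M.IsBase Y)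
    {V W : Cut M} (hne : V ≠ W) :
    (((K \ (V.1 ∪ W.1)) \ Y).ncard : ℤ) + (Y ∩ (V.1 ∩ W.1)).ncard ≤ slack M Y V + slack M Y W := by
  have hV := hK.sub V
  have hW := hK.sub W
  obtain ⟨V, X₁, K₁, h₁⟩ := V
  obtain ⟨W, X₂, K₂, h₂⟩ := W
  obtain rfl := hK.unique _ _ _ h₁
  obtain rfl := hK.unique _ _ _ h₂
  have h := h₁.ncard_sdiff_union_le hE hM h₂ fun e => hne (Subtype.ext e)
  rw [h₁.slack_eq hE, h₂.slack_eq hE]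
  rw [← h₁.rk_eq hE hY] at h
  simp only at hV hW ⊢
  have e1 := ncard_inter_add_ncard_sdiff (K₂ \ (V ∪ W)) Y
  have e2 := ncard_inter_add_ncard_sdiff (Y ∩ K₂) (V ∪ W)
  have e3 : (Y ∩ K₂) \ (V ∪ W) = (K₂ \ (V ∪ W)) ∩ Y := by
    ext x; simp only [Set.mem_inter_iff, Set.mem_sdiff]; tauto
  have e4 : (Y ∩ K₂) ∩ (V ∪ W) = (Y ∩ V) ∪ (Y ∩ W) := by
    ext x; simp only [Set.mem_inter_iff, Set.mem_union]
    have := @hV x; have := @hW x; tauto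
  have e5 := Set.ncard_union_add_ncard_inter (Y ∩ V) (Y ∩ W) (Set.toFinite _) (Set.toFinite _)
  have e6 : (Y ∩ V) ∩ (Y ∩ W) = Y ∩ (V ∩ W) := by
    ext x; simp only [Set.mem_inter_iff]; tauto
  rw [e6] at e5
  rw [e3, e4] at e2
  omega

lemma IsMain.target_le (hE : M.E = Set.univ) (hD : M.IsBase D)
    (W : Cut M) : (((Y \ D) ∩ W.1).ncard : ℤ) ≤ slack M Y W + ((D \ Y) ∩ W.1).ncard := by
  obtain ⟨W, X, K', h⟩ := W
  have := h.ncard_inter_le hE hD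
  have h2 := ncard_sdiff_inter_add Y D W
  rw [h.slack_eq hE]
  simp only
  omega

open Classical in
-- Meant for the second member of a pair, which gains p and loses q: the slack of a cut changes as
-- in `nextSlack` for the cut itself.
lemma IsMain.splitSystem_inner (hE : M.E = Set.univ) (hM : IsSplit M) (hK : IsMain M K)
    (hY : M.IsBase Y) (hD : M.IsBase D) :
    SplitSystem (excess K D Y) (excess K Y D) inner (slack M Y) where
  nonneg := slack_nonneg hE hY
  target W := by
    have h := IsMain.target_le (Y := Y) hE hD W
    have hW := hK.sub W
    rw [card_eq_ncard (T := (Y \ D) ∩ W.1) fun x => ?_,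
      card_eq_ncard (T := (D \ Y) ∩ W.1) fun x => ?_]
    · exact h
    all_goals
      simp only [Finset.mem_inter, mem_excess, mem_inner, Set.mem_inter_iff, Set.mem_sdiff]
      have := @hW x
      tauto
  pair V W hVW := by
    refine le_trans ?_ (hK.pair_le hE hM hY hVW)
    rw [add_comm]
    refine add_le_add ?_ ?_
    · rw [card_eq_ncard (T := excess K D Y \ (inner V ∪ inner W)) (by simp)]
      refine Nat.cast_le.2 (Set.ncard_le_ncard (fun x => ?_) (Set.toFinite _))
      simp only [Set.mem_sdiff, Finset.mem_coe, Set.mem_union, mem_excess, mem_inner]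
      tauto
    · rw [card_eq_ncard (T := excess K Y D ∩ (inner V ∩ inner W)) (by simp)]
      refine Nat.cast_le.2 (Set.ncard_le_ncard (fun x => ?_) (Set.toFinite _))
      simp only [Set.mem_inter_iff, Finset.mem_coe, mem_excess, mem_inner]
      tauto

open Classical in
-- Meant for the first member, which loses p and gains q: the slack changes as in `nextSlack` for
-- the complement of the cut. Complementation interchanges the two terms of the pair bound.
lemma IsMain.splitSystem_outer (hE : M.E = Set.univ) (hM : IsSplit M) (hK : IsMain M K)
    (hY : M.IsBase Y) (hD : M.IsBase D) :
    SplitSystem (excess K Y D) (excess K D Y) outer (slack M Y) where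
  nonneg := slack_nonneg hE hY
  target W := by
    have h := (hK.splitSystem_inner hE hM hY hD).target W
    have hc := hK.card_excess hE hY hD
    have e : ∀ S : Finset α, (S ∩ inner W).card + (S ∩ outer W).card = S.card := by
      intro S
      rw [← Finset.card_union_of_disjoint]
      · congr 1; ext x; simp only [Finset.mem_union, Finset.mem_inter, mem_inner, mem_outer]; tauto
      · rw [Finset.disjoint_left]; intro x
        simp only [Finset.mem_inter, mem_inner, mem_outer]; tauto
    have e1 := e (excess K Y D)
    have e2 := e (excess K D Y)
    omega
  pair V W hVW := by
    refine le_trans ?_ (hK.pair_le hE hM hY hVW)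
    refine add_le_add ?_ ?_
    · rw [card_eq_ncard (T := excess K D Y ∩ (outer V ∩ outer W)) (by simp)]
      refine Nat.cast_le.2 (Set.ncard_le_ncard (fun x => ?_) (Set.toFinite _))
      simp only [Set.mem_sdiff, Finset.mem_coe, Set.mem_union, Set.mem_inter_iff, mem_excess,
        mem_outer]
      tauto
    · rw [card_eq_ncard (T := excess K Y D \ (outer V ∪ outer W)) (by simp)]
      refine Nat.cast_le.2 (Set.ncard_le_ncard (fun x => ?_) (Set.toFinite _))
      simp only [Set.mem_inter_iff, Set.mem_sdiff, Set.mem_union, Finset.mem_coe, mem_excess,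
        mem_outer]
      tauto

open Classical in
lemma IsMain.allowed_outer_iff (hE : M.E = Set.univ) (hK : IsMain M K) (hY : M.IsBase Y)
    (hp : p ∈ excess K Y D) (hq : q ∈ excess K D Y) :
    Allowed outer (slack M Y) p q ↔ Exch M Y p q := by
  rw [mem_excess] at hp hq
  rw [exch_iff_slack hE hY hp.1.1 hq.1.2 (hK.conn hp.2 hq.2)]
  refine forall_congr' fun W => imp_congr_right fun _ => ?_
  rw [mem_outer, mem_outer, not_imp_not]

open Classical in
lemma IsMain.allowed_inner_iff (hE : M.E = Set.univ) (hK : IsMain M K) (hY : M.IsBase Y)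
    (hp : p ∈ excess K D Y) (hq : q ∈ excess K Y D) :
    Allowed inner (slack M Y) p q ↔ Exch M Y q p := by
  rw [mem_excess] at hp hq
  rw [exch_iff_slack hE hY hq.1.1 hp.1.2 (hK.conn hq.2 hp.2)]
  refine forall_congr' fun W => imp_congr_right fun _ => ?_
  rw [mem_inner, mem_inner]

open Classical in
lemma slack_insert_outer (hp : p ∈ Y) (hq : q ∉ Y) :
    slack M (insert q (Y \ {p})) = nextSlack outer (slack M Y) p q := by
  funext W
  have := ncard_inter_exchange hp hq W.1
  simp only [nextSlack, slack, mem_outer]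
  rw [this]
  split_ifs <;> first | contradiction | omega

open Classical in
lemma slack_insert_inner (hp : p ∉ Y) (hq : q ∈ Y) :
    slack M (insert p (Y \ {q})) = nextSlack inner (slack M Y) p q := by
  funext W
  have := ncard_inter_exchange hq hp W.1
  simp only [nextSlack, slack, mem_inner]
  rw [this]
  split_ifs <;> first | contradiction | omega

end Game
/-! ### Monotone exchanges and obstructed pairs -/

section Game

variable {α : Type*} [Fintype α] {M : Matroid α} {X B : Set α × Set α} {K : Set α} {s : α × α}
  {p q : α} {d : ℕ}

/-- A symmetric exchange towards `B`. -/
structure Step (M : Matroid α) (B X : Set α × Set α) (s : α × α) : Prop where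
  left : s.1 ∈ X.1 \ B.1
  right : s.2 ∈ B.1 \ X.1
  fst : Exch M X.1 s.1 s.2
  snd : Exch M X.2 s.2 s.1

lemma Compatible.mem (h : Compatible X B) (x : α) :
    (x ∈ X.1 ∧ x ∈ X.2 ↔ x ∈ B.1 ∧ x ∈ B.2) ∧ (x ∈ X.1 ∨ x ∈ X.2 ↔ x ∈ B.1 ∨ x ∈ B.2) :=
  ⟨Set.ext_iff.1 h.1 x, Set.ext_iff.1 h.2 x⟩

/-- An exchange changes the distance to B₁ by at most one, and decreases it only if the outgoing
element is not in B₁ and the incoming one is. -/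
lemma step_iff (hc : Compatible X B) :
    Step M B X s ↔ IsSymmetricExchange M X s ∧ ((swap X s).1 \ B.1).ncard < (X.1 \ B.1).ncard := by
  classical
  have h1 := hc.mem s.1
  have h2 := hc.mem s.2
  have key : s.1 ∈ X.1 → s.2 ∉ X.1 →
      (((swap X s).1 \ B.1).ncard < (X.1 \ B.1).ncard ↔ s.1 ∉ B.1 ∧ s.2 ∈ B.1) := by
    intro hp hq
    have := ncard_inter_exchange hp hq B.1ᶜ
    simp only [swap, Set.sdiff_eq]
    simp only [Set.mem_compl_iff, Set.sdiff_eq] at this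
    split_ifs at this <;> constructor <;> intro <;> first | omega | tauto
  constructor
  · intro h
    have hp := h.left
    have hq := h.right
    simp only [Set.mem_sdiff] at hp hq
    refine ⟨⟨⟨hp.1, by tauto⟩, ⟨by tauto, hq.2⟩, h.fst.2.2, h.snd.2.2⟩, (key hp.1 hq.2).2 (by tauto)⟩
  · rintro ⟨⟨hp, hq, hX⟩, hlt⟩
    have hk := (key hp.1 hq.2).1 hlt
    exact ⟨⟨hp.1, hk.1⟩, ⟨hk.2, hq.2⟩, ⟨hp.1, hq.2, hX.1⟩, ⟨hq.1, hp.2, hX.2⟩⟩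

lemma Step.isBasisPair (h : Step M B X s) : IsBasisPair M (swap X s) := ⟨h.fst.2.2, h.snd.2.2⟩

lemma Step.compatible (h : Step M B X s) (hc : Compatible X B) : Compatible (swap X s) B := by
  have h1 := h.fst.1
  have h2 := h.fst.2.1
  have h3 := h.snd.1
  have h4 := h.snd.2.1
  constructor
  all_goals
    ext x
    have hx := hc.mem x
    simp only [swap, Set.mem_inter_iff, Set.mem_union, Set.mem_insert_iff, Set.mem_sdiff,
      Set.mem_singleton_iff]
    by_cases e1 : x = s.1 <;> by_cases e2 : x = s.2 <;> grind

lemma Compatible.sdiff_snd (hc : Compatible X B) : X.2 \ B.2 = B.1 \ X.1 := by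
  ext x; have := hc.mem x; simp only [Set.mem_sdiff]; tauto

lemma Compatible.sdiff_snd_symm (hc : Compatible X B) : B.2 \ X.2 = X.1 \ B.1 := by
  ext x; have := hc.mem x; simp only [Set.mem_sdiff]; tauto

lemma Compatible.excess_snd (hc : Compatible X B) : excess K X.2 B.2 = excess K B.1 X.1 := by
  simp only [excess, hc.sdiff_snd]

lemma Compatible.excess_snd_symm (hc : Compatible X B) :
    excess K B.2 X.2 = excess K X.1 B.1 := by
  simp only [excess, hc.sdiff_snd_symm]

open Classical in
lemma Step.excess_left (h : Step M B X s) :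
    excess K (swap X s).1 B.1 = (excess K X.1 B.1).erase s.1 := by
  ext x
  have hp := h.left
  have hq := h.right
  simp only [Set.mem_sdiff] at hp hq
  simp only [mem_excess, Finset.mem_erase, swap, Set.mem_insert_iff, Set.mem_sdiff,
    Set.mem_singleton_iff]
  by_cases e1 : x = s.1 <;> by_cases e2 : x = s.2 <;> grind

open Classical in
lemma Step.excess_right (h : Step M B X s) :
    excess K B.1 (swap X s).1 = (excess K B.1 X.1).erase s.2 := by
  ext x
  have hp := h.left
  have hq := h.right
  simp only [Set.mem_sdiff] at hp hq
  simp only [mem_excess, Finset.mem_erase, swap, Set.mem_insert_iff, Set.mem_sdiff,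
    Set.mem_singleton_iff]
  by_cases e1 : x = s.1 <;> by_cases e2 : x = s.2 <;> grind

lemma ncard_sdiff_eq_card_excess (Y D : Set α) :
    (Y \ D).ncard = (excess Set.univ Y D).card := by
  rw [card_eq_ncard (T := Y \ D)]; simp [mem_excess]

lemma Step.ncard_add_one (h : Step M B X s) :
    ((swap X s).1 \ B.1).ncard + 1 = (X.1 \ B.1).ncard := by
  classical
  rw [ncard_sdiff_eq_card_excess, ncard_sdiff_eq_card_excess, h.excess_left]
  exact Finset.card_erase_add_one (mem_excess.2 ⟨h.left, trivial⟩)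

open Classical in
/-- The pair `X` is obstructed on the way to `B`. -/
def ObstructedAt (M : Matroid α) (K : Set α) (B X : Set α × Set α) (d : ℕ) : Prop :=
  Obstructed (excess K X.1 B.1) (excess K B.1 X.1) outer (slack M X.1) inner (slack M X.2) d

open Classical in
lemma Step.obstructedAt_swap_iff (h : Step M B X s) :
    ObstructedAt M K B (swap X s) d ↔
      Obstructed ((excess K X.1 B.1).erase s.1) ((excess K B.1 X.1).erase s.2)
        outer (nextSlack outer (slack M X.1) s.1 s.2)
        inner (nextSlack inner (slack M X.2) s.1 s.2) d := by
  rw [← slack_insert_outer h.fst.1 h.fst.2.1, ← slack_insert_inner h.snd.2.1 h.snd.1,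
    ← h.excess_left, ← h.excess_right]
  rfl

/-- Such an exchange takes place outside the main component and touches no cut. -/
lemma Step.obstructedAt_swap_iff_of_notMem (hK : IsMain M K) (hX : IsBasisPair M X)
    (h : Step M B X s) (hs : s.1 ∉ K) :
    ObstructedAt M K B (swap X s) d ↔ ObstructedAt M K B X d := by
  classical
  have hs' : s.2 ∉ K := fun hh => hs ((hK.mem_iff (h.fst.conn hX.1)).2 hh)
  rw [h.obstructedAt_swap_iff, Finset.erase_eq_of_notMem fun hh => hs (mem_excess.1 hh).2,
    Finset.erase_eq_of_notMem fun hh => hs' (mem_excess.1 hh).2]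
  have e1 : nextSlack outer (slack M X.1) s.1 s.2 = slack M X.1 := by
    funext W
    have h1 : s.1 ∉ W.1 := fun hh => hs (hK.sub W hh)
    have h2 : s.2 ∉ W.1 := fun hh => hs' (hK.sub W hh)
    simp [nextSlack, mem_outer, h1, h2]
  have e2 : nextSlack inner (slack M X.2) s.1 s.2 = slack M X.2 := by
    funext W
    have h1 : s.1 ∉ W.1 := fun hh => hs (hK.sub W hh)
    have h2 : s.2 ∉ W.1 := fun hh => hs' (hK.sub W hh)
    simp [nextSlack, mem_inner, h1, h2]
  rw [e1, e2]
  rfl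

/-- A pair of bases `X` on its way to the compatible pair `B`, in a split matroid. -/
structure Position (M : Matroid α) (K : Set α) (B X : Set α × Set α) : Prop where
  ground : M.E = Set.univ
  split : IsSplit M
  main : IsMain M K
  pair : IsBasisPair M X
  target : IsBasisPair M B
  compatible : Compatible X B

lemma Position.next (h : Position M K B X) (hs : Step M B X s) : Position M K B (swap X s) :=
  ⟨h.ground, h.split, h.main, hs.isBasisPair, h.target, hs.compatible h.compatible⟩

open Classical in
lemma Position.outer (h : Position M K B X) :
    SplitSystem (excess K X.1 B.1) (excess K B.1 X.1) outer (slack M X.1) :=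
  h.main.splitSystem_outer h.ground h.split h.pair.1 h.target.1

open Classical in
lemma Position.inner (h : Position M K B X) :
    SplitSystem (excess K X.1 B.1) (excess K B.1 X.1) inner (slack M X.2) := by
  have := h.main.splitSystem_inner h.ground h.split h.pair.2 h.target.2
  rwa [h.compatible.excess_snd, h.compatible.excess_snd_symm] at this

lemma Position.card_eq (h : Position M K B X) :
    (excess K X.1 B.1).card = (excess K B.1 X.1).card :=
  h.main.card_excess h.ground h.pair.1 h.target.1

open Classical in
lemma Position.allowed_outer_iff (h : Position M K B X) (hp : p ∈ excess K X.1 B.1)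
    (hq : q ∈ excess K B.1 X.1) :
    Allowed SplitExchange.outer (slack M X.1) p q ↔ Exch M X.1 p q :=
  h.main.allowed_outer_iff h.ground h.pair.1 hp hq

open Classical in
lemma Position.allowed_inner_iff (h : Position M K B X) (hp : p ∈ excess K X.1 B.1)
    (hq : q ∈ excess K B.1 X.1) :
    Allowed SplitExchange.inner (slack M X.2) p q ↔ Exch M X.2 q p := by
  rw [← h.compatible.excess_snd_symm] at hp
  rw [← h.compatible.excess_snd] at hq
  exact h.main.allowed_inner_iff h.ground h.pair.2 hp hq

open Classical in
lemma Position.step_iff_allowed (h : Position M K B X) (hp : p ∈ excess K X.1 B.1)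
    (hq : q ∈ excess K B.1 X.1) :
    Step M B X (p, q) ↔ Allowed SplitExchange.outer (slack M X.1) p q ∧
      Allowed SplitExchange.inner (slack M X.2) p q := by
  rw [h.allowed_outer_iff hp hq, h.allowed_inner_iff hp hq]
  rw [mem_excess] at hp hq
  exact ⟨fun hs => ⟨hs.fst, hs.snd⟩, fun hs => ⟨hp.1, hq.1, hs.1, hs.2⟩⟩

/-- Outside of the main component there are always exchanges. -/
lemma Position.exists_step_of_notMem (h : Position M K B X) {a : α} (ha : a ∈ X.1 \ B.1)
    (haK : a ∉ K) : ∃ b, Step M B X (a, b) := by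
  have h1 := ncard_sdiff_inter_add X.1 B.1 (cls M a)
  rw [sep_cls h.ground a _ h.target.1, sep_cls h.ground a _ h.pair.1] at h1
  have h2 : 0 < ((X.1 \ B.1) ∩ cls M a).ncard :=
    (Set.ncard_pos (Set.toFinite _)).2 ⟨a, ha, mem_cls_self M a⟩
  obtain ⟨b, hb, hab⟩ := (Set.ncard_pos (Set.toFinite _)).1 (show
    0 < ((B.1 \ X.1) ∩ cls M a).ncard by omega)
  have hmem := h.compatible.mem a
  have hmem' := h.compatible.mem b
  simp only [Set.mem_sdiff] at ha hb
  refine ⟨b, ha, hb, ?_, ?_⟩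
  · by_contra hno
    obtain ⟨W, hW, -⟩ := exists_isCut h.ground h.pair.1 ha.1 hb.2 hab hno
    exact haK (h.main.unique _ _ _ hW ▸ mem_cls_self M a)
  · by_contra hno
    obtain ⟨W, hW, -⟩ := exists_isCut h.ground h.pair.2 (by tauto) (by tauto)
      (Conn.symm hab) hno
    exact haK (h.main.unique _ _ _ hW ▸ (Conn.symm hab : a ∈ cls M b))

lemma Position.obstructedAt_swap (h : Position M K B X) (ho : ObstructedAt M K B X d)
    (hs : Step M B X s) : ObstructedAt M K B (swap X s) d := by
  classical
  by_cases hsK : s.1 ∈ K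
  · have hsK' := (h.main.mem_iff (hs.fst.conn h.pair.1)).1 hsK
    have hp : s.1 ∈ excess K X.1 B.1 := mem_excess.2 ⟨hs.left, hsK⟩
    have hq : s.2 ∈ excess K B.1 X.1 := mem_excess.2 ⟨hs.right, hsK'⟩
    rw [hs.obstructedAt_swap_iff]
    obtain ⟨i₁, i₂, j₁, j₂, ho⟩ := ho
    exact ⟨i₁, i₂, j₁, j₂, ho.next hp hq ((h.allowed_outer_iff hp hq).2 hs.fst)
      ((h.allowed_inner_iff hp hq).2 hs.snd)⟩
  · rwa [hs.obstructedAt_swap_iff_of_notMem h.main h.pair hsK]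

lemma Position.two_mul_le (h : Position M K B X) (ho : ObstructedAt M K B X d) :
    2 * d ≤ (X.1 \ B.1).ncard := by
  classical
  obtain ⟨i₁, i₂, j₁, j₂, ho⟩ := ho
  refine (ho.two_mul_le h.outer h.inner h.card_eq).trans ?_
  rw [ncard_sdiff_eq_card_excess]
  refine Finset.card_le_card fun x hx => ?_
  rw [mem_excess] at hx ⊢
  exact ⟨hx.1, trivial⟩

/-- At a stuck pair everything outside the main component has been exchanged; inside,
`Obstruction.card_eq_of_stuck` applies. -/
lemma Position.ncard_eq_two_mul (h : Position M K B X) (ho : ObstructedAt M K B X d)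
    (hno : ∀ s, ¬ Step M B X s) : (X.1 \ B.1).ncard = 2 * d := by
  classical
  obtain ⟨i₁, i₂, j₁, j₂, ho⟩ := ho
  rw [← ho.card_eq_of_stuck h.outer h.inner h.card_eq fun p hp q hq hpq =>
    hno _ ((h.step_iff_allowed hp hq).2 hpq)]
  refine (card_eq_ncard fun x => ?_).symm
  rw [mem_excess]
  refine ⟨fun hx => hx.1, fun hx => ⟨hx, ?_⟩⟩
  by_contra hK
  obtain ⟨b, hb⟩ := h.exists_step_of_notMem hx hK
  exact hno _ hb

/-- If nothing is left in the main component, the remaining exchanges cannot create an obstruction.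
-/
lemma Position.exists_step (h : Position M K B X) (hne : (X.1 \ B.1).Nonempty)
    (ho : ∀ d, ¬ ObstructedAt M K B X d) :
    ∃ s, Step M B X s ∧ ∀ d, ¬ ObstructedAt M K B (swap X s) d := by
  classical
  by_cases hP : (excess K X.1 B.1).Nonempty
  · obtain ⟨p, hp, q, hq, ha, hb, hd⟩ :=
      exists_allowed_not_obstructed h.outer h.inner h.card_eq hP ho
    have hs := (h.step_iff_allowed hp hq).2 ⟨ha, hb⟩
    exact ⟨(p, q), hs, fun d => by rw [hs.obstructedAt_swap_iff]; exact hd d⟩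
  · obtain ⟨a, ha⟩ := hne
    have haK : a ∉ K := fun haK => hP ⟨a, mem_excess.2 ⟨ha, haK⟩⟩
    obtain ⟨b, hb⟩ := h.exists_step_of_notMem ha haK
    exact ⟨_, hb, fun d => by
      rw [hb.obstructedAt_swap_iff_of_notMem h.main h.pair haK]; exact ho d⟩

/-- Some exchanges towards `B` will be impossible; a condition that an oracle can check. -/
def IsBad (M : Matroid α) (B X : Set α × Set α) : Prop :=
  Pattern (excess Set.univ X.1 B.1) (excess Set.univ B.1 X.1) (Exch M X.1)
    (fun p q => Exch M X.2 q p)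

lemma Position.isBad_iff (h : Position M K B X) : IsBad M B X ↔ ∃ d, ObstructedAt M K B X d := by
  classical
  have e : ∀ Y D : Set α, (excess Set.univ Y D).filter (· ∈ K) = excess K Y D := by
    intro Y D
    ext x
    simp [mem_excess]
  unfold IsBad ObstructedAt
  rw [pattern_filter_iff (· ∈ K) (fun p hp q hq hpq => h.main.mem_iff (hpq.conn h.pair.1))
      (fun p hp q hq hpq => (h.main.mem_iff (hpq.conn h.pair.2)).symm)
      (fun a ha b hb c hc e he h1 h2 h3 h4 => ?_), e, e,
    ← pattern_allowed_iff h.outer h.inner h.card_eq]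
  · exact ⟨Pattern.congr (fun p hp q hq => (h.allowed_outer_iff hp hq).symm)
        (fun p hp q hq => (h.allowed_inner_iff hp hq).symm),
      Pattern.congr (fun p hp q hq => h.allowed_outer_iff hp hq)
        (fun p hp q hq => h.allowed_inner_iff hp hq)⟩
  -- The elements a and b are connected through e, so b and c are in one component. Their missing
  -- exchange comes from a cut, which must lie in the main component.
  · have hab : Conn M a b := (h4.conn h.pair.2).symm.trans (h3.conn h.pair.1).symm
    rw [mem_excess] at hb hc
    obtain ⟨W, hW, -⟩ := exists_isCut h.ground h.pair.1 hb.1.1 hc.1.2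
      (hab.symm.trans (h1.conn h.pair.1)) h2
    exact h.main.unique _ _ _ hW ▸ hab.symm

/-- A sequence of exchanges that avoids bad pairs as long as possible and goes on as long as
possible. -/
inductive Run (M : Matroid α) (B : Set α × Set α) : Set α × Set α → List (α × α) → Prop where
  | stuck (X : Set α × Set α) (h : ∀ s, ¬ Step M B X s) : Run M B X []
  | step (X : Set α × Set α) (s : α × α) (l : List (α × α)) (hs : Step M B X s)
      (hbad : IsBad M B (swap X s) → ∀ s', Step M B X s' → IsBad M B (swap X s'))
      (hl : Run M B (swap X s) l) : Run M B X (s :: l)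

lemma Run.isStrictlyMonotone {l : List (α × α)} (hl : Run M B X l) (hc : Compatible X B) :
    IsStrictlyMonotone M B X l := by
  induction hl with
  | stuck => trivial
  | step X s l hs _ _ ih =>
    have := (step_iff hc).1 hs
    exact ⟨this.1, this.2, ih (hs.compatible hc)⟩

lemma Position.length_le (h : Position M K B X) {l : List (α × α)}
    (hl : IsStrictlyMonotone M B X l) : l.length ≤ (X.1 \ B.1).ncard := by
  induction l generalizing X with
  | nil => simp
  | cons s l ih =>
    obtain ⟨h1, h2, h3⟩ := hl
    have hs := (step_iff h.compatible).2 ⟨h1, h2⟩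
    have := ih (h.next hs) h3
    rw [List.length_cons]
    omega

/-- The obstruction persists with the same d, and 2d elements are always left. -/
lemma Position.length_add_le (h : Position M K B X) (ho : ObstructedAt M K B X d)
    {l : List (α × α)} (hl : IsStrictlyMonotone M B X l) :
    l.length + 2 * d ≤ (X.1 \ B.1).ncard := by
  induction l generalizing X with
  | nil => simpa using h.two_mul_le ho
  | cons s l ih =>
    obtain ⟨h1, h2, h3⟩ := hl
    have hs := (step_iff h.compatible).2 ⟨h1, h2⟩
    have := ih (h.next hs) (h.obstructedAt_swap ho hs) h3
    rw [List.length_cons]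
    omega

lemma Run.length_add_eq {l : List (α × α)} (hl : Run M B X l) (h : Position M K B X)
    (ho : ObstructedAt M K B X d) : l.length + 2 * d = (X.1 \ B.1).ncard := by
  induction hl with
  | stuck X hno => simp [h.ncard_eq_two_mul ho hno]
  | step X s l hs _ _ ih =>
    have := ih (h.next hs) (h.obstructedAt_swap ho hs)
    have := hs.ncard_add_one
    rw [List.length_cons]
    omega

/-- An unobstructed pair has an exchange to an unobstructed pair, so the rule `hbad` keeps the run
unobstructed; it can only get stuck when X₁ = B₁ is reached. -/
lemma Run.length_eq {l : List (α × α)} (hl : Run M B X l) (h : Position M K B X)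
    (ho : ∀ d, ¬ ObstructedAt M K B X d) : l.length = (X.1 \ B.1).ncard := by
  induction hl with
  | stuck X hno =>
    by_contra hne
    obtain ⟨s, hs, -⟩ := h.exists_step ((Set.ncard_pos (Set.toFinite _)).1 (by
      rw [List.length_nil] at hne; omega)) ho
    exact hno s hs
  | step X s l hs hbad _ ih =>
    have hn : ∀ d, ¬ ObstructedAt M K B (swap X s) d := by
      by_contra hcon
      push Not at hcon
      obtain ⟨s', hs', hd⟩ := h.exists_step ⟨_, hs.left⟩ ho
      obtain ⟨d, hd'⟩ := (h.next hs').isBad_iff.1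
        (hbad ((h.next hs).isBad_iff.2 hcon) s' hs')
      exact hd d hd'
    have := ih (h.next hs) hn
    have := hs.ncard_add_one
    rw [List.length_cons]
    omega

/-- Greedy runs are longest. -/
theorem Run.isLongest {l : List (α × α)} (hl : Run M B X l) (hE : M.E = Set.univ)
    (hM : IsSplit M) (hX : IsBasisPair M X) (hB : IsBasisPair M B) (hc : Compatible X B) :
    IsLongestStrictlyMonotone M X B l := by
  obtain ⟨K, hK⟩ := exists_isMain hE hM
  have h : Position M K B X := ⟨hE, hM, hK, hX, hB, hc⟩
  refine ⟨hl.isStrictlyMonotone hc, fun l' hl' => ?_⟩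
  by_cases ho : ∃ d, ObstructedAt M K B X d
  · obtain ⟨d, hd⟩ := ho
    have := hl.length_add_eq h hd
    have := h.length_add_le hd hl'
    omega
  · push Not at ho
    rw [hl.length_eq h ho]
    exact h.length_le hl'

end Game
/-! ### Formulas for the program -/

section Formulas

/-- A term holds if its value is not `0`. -/
def Term.Holds {n : ℕ} (indep : Set (Fin n) → Prop) (t : Term) (reg : ℕ → ℕ) (arr : ℕ → ℕ → ℕ) :
    Prop := t.den indep reg arr ≠ 0

/-- Conjunction. -/
def Term.and (t u : Term) : Term := .ite t u (.ex (.const 0))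

/-- Negation. -/
def Term.not (t : Term) : Term := .ite t (.ex (.const 0)) (.ex (.const 1))

/-- The number of values of a register for which a term holds. -/
def Term.count (v : ℕ) (t : Term) : Term := .sum v (.ite t (.ex (.const 1)) (.ex (.const 0)))

/-- The values of two terms are different. -/
def Term.ne (t u : Term) : Term := .add (.sub t u) (.sub u t)

variable {n : ℕ} {indep : Set (Fin n) → Prop} {reg : ℕ → ℕ} {arr : ℕ → ℕ → ℕ}

@[simp] lemma holds_ex (e : Expr) : (Term.ex e).Holds indep reg arr ↔ e.eval reg arr ≠ 0 := Iff.rfl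

@[simp] lemma holds_and (t u : Term) :
    (t.and u).Holds indep reg arr ↔ t.Holds indep reg arr ∧ u.Holds indep reg arr := by
  simp only [Term.Holds, Term.and, Term.den]
  split_ifs <;> simp_all

@[simp] lemma holds_not (t : Term) : t.not.Holds indep reg arr ↔ ¬ t.Holds indep reg arr := by
  simp only [Term.Holds, Term.not, Term.den]
  split_ifs <;> simp_all

@[simp] lemma holds_add (t u : Term) :
    (Term.add t u).Holds indep reg arr ↔ t.Holds indep reg arr ∨ u.Holds indep reg arr := by
  simp only [Term.Holds, Term.den]
  omega

@[simp] lemma holds_ne (t u : Term) :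
    (t.ne u).Holds indep reg arr ↔ t.den indep reg arr ≠ u.den indep reg arr := by
  simp only [Term.Holds, Term.ne, Term.den]
  omega

/-- Sums of natural numbers serve as existential quantifiers. -/
lemma holds_sum (h : reg 0 = n) (v : ℕ) (t : Term) :
    (Term.sum v t).Holds indep reg arr ↔
      ∃ i : Fin n, t.Holds indep (Function.update reg v i) arr := by
  simp only [Term.Holds, Term.den, h, Finset.sum_range, ne_eq, Finset.sum_eq_zero_iff,
    Finset.mem_univ, true_implies, not_forall]

open Classical in
lemma den_count (h : reg 0 = n) (v : ℕ) (t : Term) :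
    (Term.count v t).den indep reg arr =
      (Finset.univ.filter fun i : Fin n => t.Holds indep (Function.update reg v i) arr).card := by
  rw [Finset.card_filter]
  simp only [Term.count, Term.den, h, Finset.sum_range, Term.Holds, Expr.eval_const]
  exact Finset.sum_congr rfl fun _ _ => by congr

@[simp] lemma holds_update (a : ℕ) (i e : Expr) (t : Term) :
    (Term.update a i e t).Holds indep reg arr ↔ t.Holds indep reg
      (Function.update arr a (Function.update (arr a) (i.eval reg arr) (e.eval reg arr))) := Iff.rfl

@[simp] lemma holds_query (a : ℕ) :
    (Term.query a).Holds indep reg arr ↔ indep {i | arr a i ≠ 0} := by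
  simp [Term.Holds, Term.den]

/-- The set in array `a` remains independent when `x` is replaced by `y`. -/
def exchTerm (a x y : ℕ) : Term :=
  .update a (.var x) (.const 0) (.update a (.var y) (.const 1) (.query a))

/-- The element `x` is in the set in array `a` but not in that in array `b`. -/
def memTerm (a b x : ℕ) : Term :=
  (Term.ex (.get a (.var x))).and (Term.ex (.get b (.var x))).not

/-- The first and the second of two conditions of an obstruction at the elements `x` and `y`. -/
def clashTerm (x y z w : ℕ) : Term :=
  .add ((exchTerm 0 x y).and (exchTerm 0 z w)) ((exchTerm 1 y x).and (exchTerm 1 w z))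

/-- The condition on the elements in registers `8` to `11` to be witnesses of a bad pair. -/
def witnessTerm : Term :=
  (exchTerm 0 8 10).and <| (exchTerm 0 8 11).not.and <| (exchTerm 0 9 10).not.and <|
  (exchTerm 0 9 11).and <| (exchTerm 1 11 8).and <| (exchTerm 1 10 8).not.and <|
  (exchTerm 1 10 9).and <| (exchTerm 1 11 9).not.and <|
  (Term.sum 12 ((memTerm 0 2 12).and (clashTerm 12 10 12 11))).not.and <|
  (Term.sum 12 ((memTerm 2 0 12).and (clashTerm 8 12 9 12))).not.and <|
  (Term.count 12 ((memTerm 0 2 12).and ((exchTerm 0 12 10).and (exchTerm 1 11 12)))).ne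
    (Term.count 12 ((memTerm 2 0 12).and ((exchTerm 0 8 12).and (exchTerm 1 12 8))))

/-- The pair in arrays `0` and `1` is bad on the way to the set in array `2`. -/
def badTerm : Term :=
  .sum 8 <| (memTerm 0 2 8).and <| .sum 9 <| (memTerm 0 2 9).and <|
  .sum 10 <| (memTerm 2 0 10).and <| .sum 11 <| (memTerm 2 0 11).and witnessTerm

/-- The elements in registers `5` and `6` define an exchange. -/
def stepTerm : Term :=
  (memTerm 0 2 5).and <| (memTerm 2 0 6).and <| (exchTerm 0 5 6).and (exchTerm 1 6 5)

/-- The pair that results from an exchange is bad. -/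
def badAfterTerm : Term :=
  .update 0 (.var 5) (.const 0) <| .update 0 (.var 6) (.const 1) <|
  .update 1 (.var 6) (.const 0) <| .update 1 (.var 5) (.const 1) badTerm

/-- The value of an exchange. -/
def scoreTerm : Term :=
  .ite stepTerm (.ite badAfterTerm (.ex (.const 1)) (.ex (.const 2))) (.ex (.const 0))

/-- The arrays hold the pair `X` and the first member of `B`. -/
structure Holding (arr : ℕ → ℕ → ℕ) (B X : Set (Fin n) × Set (Fin n)) : Prop where
  fst (i : Fin n) : arr 0 i ≠ 0 ↔ i ∈ X.1
  snd (i : Fin n) : arr 1 i ≠ 0 ↔ i ∈ X.2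
  target (i : Fin n) : arr 2 i ≠ 0 ↔ i ∈ B.1

variable {B X : Set (Fin n) × Set (Fin n)} {M : Matroid (Fin n)}

/-- Replacement of an element in an array. -/
def exchArr (f : ℕ → ℕ) (x y : ℕ) : ℕ → ℕ := Function.update (Function.update f x 0) y 1

lemma exchArr_ne_zero_iff {f : ℕ → ℕ} {Y : Set (Fin n)} (hf : ∀ i : Fin n, f i ≠ 0 ↔ i ∈ Y)
    (x y i : Fin n) : exchArr f x y i ≠ 0 ↔ i ∈ insert y (Y \ {x}) := by
  have := hf i
  simp only [exchArr, Function.update_apply, Fin.val_inj, Set.mem_insert_iff, Set.mem_sdiff,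
    Set.mem_singleton_iff]
  split_ifs <;> simp_all

lemma holds_exchTerm (a x y : ℕ) :
    (exchTerm a x y).Holds indep reg arr ↔
      indep {i : Fin n | exchArr (arr a) (reg x) (reg y) i ≠ 0} := by
  simp [exchTerm, exchArr]

lemma holds_memTerm (a b x : ℕ) :
    (memTerm a b x).Holds indep reg arr ↔ arr a (reg x) ≠ 0 ∧ ¬ arr b (reg x) ≠ 0 := by
  simp [memTerm]

lemma Holding.setOf_fst (h : Holding arr B X) (x y : Fin n) :
    {i : Fin n | exchArr (arr 0) x y i ≠ 0} = insert y (X.1 \ {x}) :=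
  Set.ext fun i => exchArr_ne_zero_iff h.fst x y i

lemma Holding.setOf_snd (h : Holding arr B X) (x y : Fin n) :
    {i : Fin n | exchArr (arr 1) x y i ≠ 0} = insert y (X.2 \ {x}) :=
  Set.ext fun i => exchArr_ne_zero_iff h.snd x y i

lemma Holding.swap (h : Holding arr B X) (x y : Fin n) :
    Holding (Function.update (Function.update arr 0 (exchArr (arr 0) x y)) 1
      (exchArr (arr 1) y x)) B (swap X (x, y)) where
  fst i := by simpa [SplitExchange.swap] using exchArr_ne_zero_iff h.fst x y i
  snd i := by simpa [SplitExchange.swap] using exchArr_ne_zero_iff h.snd y x i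
  target i := by simpa using h.target i

lemma holds_badTerm_iff_pattern (h : Holding arr B X) (h0 : reg 0 = n) :
    badTerm.Holds M.Indep reg arr ↔
      Pattern (excess Set.univ X.1 B.1) (excess Set.univ B.1 X.1)
        (fun p q => M.Indep (insert q (X.1 \ {p}))) (fun p q => M.Indep (insert p (X.2 \ {q}))) := by
  classical
  simp only [badTerm, witnessTerm, clashTerm, holds_sum, h0, holds_and, holds_not, holds_add,
    holds_ne, den_count, holds_exchTerm, holds_memTerm, Function.update_self, Function.update_of_ne,
    ne_eq, OfNat.zero_ne_ofNat, Nat.reduceEqDiff, not_false_eq_true]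
  simp only [← ne_eq, h.setOf_fst, h.setOf_snd, h.fst, h.target]
  unfold Pattern
  simp only [mem_excess, Set.mem_univ, and_true]
  simp only [not_exists, not_and, not_or]
  -- The term follows `Pattern` clause by clause: four quantifiers, ten conditions, and the
  -- inequality of the two counts.
  iterate 4 refine exists_congr fun _ => and_congr_right fun _ => ?_
  iterate 10 refine and_congr_right fun _ => ?_
  refine not_congr (Eq.congr ?_ ?_) <;>
  · congr 1
    ext x
    simp [mem_excess]

lemma indep_iff_exch {Y : Set (Fin n)} {p q : Fin n} (hY : M.IsBase Y) (hp : p ∈ Y) (hq : q ∉ Y) :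
    M.Indep (insert q (Y \ {p})) ↔ Exch M Y p q :=
  ⟨fun hi => ⟨hp, hq, hY.exchange_isBase_of_indep hq hi⟩, fun hx => hx.2.2.indep⟩

lemma holds_badTerm_iff (h : Holding arr B X) (h0 : reg 0 = n) (hX : IsBasisPair M X)
    (hc : Compatible X B) : badTerm.Holds M.Indep reg arr ↔ IsBad M B X := by
  have h1 : ∀ p ∈ excess Set.univ X.1 B.1, ∀ q ∈ excess Set.univ B.1 X.1,
      (M.Indep (insert q (X.1 \ {p})) ↔ Exch M X.1 p q) := by
    intro p hp q hq
    rw [mem_excess] at hp hq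
    exact indep_iff_exch hX.1 hp.1.1 hq.1.2
  have h2 : ∀ p ∈ excess Set.univ X.1 B.1, ∀ q ∈ excess Set.univ B.1 X.1,
      (M.Indep (insert p (X.2 \ {q})) ↔ Exch M X.2 q p) := by
    intro p hp q hq
    rw [mem_excess] at hp hq
    have := hc.mem p
    have := hc.mem q
    exact indep_iff_exch hX.2 (by tauto) (by tauto)
  rw [holds_badTerm_iff_pattern h h0]
  exact ⟨Pattern.congr h1 h2, Pattern.congr (fun p hp q hq => (h1 p hp q hq).symm)
    fun p hp q hq => (h2 p hp q hq).symm⟩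

lemma holds_stepTerm_iff (h : Holding arr B X) (hX : IsBasisPair M X) (hc : Compatible X B)
    {p q : Fin n} (hp : reg 5 = p) (hq : reg 6 = q) :
    stepTerm.Holds M.Indep reg arr ↔ Step M B X (p, q) := by
  simp only [stepTerm, holds_and, holds_exchTerm, holds_memTerm, hp, hq, h.setOf_fst, h.setOf_snd,
    h.fst, h.target]
  have h1 := hc.mem p
  have h2 := hc.mem q
  constructor
  · rintro ⟨hp, hq, h3, h4⟩
    exact ⟨hp, hq, (indep_iff_exch hX.1 hp.1 hq.2).1 h3,
      (indep_iff_exch hX.2 (by tauto) (by tauto)).1 h4⟩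
  · intro hs
    exact ⟨hs.left, hs.right, hs.fst.2.2.indep, hs.snd.2.2.indep⟩

lemma holds_badAfterTerm_iff (h : Holding arr B X) (hc : Compatible X B) (h0 : reg 0 = n)
    {p q : Fin n} (hp : reg 5 = p) (hq : reg 6 = q) (hs : Step M B X (p, q)) :
    badAfterTerm.Holds M.Indep reg arr ↔ IsBad M B (swap X (p, q)) := by
  rw [← holds_badTerm_iff (h.swap p q) h0 hs.isBasisPair (hs.compatible hc)]
  simp [badAfterTerm, exchArr, hp, hq]

open Classical in
/-- The value of an exchange: `2` if it leads to a pair that is not bad, `1` if it leads to a bad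
pair, and `0` if it is not an exchange towards `B`. -/
noncomputable def score (M : Matroid (Fin n)) (B X : Set (Fin n) × Set (Fin n))
    (s : Fin n × Fin n) : ℕ :=
  if Step M B X s then if IsBad M B (swap X s) then 1 else 2 else 0

lemma den_scoreTerm (h : Holding arr B X) (hX : IsBasisPair M X) (hc : Compatible X B)
    (h0 : reg 0 = n) {p q : Fin n} (hp : reg 5 = p) (hq : reg 6 = q) :
    scoreTerm.den M.Indep reg arr = score M B X (p, q) := by
  have h1 := holds_stepTerm_iff h hX hc hp hq
  simp only [Term.Holds] at h1
  simp only [scoreTerm, Term.den, score]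
  by_cases hs : Step M B X (p, q)
  · have h2 := holds_badAfterTerm_iff h hc h0 hp hq hs
    simp only [Term.Holds] at h2
    rw [if_pos (h1.2 hs), if_pos hs]
    by_cases hb : IsBad M B (swap X (p, q))
    · rw [if_pos (h2.2 hb), if_pos hb]
      rfl
    · rw [if_neg fun hh => hb (h2.1 hh), if_neg hb]
      rfl
  · rw [if_neg fun hh => hs (h1.1 hh), if_neg hs]
    rfl

end Formulas
/-! ### The program -/

section Algorithm

/-- Evaluate the exchange in registers `5` and `6` and keep it if it is the best so far. -/
def tryExchange : Program :=
  -- The registers of `scoreTerm` are below 20, so its scratch memory starts there. The truncated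
  -- difference is nonzero exactly if the new value beats the best one so far.
  .seq (scoreTerm.compile 20) <| .ite (.sub (.var 20) (.var 2))
    (.seq (.assign 2 (.var 20)) (.seq (.assign 3 (.var 5)) (.assign 4 (.var 6)))) .skip

/-- Find an exchange of largest value. -/
def search : Program :=
  .seq (.assign 2 (.const 0)) (.loop 5 (.var 0) (.loop 6 (.var 0) tryExchange))

/-- Perform the exchange that has been found and append it to the output. -/
def perform : Program :=
  .seq (.store 0 (.var 3) (.const 0)) <| .seq (.store 0 (.var 4) (.const 1)) <|
  .seq (.store 1 (.var 4) (.const 0)) <| .seq (.store 1 (.var 3) (.const 1)) <|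
  .seq (.store 4 (.var 1) (.var 3)) <| .seq (.store 5 (.var 1) (.var 4)) <|
  .assign 1 (.add (.var 1) (.const 1))

/-- As often as there are elements: find a best exchange and perform it. -/
def greedy : Program := .loop 7 (.var 0) (.seq search (.ite (.var 2) perform .skip))

lemma greedy_tame : greedy.Tame := by
  have h : scoreTerm.Tame := by
    simp [scoreTerm, stepTerm, badAfterTerm, badTerm, witnessTerm, clashTerm, memTerm, exchTerm,
      Term.Tame, Term.and, Term.not, Term.ne, Term.count]
  have h' := h.compile (d := 20) (by norm_num)
  simp [greedy, search, tryExchange, perform, Program.Tame, h']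

lemma bound_scoreTerm : scoreTerm.bound ≤ 20 := by
  simp [scoreTerm, stepTerm, badAfterTerm, badTerm, witnessTerm, clashTerm, memTerm, exchTerm,
    Term.bound, Expr.bound, Term.and, Term.not, Term.ne, Term.count]

variable {n : ℕ} {M : Matroid (Fin n)} {B X A : Set (Fin n) × Set (Fin n)}

/-- The state of the search after the exchanges in `V` have been tried. -/
structure Searching (M : Matroid (Fin n)) (B X : Set (Fin n) × Set (Fin n)) (len : ℕ)
    (arr : ℕ → ℕ → ℕ) (V : Fin n → Fin n → Prop) (s : Config) : Prop where
  size : s.reg 0 = n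
  len_eq : s.reg 1 = len
  arr_eq : s.arr = arr
  le : ∀ p q, V p q → score M B X (p, q) ≤ s.reg 2
  best : s.reg 2 ≠ 0 → ∃ p q : Fin n, s.reg 3 = p ∧ s.reg 4 = q ∧ s.reg 2 = score M B X (p, q)

variable {len : ℕ} {arr : ℕ → ℕ → ℕ} {V V' : Fin n → Fin n → Prop} {s : Config}

lemma Searching.of_reg {s' : Config} (h : Searching M B X len arr V s)
    (hr : ∀ v < 5, s'.reg v = s.reg v) (ha : s'.arr = s.arr) (hV : ∀ p q, V' p q → V p q) :
    Searching M B X len arr V' s' where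
  size := by rw [hr 0 (by norm_num), h.size]
  len_eq := by rw [hr 1 (by norm_num), h.len_eq]
  arr_eq := by rw [ha, h.arr_eq]
  le p q hpq := by rw [hr 2 (by norm_num)]; exact h.le p q (hV p q hpq)
  best := by
    rw [hr 2 (by norm_num), hr 3 (by norm_num), hr 4 (by norm_num)]
    exact h.best

lemma Searching.tryExchange (ha : Holding arr B X) (hX : IsBasisPair M X) (hc : Compatible X B)
    (h : Searching M B X len arr V s) {p q : Fin n} (hp : s.reg 5 = p) (hq : s.reg 6 = q)
    (hV : ∀ p' q', V' p' q' → V p' q' ∨ p' = p ∧ q' = q) :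
    Searching M B X len arr V' (tryExchange.exec M.Indep s) ∧
      (tryExchange.exec M.Indep s).reg 5 = p := by
  obtain ⟨c1, c2, c3⟩ := scoreTerm.exec_compile M.Indep 20 bound_scoreTerm s
  rw [h.arr_eq, den_scoreTerm ha hX hc h.size hp hq] at c1
  rw [h.arr_eq] at c3
  simp only [SplitExchange.tryExchange, exec_seq_reg, exec_ite, tick_reg, tick_arr, Expr.eval_sub,
    Expr.eval_var, c1, c2 2 (by norm_num)]
  split_ifs with hlt
  · refine ⟨⟨?_, ?_, ?_, fun p' q' hV' => ?_, fun _ => ⟨p, q, ?_, ?_, ?_⟩⟩, ?_⟩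
    · simp [c2 0, h.size]
    · simp [c2 1, h.len_eq]
    · simp [c3]
    · simp only [exec_assign_reg, tick_reg, tick_arr, Expr.eval_var, ne_eq,
        Nat.reduceEqDiff, not_false_eq_true, Function.update_of_ne, Function.update_self, c1]
      rcases hV p' q' hV' with h' | ⟨rfl, rfl⟩
      · have := h.le p' q' h'
        omega
      · exact le_rfl
    · simp [c2 5, hp]
    · simp [c2 6, hq]
    · simp [c1]
    · simp [c2 5, hp]
  · refine ⟨⟨?_, ?_, ?_, fun p' q' hV' => ?_, ?_⟩, ?_⟩
    · simp [Program.exec, c2 0, h.size]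
    · simp [Program.exec, c2 1, h.len_eq]
    · simp [Program.exec, c3]
    · simp only [Program.exec, tick_reg, c2 2 (by norm_num : 2 < 20)]
      rcases hV p' q' hV' with h' | ⟨rfl, rfl⟩
      · exact h.le p' q' h'
      · omega
    · simpa [Program.exec, c2 2, c2 3, c2 4] using h.best
    · simp [Program.exec, c2 5, hp]

lemma exec_search (ha : Holding arr B X) (hX : IsBasisPair M X) (hc : Compatible X B)
    (h0 : s.reg 0 = n) (h1 : s.reg 1 = len) (harr : s.arr = arr) :
    Searching M B X len arr (fun _ _ => True) (search.exec M.Indep s) := by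
  simp only [search, exec_seq_reg]
  set s₁ := ((Program.assign 2 (.const 0)).exec M.Indep s).tick 1 with hs₁
  have e₁ : s₁.reg 0 = n := by simp [hs₁, h0]
  have key := exec_loop_induction M.Indep (v := 5) (e := .var 0)
    (c := .loop 6 (.var 0) tryExchange) (s := s₁)
    (fun k r => Searching M B X len arr (fun p _ => (p : ℕ) < k) r) ?_ ?_
  · simp only [Expr.eval_var, e₁] at key
    exact key.of_reg (fun _ _ => rfl) rfl fun p _ _ => p.2
  · refine ⟨by simp [e₁], by simp [hs₁, h1], by simp [hs₁, harr], fun p _ h => ?_, fun h => ?_⟩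
    · exact absurd h (Nat.not_lt_zero _)
    · exact absurd (by simp [hs₁]) h
  · intro k r hk hr
    simp only [Expr.eval_var, e₁] at hk
    set r₁ := (r.setReg 5 k).tick 1 with hr₁
    have e₂ : r₁.reg 0 = n := by simp [hr₁, hr.size]
    have key := exec_loop_induction M.Indep (v := 6) (e := .var 0) (c := tryExchange) (s := r₁)
      -- The pairs tried so far form an initial segment of the lexicographic order.
      (fun j t => Searching M B X len arr (fun p q => (p : ℕ) < k ∨ (p : ℕ) = k ∧ (q : ℕ) < j) t ∧
        t.reg 5 = k) ?_ ?_
    · simp only [Expr.eval_var, e₂] at key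
      refine key.1.of_reg (fun _ _ => rfl) rfl fun p q hp => ?_
      have := q.2
      omega
    · refine ⟨hr.of_reg (fun v hv => ?_) rfl fun p q hp => by omega, by simp [hr₁]⟩
      simp [hr₁, show v ≠ 5 by omega]
    · rintro j t hj ⟨ht, ht5⟩
      simp only [Expr.eval_var, e₂] at hj
      have ht' : Searching M B X len arr (fun p q => (p : ℕ) < k ∨ (p : ℕ) = k ∧ (q : ℕ) < j)
          ((t.setReg 6 j).tick 1) :=
        ht.of_reg (fun v hv => by simp [show v ≠ 6 by omega]) rfl fun _ _ h => h
      exact ht'.tryExchange ha hX hc (p := ⟨k, hk⟩) (q := ⟨j, hj⟩) (by simp [ht5]) (by simp)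
        fun p' q' h => by
          simp only [Fin.ext_iff]
          omega

/-- The state between two exchanges: `X` is the current pair, and `l` the output so far. -/
structure Between (M : Matroid (Fin n)) (B A X : Set (Fin n) × Set (Fin n))
    (l : List (Fin n × Fin n)) (s : Config) : Prop where
  size : s.reg 0 = n
  output : s.Outputs l
  holding : Holding s.arr B X
  pair : IsBasisPair M X
  compatible : Compatible X B
  -- Runs are built from the front but the output grows at the end, so the invariant quantifies over
  -- all continuations.
  run : ∀ l', Run M B X l' → Run M B A (l ++ l')

lemma score_ne_zero_iff {x : Fin n × Fin n} : score M B X x ≠ 0 ↔ Step M B X x := by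
  unfold score
  split_ifs with h <;> simp [h]

lemma exec_perform {indep : Set (Fin n) → Prop} (s : Config) :
    (perform.exec indep s).reg = Function.update s.reg 1 (s.reg 1 + 1) ∧
    (perform.exec indep s).arr 0 = exchArr (s.arr 0) (s.reg 3) (s.reg 4) ∧
    (perform.exec indep s).arr 1 = exchArr (s.arr 1) (s.reg 4) (s.reg 3) ∧
    (perform.exec indep s).arr 2 = s.arr 2 ∧
    (perform.exec indep s).arr 4 = Function.update (s.arr 4) (s.reg 1) (s.reg 3) ∧
    (perform.exec indep s).arr 5 = Function.update (s.arr 5) (s.reg 1) (s.reg 4) := by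
  simp [perform, exchArr]

lemma Between.round {l : List (Fin n × Fin n)} (h : Between M B A X l s) :
    (∀ x, ¬ Step M B X x) ∧ Between M B A X l
        ((Program.seq search (.ite (.var 2) perform .skip)).exec M.Indep s) ∨
      ∃ x, Step M B X x ∧ Between M B A (swap X x) (l ++ [x])
        ((Program.seq search (.ite (.var 2) perform .skip)).exec M.Indep s) := by
  have hs := exec_search h.holding h.pair h.compatible h.size h.output.1 rfl
  rw [exec_seq_reg, exec_ite]
  set r := search.exec M.Indep s with hr
  by_cases hb : (Expr.var 2).eval (r.tick 1).reg (r.tick 1).arr ≠ 0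
  · rw [if_pos hb]
    simp only [tick_reg, Expr.eval_var] at hb
    right
    obtain ⟨p, q, hp, hq, hpq⟩ := hs.best hb
    have hstep : Step M B X (p, q) := score_ne_zero_iff.1 (hpq ▸ hb)
    obtain ⟨e1, e2, e3, e4, e5, e6⟩ :=
      exec_perform (indep := M.Indep) ((r.tick 1).tick ((Expr.var 2).cost + 1))
    simp only [tick_reg, tick_arr, hp, hq, hs.len_eq, hs.arr_eq] at e1 e2 e3 e4 e5 e6
    refine ⟨(p, q), hstep, ?_, ⟨?_, fun i hi => ?_⟩, ⟨?_, ?_, ?_⟩, hstep.isBasisPair,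
      hstep.compatible h.compatible, fun l' hl' => ?_⟩
    · simp [e1, hs.size]
    · simp [e1]
    · rw [e5, e6]
      rw [List.length_append, List.length_singleton] at hi
      rcases Nat.lt_succ_iff_lt_or_eq.1 hi with hi' | rfl
      · have := h.output.2 i hi'
        simpa [hi'.ne, List.getElem_append_left hi'] using this
      · simp
    · rw [e2]
      exact exchArr_ne_zero_iff h.holding.fst p q
    · rw [e3]
      exact exchArr_ne_zero_iff h.holding.snd q p
    · rw [e4]
      exact h.holding.target
    · rw [List.append_assoc]
      refine h.run _ (.step X _ _ hstep (fun hbad x hx => ?_) hl')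
      -- The chosen exchange has the largest score. If it leads to a bad pair, this score is 1, so
      -- no exchange has score 2.
      have h1 := hs.le x.1 x.2 trivial
      rw [hpq] at h1
      by_contra hx'
      simp [score, hstep, hbad, hx, hx'] at h1
  · rw [if_neg hb]
    simp only [tick_reg, Expr.eval_var] at hb
    left
    have hb' : r.reg 2 = 0 := by simpa using hb
    refine ⟨fun x hx => ?_, ?_⟩
    · have := hs.le x.1 x.2 trivial
      rw [hb', Nat.le_zero] at this
      exact score_ne_zero_iff.2 hx this
    · refine ⟨hs.size, ⟨hs.len_eq, ?_⟩, ?_, h.pair, h.compatible, h.run⟩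
      · simp only [Program.exec, tick_arr, hs.arr_eq]
        exact h.output.2
      · simp only [Program.exec, tick_arr, hs.arr_eq]
        exact h.holding

lemma charVec_ne_zero_iff (Y : Set (Fin n)) (i : Fin n) : charVec Y i ≠ 0 ↔ i ∈ Y := by
  simp [charVec]

lemma Between.of_tick {l : List (Fin n × Fin n)} (h : Between M B A X l s) {s' : Config}
    (hr : ∀ v < 2, s'.reg v = s.reg v) (ha : s'.arr = s.arr) : Between M B A X l s' where
  size := by rw [hr 0 (by norm_num), h.size]
  output := by
    unfold Config.Outputs
    rw [hr 1 (by norm_num), ha]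
    exact h.output
  holding := ha ▸ h.holding
  pair := h.pair
  compatible := h.compatible
  run := h.run

theorem exec_greedy (hA : IsBasisPair M A) (hc : Compatible A B) :
    ∃ l, (greedy.exec M.Indep (startConfig A B)).Outputs l ∧ Run M B A l := by
  have key := exec_loop_induction M.Indep (v := 7) (e := .var 0)
    (c := .seq search (.ite (.var 2) perform .skip)) (s := startConfig A B)
    -- Each round decreases |X₁ \ B₁| or finds the pair stuck, in which case pair and output stay as
    -- they are. As |A₁ \ B₁| ≤ n, n rounds suffice.
    (fun k r => ∃ X l, Between M B A X l r ∧
      ((∀ x, ¬ Step M B X x) ∨ (X.1 \ B.1).ncard + k ≤ n)) ?_ ?_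
  · obtain ⟨X, l, h, hX⟩ := key
    refine ⟨l, h.output, ?_⟩
    have hno : ∀ x, ¬ Step M B X x := by
      rcases hX with hX | hX
      · exact hX
      · intro x hx
        have := (Set.ncard_pos (Set.toFinite _)).2 ⟨_, hx.left⟩
        have e : (Expr.var 0).eval (startConfig A B).reg (startConfig A B).arr = n := rfl
        omega
    have := h.run [] (.stuck X hno)
    rwa [List.append_nil] at this
  · refine ⟨A, [], ⟨rfl, ⟨rfl, fun i hi => absurd hi (Nat.not_lt_zero i)⟩,
      ⟨charVec_ne_zero_iff _, charVec_ne_zero_iff _, charVec_ne_zero_iff _⟩, hA, hc,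
      fun l hl => hl⟩, .inr ?_⟩
    have := Set.ncard_le_card (A.1 \ B.1)
    simpa using this
  · rintro k r - ⟨X, l, h, hX⟩
    have h' : Between M B A X l ((r.setReg 7 k).tick 1) :=
      h.of_tick (fun v hv => by simp [show v ≠ 7 by omega]) rfl
    rcases h'.round with ⟨hno, hb⟩ | ⟨x, hx, hb⟩
    · exact ⟨X, l, hb, .inl hno⟩
    · refine ⟨_, _, hb, .inr ?_⟩
      have := hx.ncard_add_one
      rcases hX with hX | hX
      · exact absurd hx (hX x)
      · omega

end Algorithm
end SplitExchange

open SplitExchange in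
theorem theorem4p1 :
    ∃ (algorithm : Program) (p : Polynomial ℕ),
      ∀ (n : ℕ) (M : Matroid (Fin n)), M.E = Set.univ → IsSplit M →
        ∀ A B : Set (Fin n) × Set (Fin n), IsBasisPair M A → IsBasisPair M B → Compatible A B →
          (algorithm.exec M.Indep (startConfig A B)).calls ≤ p.eval n ∧
          (algorithm.exec M.Indep (startConfig A B)).steps ≤ p.eval n ∧
          ∃ l : List (Fin n × Fin n),
            (algorithm.exec M.Indep (startConfig A B)).Outputs l ∧
              IsLongestStrictlyMonotone M A B l := by
  refine ⟨greedy, greedy.time, fun n M hE hM A B hA hB hc => ?_⟩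
  obtain ⟨-, h1, h2⟩ := greedy_tame.exec_le M.Indep (startConfig A B)
  obtain ⟨l, hl, hrun⟩ := exec_greedy hA hc
  exact ⟨by simpa [startConfig] using h1, by simpa [startConfig] using h2, l, hl,
    hrun.isLongest hE hM hA hB hc⟩
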